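/- **Systems.** Let $\mathbb F$ be a field. A PC (polynomial calculus) refutation of a set $Q\subseteq\mathbb F[x_1,x_2,\dots]$ is a finite sequence of commutative polynomials ending in $1$ in which every line is an element of $Q$, an axiom $x(1-x)$, a product $x\cdot q$ of a variable with an earlier line $q$, or a linear combination $a q+b q'$ ($a,b\in\mathbb F$) of earlier lines. Fix a linear order $\preceq$ on the variables, and for a commutative polynomial $f$ let $[\![f]\!]$ be the noncommutative polynomial obtained by writing every monomial of $f$ in $\preceq$-nondecreasing order. An *ordered formula* is a noncommutative arithmetic formula (a binary tree with leaves labelled by variables or field elements and inner nodes labelled $+$ or $\times$) each of whose subformulas computes a polynomial of the form $[\![f]\!]$; its size is its number of nodes. An *OFPC refutation* of $Q$ is a PC refutation of $Q$ each line $f$ of which is written as an arbitrarily chosen ordered formula computing $[\![f]\!]$; its size is the total size of these formulas. PCR (polynomial calculus with resolution) is defined as PC, with additional formal variables $\bar x$ and with the axioms $x\bar x$ and $x+\bar x-1$ in place of $x(1-x)$; the size of a PCR refutation is the total number of monomials (with nonzero coefficient) in its lines. A CNF is given to OFPC by the polynomials $\prod_{x\in C}(x-1)\prod_{\neg x\in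 C}x$, and to PCR by the monomials $\prod_{x\in C}\bar x\prod_{\neg x\in C}x$, for its clauses $C$. **Tseitin formulas.** Let $G$ be a finite simple undirected graph with vertex set $V$, let $p\ge 1$ be an integer, and let $c:V\to\mathbb Z/p$ satisfy $\sum_{v\in V}c(v)\neq 0$ (for instance $c\equiv 1$ and $p\nmid |V|$). Replace every edge by two opposite directed edges $e,\bar e$. The Tseitin mod $p$ formula of $(G,c)$ has a variable $x_{e,i}$ for every directed edge $e$ and every $i\in\mathbb Z/p$, and the clauses: $\bigvee_i x_{e,i}$ for all $e$; $\neg x_{e,i}\vee\neg x_{e,j}$ for all $e$ and $i\ne j$; $\neg x_{e,i}\vee x_{\bar e,-i}$ and $x_{e,i}\vee\neg x_{\bar e,-i}$ for all $e,i$; and, for every vertex $v$ with outgoing edges $e_1,\dots,e_r$ and all $j_1,\dots,j_r\in\mathbb Z/p$ with $j_1+\dots+j_r\ne c(v)$, the clause $\bigvee_k\neg x_{e_k,j_k}$. **Corollary.** (1) For all $r$ and $p$ there are polynomials $B,T$ with natural number coefficients such that for every $r$-regular finite simple graph $G$ with $n$ vertices, every $c$ as above, every field $\mathbb F$ with at least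 $T(n)$ elements (possibly infinite), and every linear order on the variables $x_{e,i}$, the Tseitin mod $p$ formula of $(G,c)$ has an OFPC refutation over $\mathbb F$ of size at most $B(n)$. (2) For every infinite field $\mathbb F$ and every linear order on the variables $x_0,x_1,x_2,\dots$, OFPC over $\mathbb F$ is strictly stronger than PCR over $\mathbb F$ as a refutation system for CNFs: there is a polynomial $B$ such that every finite CNF with a PCR refutation of size $s$ has an OFPC refutation of size at most $B(s)$, while there is no polynomial $B$ such that every finite CNF with an OFPC refutation of size $s$ has a PCR refutation of size at most $B(s)$. -/

import Mathlib

noncomputable section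

/-! ### Noncommutative formulas and ordered formulas -/

/-- Noncommutative algebraic formulas over `F` in the variables `σ`: binary trees, leaves labelled
by variables or field elements, inner nodes labelled `+` or `×` with ordered children. -/
inductive NCFormula (F σ : Type*) where
  | var (x : σ) : NCFormula F σ
  | const (c : F) : NCFormula F σ
  | add (f g : NCFormula F σ) : NCFormula F σ
  | mul (f g : NCFormula F σ) : NCFormula F σ

/-- The number of nodes of the tree. -/
def NCFormula.size {F σ : Type*} : NCFormula F σ → ℕ
  | .var _ => 1
  | .const _ => 1
  | .add f g => f.size + g.size + 1
  | .mul f g => f.size + g.size + 1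

/-- The noncommutative polynomial computed by a formula, in the free algebra `F⟨σ⟩`. -/
def NCFormula.eval {F σ : Type*} [Field F] : NCFormula F σ → FreeAlgebra F σ
  | .var x => FreeAlgebra.ι F x
  | .const c => algebraMap F (FreeAlgebra F σ) c
  | .add f g => f.eval + g.eval
  | .mul f g => f.eval * g.eval

/-- The set of all subformulas of a formula (the formula itself included). -/
def NCFormula.subformulas {F σ : Type*} : NCFormula F σ → Set (NCFormula F σ)
  | .var x => {.var x}
  | .const c => {.const c}
  | .add f g => insert (.add f g) (f.subformulas ∪ g.subformulas)
  | .mul f g => insert (.mul f g) (f.subformulas ∪ g.subformulas)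

/-- The product of the variables of a commutative monomial (with multiplicities), multiplied in
nondecreasing order with respect to the linear order `ord`. -/
def orderedMonomial (F : Type*) [Field F] {σ : Type*} (ord : LinearOrder σ) (m : σ →₀ ℕ) :
    FreeAlgebra F σ :=
  letI := ord
  (((Finsupp.toMultiset m).sort (· ≤ ·)).map (FreeAlgebra.ι F)).prod

/-- The map `f ↦ ⟦f⟧` from commutative to noncommutative polynomials which writes every monomial
in nondecreasing order. -/
def orderedPoly {F σ : Type*} [Field F] (ord : LinearOrder σ) (f : MvPolynomial σ F) :
    FreeAlgebra F σ :=
  ∑ m ∈ f.support, MvPolynomial.coeff m f • orderedMonomial F ord m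

/-- An ordered formula: each of its subformulas computes an ordered polynomial. -/
def NCFormula.IsOrdered {F σ : Type*} [Field F] (ord : LinearOrder σ) (Φ : NCFormula F σ) : Prop :=
  ∀ Ψ ∈ Φ.subformulas, ∃ f : MvPolynomial σ F, Ψ.eval = orderedPoly ord f

/-- `Φ` is an ordered formula computing the commutative polynomial `f`. -/
def NCFormula.ComputesOrdered {F σ : Type*} [Field F] (ord : LinearOrder σ) (Φ : NCFormula F σ)
    (f : MvPolynomial σ F) : Prop :=
  Φ.IsOrdered ord ∧ Φ.eval = orderedPoly ord f

/-! ### Polynomial calculus, polynomial calculus with resolution, PC over ordered formulas -/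

/-- `q` is an axiom (a member of `A`) or follows from polynomials in `prev` by one application of
the product rule or of the addition rule. -/
def PCInferred {F σ : Type*} [Field F] (A prev : Set (MvPolynomial σ F)) (q : MvPolynomial σ F) :
    Prop :=
  q ∈ A ∨
  (∃ x : σ, ∃ p ∈ prev, q = MvPolynomial.X x * p) ∨
  (∃ p₁ ∈ prev, ∃ p₂ ∈ prev, ∃ a b : F, q = MvPolynomial.C a * p₁ + MvPolynomial.C b * p₂)

/-- A sequence of proof-lines with axioms `A`, each line being inferred from earlier ones,
that ends in the polynomial `g`. -/
def IsPCDerivation {F σ : Type*} [Field F] (A : Set (MvPolynomial σ F))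
    (π : List (MvPolynomial σ F)) (g : MvPolynomial σ F) : Prop :=
  (∀ (i : ℕ) (hi : i < π.length), PCInferred A {p | p ∈ π.take i} π[i]) ∧ π.getLast? = some g

/-- The Boolean axioms `x (1 - x)` of PC. -/
def pcAxioms (F σ : Type*) [Field F] : Set (MvPolynomial σ F) :=
  {q | ∃ x : σ, q = MvPolynomial.X x * (1 - MvPolynomial.X x)}

/-- PC proofs of `g` from the initial polynomials `Q`. -/
def IsPCProof {F σ : Type*} [Field F] (Q : Set (MvPolynomial σ F)) (π : List (MvPolynomial σ F))
    (g : MvPolynomial σ F) : Prop :=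
  IsPCDerivation (Q ∪ pcAxioms F σ) π g

/-- The axioms `x x̄` and `x + x̄ - 1` of PCR; the variable `x` is `Sum.inl x` and the formal
variable `x̄` is `Sum.inr x`. -/
def pcrAxioms (F σ : Type*) [Field F] : Set (MvPolynomial (σ ⊕ σ) F) :=
  {q | ∃ x : σ, q = MvPolynomial.X (Sum.inl x) * MvPolynomial.X (Sum.inr x)} ∪
  {q | ∃ x : σ, q = MvPolynomial.X (Sum.inl x) + MvPolynomial.X (Sum.inr x) - 1}

/-- PCR proofs of `g` from the initial polynomials `Q`. -/
def IsPCRProof {F σ : Type*} [Field F] (Q : Set (MvPolynomial (σ ⊕ σ) F))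
    (π : List (MvPolynomial (σ ⊕ σ) F)) (g : MvPolynomial (σ ⊕ σ) F) : Prop :=
  IsPCDerivation (Q ∪ pcrAxioms F σ) π g

/-- The size of a PCR proof: the total number of monomials in all proof-lines. -/
def pcrSize {F σ : Type*} [Field F] (π : List (MvPolynomial (σ ⊕ σ) F)) : ℕ :=
  (π.map fun q => q.support.card).sum

/-- An OFPC proof of `g` from `Q` with respect to the order `ord` on the variables: the lines of a
PC proof of `g` from `Q`, written as (arbitrarily chosen) ordered formulas. -/
def IsOFPCProof {F σ : Type*} [Field F] (ord : LinearOrder σ) (Q : Set (MvPolynomial σ F))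
    (Φs : List (NCFormula F σ)) (g : MvPolynomial σ F) : Prop :=
  ∃ π : List (MvPolynomial σ F), IsPCProof Q π g ∧
    List.Forall₂ (fun Φ q => Φ.ComputesOrdered ord q) Φs π

/-- The size of an OFPC proof: the total size of its formulas. -/
def ofpcSize {F σ : Type*} (Φs : List (NCFormula F σ)) : ℕ :=
  (Φs.map NCFormula.size).sum

/-! ### CNFs and their polynomial translations -/

/-- A clause: a finite set of literals; `(x, true)` is the literal `x`, `(x, false)` is `¬ x`. -/
abbrev Clause (σ : Type*) := Finset (σ × Bool)

/-- The translation `∏ (x_j - b_j)` of a clause, `b_j = 1` for the literal `x_j` and `b_j = 0` for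
the literal `¬ x_j`. -/
def Clause.poly (F : Type*) [Field F] {σ : Type*} (C : Clause σ) : MvPolynomial σ F :=
  ∏ l ∈ C, (MvPolynomial.X l.1 - MvPolynomial.C (if l.2 then 1 else 0))

/-- The set of the polynomial translations of the clauses of a CNF. -/
def cnfPolys (F : Type*) [Field F] {σ : Type*} (K : Set (Clause σ)) : Set (MvPolynomial σ F) :=
  (fun C => Clause.poly F C) '' K

/-- The translation of a clause for PCR: a monomial, with the factor `x̄` for a literal `x` and the
factor `x` for a literal `¬ x`. -/
def Clause.pcrPoly (F : Type*) [Field F] {σ : Type*} (C : Clause σ) : MvPolynomial (σ ⊕ σ) F :=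
  ∏ l ∈ C, MvPolynomial.X (if l.2 then Sum.inr l.1 else Sum.inl l.1)

/-- The set of the PCR translations of the clauses of a CNF. -/
def cnfPCRPolys (F : Type*) [Field F] {σ : Type*} (K : Set (Clause σ)) :
    Set (MvPolynomial (σ ⊕ σ) F) :=
  (fun C => Clause.pcrPoly F C) '' K

/-! ### Tseitin mod `p` formulas -/

/-- The variables `x_{e,i}` of the Tseitin mod `p` formula, for `e` a directed edge (every
undirected edge of `G` gives two opposite directed edges) and `i` a residue mod `p`;
`x_{e,i}` says that the edge `e` has the value `i`. -/
abbrev TseitinVar {V : Type*} (G : SimpleGraph V) (p : ℕ) := G.Dart × ZMod p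

/-- Every directed edge has at least one value. -/
def tseitinSome {V : Type*} (G : SimpleGraph V) (p : ℕ) [NeZero p] :
    Set (Clause (TseitinVar G p)) :=
  {C | ∃ e : G.Dart,
    C = Finset.univ.map ⟨fun i : ZMod p => ((e, i), true), fun i j h => by simpa using h⟩}

/-- Every directed edge has at most one value. -/
def tseitinUnique {V : Type*} [DecidableEq V] (G : SimpleGraph V) (p : ℕ) :
    Set (Clause (TseitinVar G p)) :=
  {C | ∃ (e : G.Dart) (i j : ZMod p), i ≠ j ∧ C = {((e, i), false), ((e, j), false)}}

/-- Opposite directed edges have opposite values mod `p`. -/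
def tseitinOpposite {V : Type*} [DecidableEq V] (G : SimpleGraph V) (p : ℕ) :
    Set (Clause (TseitinVar G p)) :=
  {C | ∃ (e : G.Dart) (i : ZMod p),
    C = {((e, i), false), ((e.symm, -i), true)} ∨ C = {((e, i), true), ((e.symm, -i), false)}}

/-- For every vertex `v`, the values of the directed edges with source `v` sum to the charge of `v`
mod `p`: every choice `j` of values that violates this is excluded by a clause. -/
def tseitinVertex {V : Type*} [Fintype V] [DecidableEq V] (G : SimpleGraph V) [DecidableRel G.Adj]
    (p : ℕ) (charge : V → ZMod p) : Set (Clause (TseitinVar G p)) :=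
  {C | ∃ (v : V) (j : G.Dart → ZMod p),
    ∑ e ∈ Finset.univ.filter (fun e : G.Dart => e.fst = v), j e ≠ charge v ∧
    C = (Finset.univ.filter (fun e : G.Dart => e.fst = v)).image fun e => ((e, j e), false)}

/-- The Tseitin mod `p` formula of the graph `G` with the given charges, a CNF. -/
def tseitinCNF {V : Type*} [Fintype V] [DecidableEq V] (G : SimpleGraph V) [DecidableRel G.Adj]
    (p : ℕ) [NeZero p] (charge : V → ZMod p) : Set (Clause (TseitinVar G p)) :=
  tseitinSome G p ∪ tseitinUnique G p ∪ tseitinOpposite G p ∪ tseitinVertex G p charge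

/-! ### Simulations of refutation systems -/

/-- A refutation system for CNFs in the variables `σ`, given by the relation
"the CNF `K` has a refutation of size `s`". -/
abbrev RefutationSystem (σ : Type*) := Set (Clause σ) → ℕ → Prop

/-- OFPC over `F` with the order `ord` on the variables. -/
def ofpcSystem (F : Type*) [Field F] {σ : Type*} (ord : LinearOrder σ) : RefutationSystem σ :=
  fun K s => ∃ Φs : List (NCFormula F σ), IsOFPCProof ord (cnfPolys F K) Φs 1 ∧ ofpcSize Φs = s

/-- PCR over `F`. -/
def pcrSystem (F : Type*) [Field F] (σ : Type*) : RefutationSystem σ :=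
  fun K s => ∃ π : List (MvPolynomial (σ ⊕ σ) F), IsPCRProof (cnfPCRPolys F K) π 1 ∧ pcrSize π = s

/-- `P₂` polynomially simulates `P₁`: every `P₁`-refutation of a (finite) CNF can be replaced by a
`P₂`-refutation of the same CNF whose size is polynomial in the size of the first. -/
def PolySimulates {σ : Type*} (P₂ P₁ : RefutationSystem σ) : Prop :=
  ∃ B : Polynomial ℕ, ∀ K : Set (Clause σ), K.Finite → ∀ s : ℕ, P₁ K s →
    ∃ s' : ℕ, s' ≤ B.eval s ∧ P₂ K s'

/-- `P₂` is strictly stronger than `P₁`. -/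
def StrictlyStronger {σ : Type*} (P₂ P₁ : RefutationSystem σ) : Prop :=
  PolySimulates P₂ P₁ ∧ ¬ PolySimulates P₁ P₂

end

/-! Upper bound. Call a polynomial split if it is a scalar times a product of univariate polynomials
in distinct variables. The factors commute and can be arranged along any order of the variables, so
a sum of few split polynomials has a short ordered formula for every order
(`HasSplitRank.exists_computesOrdered`). An identity that writes 1 as a sum of few split multiples
of split axioms therefore yields a short OFPC refutation (`HasCert.exists_isOFPCProof`). For Tseitin
formulas such an identity comes from the group algebra of `ZMod p` over the polynomial ring, with
formal powers of t and t^p = 1. Let P be the product over all directed edges e of a factor that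
becomes t^i when e has value i. Modulo the axioms, grouping P by vertices gives t to the total
charge, and grouping it by pairs of opposite edges gives t^0. As the total charge is nonzero, the
coefficients at t^0 are 0 and 1, and subtraction derives 1. The telescoping in
`ResidueAlgebra.HasCert.prod_sub` needs partial products of small split rank. This holds because a
coefficient in t is a linear combination of evaluations at enough points of the field, each of them
split (`hasSplitRank_prod_residueFactor`). A single group is handled by case distinction over its
values (`HasCert.of_selected`).

Simulation of PCR. Substituting 1 - x for x̄ turns every monomial into a split polynomial, so a line
with s monomials gets split rank at most s, and each inference costs at most two PC lines
(`RestrictedDerivation.exists_pc`).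

Separation. The hard formulas live on the complete directed graph with loops on 3m vertices, every
edge taken twice. The degree is linear in m, so the OFPC bound is only exponential in m, while PCR
needs size exponential in m^2 (`pow_le_pcrSize_mul_pow`). A restriction fixes one copy of each edge
and kills every monomial that touches many edges, and what remains is refuted by a degree argument.
Take p invertible in the field and a faithful character of `ZMod p`, and sum the Fourier
coefficients of a line over the characters equivalent to a given one through few vertex constraints.
These class sums vanish on axioms and are preserved by inferences of low degree
(`ClassSumsVanish.mul_coordinate`), but do not vanish on 1 (`not_classSumsVanish_one`). The reason
is isoperimetric: a medium-sized vertex set has quadratically many boundary edges, so no low-degree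
character leads from small combinations of constraints to large ones. -/

noncomputable section

open MvPolynomial

/-! ### Ordered polynomials and ordered formulas -/

section OrderedPolynomials

variable {F σ : Type*} [Field F]

theorem orderedPoly_eq_constr (ord : LinearOrder σ) (f : MvPolynomial σ F) :
    orderedPoly ord f = (basisMonomials σ F).constr F (orderedMonomial F ord) f := by
  conv_rhs => rw [f.as_sum]
  rw [map_sum]
  refine Finset.sum_congr rfl fun m _ => ?_
  have h : (monomial m) (coeff m f) = coeff m f • basisMonomials σ F m := by
    rw [coe_basisMonomials, smul_monomial, smul_eq_mul, mul_one]
  rw [h, map_smul, Module.Basis.constr_basis]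

theorem orderedPoly_add (ord : LinearOrder σ) (f g : MvPolynomial σ F) :
    orderedPoly ord (f + g) = orderedPoly ord f + orderedPoly ord g := by
  simp only [orderedPoly_eq_constr, map_add]

theorem orderedPoly_monomial (ord : LinearOrder σ) (m : σ →₀ ℕ) (c : F) :
    orderedPoly ord (monomial m c) = c • orderedMonomial F ord m := by
  have h : (monomial m) c = c • basisMonomials σ F m := by
    rw [coe_basisMonomials, smul_monomial, smul_eq_mul, mul_one]
  rw [orderedPoly_eq_constr, h, map_smul, Module.Basis.constr_basis]

theorem orderedMonomial_add (ord : LinearOrder σ) {m m' : σ →₀ ℕ}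
    (h : ∀ x ∈ m.support, ∀ y ∈ m'.support, ord.le x y) :
    orderedMonomial F ord (m + m') = orderedMonomial F ord m * orderedMonomial F ord m' := by
  let := ord
  unfold orderedMonomial
  rw [← List.prod_append, ← List.map_append]
  congr 2
  refine List.Perm.eq_of_pairwise' (r := (· ≤ ·)) (Multiset.pairwise_sort _ _) ?_ ?_
  · rw [List.pairwise_append]
    refine ⟨Multiset.pairwise_sort _ _, Multiset.pairwise_sort _ _, fun x hx y hy => ?_⟩
    rw [Multiset.mem_sort, Finsupp.mem_toMultiset] at hx hy
    exact h x hx y hy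
  · rw [← Multiset.coe_eq_coe, ← Multiset.coe_add, Multiset.sort_eq, Multiset.sort_eq,
      Multiset.sort_eq, map_add]

/-- Concatenating sorted words stays sorted when the first uses only variables below those of the
second. The weak inequality also admits a shared variable, which Horner's scheme needs. -/
theorem orderedPoly_mul (ord : LinearOrder σ) {f g : MvPolynomial σ F}
    (h : ∀ x ∈ f.vars, ∀ y ∈ g.vars, ord.le x y) :
    orderedPoly ord (f * g) = orderedPoly ord f * orderedPoly ord g := by
  conv_lhs => rw [f.as_sum, g.as_sum, Finset.sum_mul_sum, orderedPoly_eq_constr]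
  rw [orderedPoly, orderedPoly, Finset.sum_mul_sum, map_sum]
  refine Finset.sum_congr rfl fun m hm => ?_
  rw [map_sum]
  refine Finset.sum_congr rfl fun m' hm' => ?_
  rw [monomial_mul, ← orderedPoly_eq_constr, orderedPoly_monomial, orderedMonomial_add,
    smul_mul_smul_comm]
  exact fun x hx y hy => h x ((mem_vars_iff_mem_support _).2 ⟨m, hm, hx⟩) y ((mem_vars_iff_mem_support _).2 ⟨m', hm', hy⟩)

theorem orderedPoly_C (ord : LinearOrder σ) (c : F) :
    orderedPoly ord (C c : MvPolynomial σ F) = algebraMap F _ c := by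
  rw [C_apply, orderedPoly_monomial, orderedMonomial, map_zero, Multiset.sort_zero, List.map_nil,
    List.prod_nil, Algebra.algebraMap_eq_smul_one]

theorem orderedPoly_X (ord : LinearOrder σ) (x : σ) :
    orderedPoly ord (X x : MvPolynomial σ F) = FreeAlgebra.ι F x := by
  rw [X, orderedPoly_monomial, one_smul, orderedMonomial, Finsupp.toMultiset_single, one_smul,
    Multiset.sort_singleton, List.map_singleton, List.prod_singleton]

theorem computesOrdered_const (ord : LinearOrder σ) (c : F) :
    (NCFormula.const c : NCFormula F σ).ComputesOrdered ord (C c) := by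
  refine ⟨?_, (orderedPoly_C ord c).symm⟩
  rintro Ψ rfl
  exact ⟨C c, (orderedPoly_C ord c).symm⟩

theorem computesOrdered_var (ord : LinearOrder σ) (x : σ) :
    (NCFormula.var x : NCFormula F σ).ComputesOrdered ord (X x) := by
  refine ⟨?_, (orderedPoly_X ord x).symm⟩
  rintro Ψ rfl
  exact ⟨X x, (orderedPoly_X ord x).symm⟩

theorem NCFormula.ComputesOrdered.add {ord : LinearOrder σ} {Φ Ψ : NCFormula F σ}
    {f g : MvPolynomial σ F} (hf : Φ.ComputesOrdered ord f) (hg : Ψ.ComputesOrdered ord g) :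
    (NCFormula.add Φ Ψ).ComputesOrdered ord (f + g) := by
  have h : (NCFormula.add Φ Ψ).eval = orderedPoly ord (f + g) := by
    rw [orderedPoly_add, ← hf.2, ← hg.2, NCFormula.eval]
  refine ⟨?_, h⟩
  rintro Θ (rfl | hΘ | hΘ)
  exacts [⟨_, h⟩, hf.1 Θ hΘ, hg.1 Θ hΘ]

theorem NCFormula.ComputesOrdered.mul {ord : LinearOrder σ} {Φ Ψ : NCFormula F σ}
    {f g : MvPolynomial σ F} (hf : Φ.ComputesOrdered ord f) (hg : Ψ.ComputesOrdered ord g)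
    (hvars : ∀ x ∈ f.vars, ∀ y ∈ g.vars, ord.le x y) :
    (NCFormula.mul Φ Ψ).ComputesOrdered ord (f * g) := by
  have h : (NCFormula.mul Φ Ψ).eval = orderedPoly ord (f * g) := by
    rw [orderedPoly_mul ord hvars, ← hf.2, ← hg.2, NCFormula.eval]
  refine ⟨?_, h⟩
  rintro Θ (rfl | hΘ | hΘ)
  exacts [⟨_, h⟩, hf.1 Θ hΘ, hg.1 Θ hΘ]

theorem vars_aeval_X_subset (x : σ) (u : Polynomial F) :
    (Polynomial.aeval (X x : MvPolynomial σ F) u).vars ⊆ {x} := by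
  classical
  rw [Polynomial.aeval_eq_sum_range]
  refine (vars_sum_subset _ _).trans (Finset.biUnion_subset.2 fun i _ => ?_)
  rw [smul_eq_C_mul]
  refine (vars_mul _ _).trans ?_
  rw [vars_C, Finset.empty_union]
  exact (vars_pow _ _).trans (by rw [vars_X])

/-- Horner's scheme, at four nodes per degree. -/
theorem exists_computesOrdered_univariate (ord : LinearOrder σ) (x : σ) (d : ℕ) :
    ∀ u : Polynomial F, u.natDegree ≤ d → ∃ Φ : NCFormula F σ,
      Φ.ComputesOrdered ord (Polynomial.aeval (X x) u) ∧ Φ.size ≤ 4 * d + 1 := by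
  induction d with
  | zero =>
    intro u hu
    obtain ⟨c, rfl⟩ := Polynomial.natDegree_eq_zero.1 (Nat.le_zero.1 hu)
    rw [Polynomial.aeval_C]
    exact ⟨_, computesOrdered_const ord c, by simp [NCFormula.size]⟩
  | succ d ih =>
    intro u hu
    obtain ⟨Φ, hΦ, hs⟩ := ih u.divX (by rw [Polynomial.natDegree_divX_eq_natDegree_tsub_one]; omega)
    refine ⟨.add (.mul Φ (.var x)) (.const (u.coeff 0)), ?_, by simp only [NCFormula.size]; omega⟩
    conv in Polynomial.aeval _ u => rw [← Polynomial.divX_mul_X_add u]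
    rw [map_add, map_mul, Polynomial.aeval_X, Polynomial.aeval_C]
    refine (hΦ.mul (computesOrdered_var ord x) fun y hy z hz => ?_).add (computesOrdered_const ord _)
    have hy := vars_aeval_X_subset x _ hy
    rw [Finset.mem_singleton] at hy
    rw [vars_X, Finset.mem_singleton] at hz
    rw [hy, hz]

end OrderedPolynomials

/-! ### Split polynomials and split rank -/

section SplitPolynomials

variable {F σ : Type*} [Field F]

/-- A scalar multiple of a product of univariate polynomials of degree at most `d`, one for each of
the variables in `T`. -/
def IsSplit (T : Finset σ) (d : ℕ) (g : MvPolynomial σ F) : Prop :=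
  ∃ (c : F) (u : σ → Polynomial F), (∀ x, (u x).natDegree ≤ d) ∧
    g = C c * ∏ x ∈ T, Polynomial.aeval (X x : MvPolynomial σ F) (u x)

theorem IsSplit.mono {T : Finset σ} {d d' : ℕ} {g : MvPolynomial σ F} (h : IsSplit T d g)
    (hd : d ≤ d') : IsSplit T d' g := by
  obtain ⟨c, u, hu, rfl⟩ := h
  exact ⟨c, u, fun x => (hu x).trans hd, rfl⟩

theorem IsSplit.mul {T : Finset σ} {d d' : ℕ} {f g : MvPolynomial σ F} (hf : IsSplit T d f)
    (hg : IsSplit T d' g) : IsSplit T (d + d') (f * g) := by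
  obtain ⟨c, u, hu, rfl⟩ := hf
  obtain ⟨c', u', hu', rfl⟩ := hg
  refine ⟨c * c', fun x => u x * u' x,
    fun x => Polynomial.natDegree_mul_le.trans (add_le_add (hu x) (hu' x)), ?_⟩
  simp only [map_mul, Finset.prod_mul_distrib]
  ring

theorem isSplit_C (T : Finset σ) (d : ℕ) (c : F) : IsSplit T d (C c) :=
  ⟨c, fun _ => 1, fun x => by simp, by simp⟩

theorem isSplit_one (T : Finset σ) (d : ℕ) : IsSplit T d (1 : MvPolynomial σ F) := by
  simpa using isSplit_C (F := F) T d 1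

theorem isSplit_prod_of_subset {T S : Finset σ} (hS : S ⊆ T) {d : ℕ} (u : σ → Polynomial F)
    (hu : ∀ x ∈ S, (u x).natDegree ≤ d) :
    IsSplit T d (∏ x ∈ S, Polynomial.aeval (X x : MvPolynomial σ F) (u x)) := by
  classical
  refine ⟨1, fun x => if x ∈ S then u x else 1, fun x => ?_, ?_⟩
  · dsimp only
    split_ifs with h
    · exact hu x h
    · simp
  · rw [C_1, one_mul, ← Finset.prod_subset hS]
    · exact Finset.prod_congr rfl fun x hx => by simp only [if_pos hx]
    · intro x _ hx
      simp only [if_neg hx, map_one]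

theorem isSplit_aeval {T : Finset σ} {x : σ} (hx : x ∈ T) {d : ℕ} (u : Polynomial F)
    (hu : u.natDegree ≤ d) : IsSplit T d (Polynomial.aeval (X x : MvPolynomial σ F) u) := by
  have := isSplit_prod_of_subset (T := T) (S := {x}) (by simpa using hx) (d := d) (fun _ => u)
    (fun _ _ => hu)
  simpa using this

theorem isSplit_X {T : Finset σ} {x : σ} (hx : x ∈ T) : IsSplit T 1 (X x : MvPolynomial σ F) := by
  simpa using isSplit_aeval (F := F) hx Polynomial.X (d := 1) Polynomial.natDegree_X_le

/-- Adding the variables of `T` in increasing order puts each new factor at the right end. This is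
where the independence of the order comes from. -/
theorem exists_computesOrdered_prod (ord : LinearOrder σ) (T : Finset σ) (d : ℕ)
    (u : σ → Polynomial F) (hu : ∀ x, (u x).natDegree ≤ d) : ∃ Φ : NCFormula F σ,
      Φ.ComputesOrdered ord (∏ x ∈ T, Polynomial.aeval (X x : MvPolynomial σ F) (u x)) ∧
      Φ.size ≤ T.card * (4 * d + 2) + 1 := by
  let := ord
  induction T using Finset.induction_on_max with
  | empty => exact ⟨.const 1, by simpa using computesOrdered_const (F := F) ord 1, by
      simp [NCFormula.size]⟩
  | insert a s ha ih =>
    have has : a ∉ s := fun h => lt_irrefl _ (ha a h)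
    obtain ⟨Φ, hΦ, hs⟩ := ih
    obtain ⟨Ψ, hΨ, hs'⟩ := exists_computesOrdered_univariate (F := F) ord a d (u a) (hu a)
    refine ⟨.mul Φ Ψ, ?_, ?_⟩
    · rw [Finset.prod_insert has, mul_comm]
      refine hΦ.mul hΨ fun x hx y hy => ?_
      have hy := Finset.mem_singleton.1 (vars_aeval_X_subset a _ hy)
      obtain ⟨z, hz, hxz⟩ := Finset.mem_biUnion.1 (vars_prod _ hx)
      have hxz := Finset.mem_singleton.1 (vars_aeval_X_subset z _ hxz)
      rw [hy, hxz]
      exact (ha z hz).le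
    · rw [Finset.card_insert_of_notMem has, NCFormula.size, Nat.succ_mul]
      omega

theorem IsSplit.exists_computesOrdered (ord : LinearOrder σ) {T : Finset σ} {d : ℕ}
    {g : MvPolynomial σ F} (hg : IsSplit T d g) : ∃ Φ : NCFormula F σ,
      Φ.ComputesOrdered ord g ∧ Φ.size ≤ T.card * (4 * d + 2) + 3 := by
  obtain ⟨c, u, hu, rfl⟩ := hg
  obtain ⟨Φ, hΦ, hs⟩ := exists_computesOrdered_prod ord T d u hu
  refine ⟨.mul (.const c) Φ, (computesOrdered_const ord c).mul hΦ ?_, ?_⟩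
  · simp
  · simp only [NCFormula.size]
    omega

/-- A sum of at most `M` split polynomials. -/
def HasSplitRank (T : Finset σ) (d M : ℕ) (f : MvPolynomial σ F) : Prop :=
  ∃ l : List (MvPolynomial σ F), l.length ≤ M ∧ (∀ g ∈ l, IsSplit T d g) ∧ f = l.sum

theorem HasSplitRank.exists_computesOrdered (ord : LinearOrder σ) {T : Finset σ} {d M : ℕ}
    {f : MvPolynomial σ F} (hf : HasSplitRank T d M f) : ∃ Φ : NCFormula F σ,
      Φ.ComputesOrdered ord f ∧ Φ.size ≤ M * (T.card * (4 * d + 2) + 4) + 1 := by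
  obtain ⟨l, hl, hg, rfl⟩ := hf
  suffices h : ∃ Φ : NCFormula F σ, Φ.ComputesOrdered ord l.sum ∧
      Φ.size ≤ l.length * (T.card * (4 * d + 2) + 4) + 1 by
    obtain ⟨Φ, hΦ, hs⟩ := h
    exact ⟨Φ, hΦ, hs.trans (by gcongr)⟩
  clear hl
  induction l with
  | nil => exact ⟨.const 0, by simpa using computesOrdered_const (F := F) ord 0, by
      simp [NCFormula.size]⟩
  | cons g l ih =>
    obtain ⟨Φ, hΦ, hs⟩ := ih fun g hg' => hg g (List.mem_cons_of_mem _ hg')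
    obtain ⟨Ψ, hΨ, hs'⟩ := (hg g List.mem_cons_self).exists_computesOrdered ord
    refine ⟨.add Ψ Φ, by rw [List.sum_cons]; exact hΨ.add hΦ, ?_⟩
    rw [List.length_cons, NCFormula.size, Nat.succ_mul]
    omega

theorem IsSplit.hasSplitRank {T : Finset σ} {d : ℕ} {g : MvPolynomial σ F} (hg : IsSplit T d g) :
    HasSplitRank T d 1 g :=
  ⟨[g], by simp, by simpa using hg, by simp⟩

theorem HasSplitRank.mono {T : Finset σ} {d d' M M' : ℕ} {f : MvPolynomial σ F}
    (hf : HasSplitRank T d M f) (hd : d ≤ d') (hM : M ≤ M') : HasSplitRank T d' M' f := by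
  obtain ⟨l, hl, hg, rfl⟩ := hf
  exact ⟨l, hl.trans hM, fun g h => (hg g h).mono hd, rfl⟩

theorem hasSplitRank_zero (T : Finset σ) (d M : ℕ) : HasSplitRank T d M (0 : MvPolynomial σ F) :=
  ⟨[], by simp, by simp, by simp⟩

theorem HasSplitRank.add {T : Finset σ} {d M M' : ℕ} {f g : MvPolynomial σ F}
    (hf : HasSplitRank T d M f) (hg : HasSplitRank T d M' g) :
    HasSplitRank T d (M + M') (f + g) := by
  obtain ⟨l, hl, h, rfl⟩ := hf
  obtain ⟨l', hl', h', rfl⟩ := hg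
  refine ⟨l ++ l', by rw [List.length_append]; omega, fun q hq => ?_, by rw [List.sum_append]⟩
  exact (List.mem_append.1 hq).elim (h q) (h' q)

theorem hasSplitRank_sum {T : Finset σ} {d : ℕ} {ι : Type*} (s : Finset ι)
    {f : ι → MvPolynomial σ F} {M : ι → ℕ} (hf : ∀ i ∈ s, HasSplitRank T d (M i) (f i)) :
    HasSplitRank T d (∑ i ∈ s, M i) (∑ i ∈ s, f i) := by
  classical
  induction s using Finset.induction_on with
  | empty => exact hasSplitRank_zero _ _ _
  | insert a s ha ih =>
    rw [Finset.sum_insert ha, Finset.sum_insert ha]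
    exact (hf a (Finset.mem_insert_self _ _)).add
      (ih fun i hi => hf i (Finset.mem_insert_of_mem hi))

theorem HasSplitRank.isSplit_mul {T : Finset σ} {d d' M : ℕ} {f g : MvPolynomial σ F}
    (hf : HasSplitRank T d M f) (hg : IsSplit T d' g) :
    HasSplitRank T (d + d') M (f * g) := by
  obtain ⟨l, hl, h, rfl⟩ := hf
  refine ⟨l.map (· * g), by simpa using hl, fun q hq => ?_, (List.sum_map_mul_right l _ g).symm ▸ ?_⟩
  · obtain ⟨q', hq', rfl⟩ := List.mem_map.1 hq
    exact (h q' hq').mul hg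
  · simp

theorem HasSplitRank.mul {T : Finset σ} {d d' M M' : ℕ} {f g : MvPolynomial σ F}
    (hf : HasSplitRank T d M f) (hg : HasSplitRank T d' M' g) :
    HasSplitRank T (d + d') (M * M') (f * g) := by
  obtain ⟨l, hl, h, rfl⟩ := hg
  refine HasSplitRank.mono ?_ le_rfl (Nat.mul_le_mul_left M hl)
  clear hl
  induction l with
  | nil => simpa using hasSplitRank_zero _ _ _
  | cons q l ih =>
    rw [List.sum_cons, mul_add, List.length_cons, Nat.mul_succ, add_comm (f * q)]
    exact (ih fun g hg => h g (List.mem_cons_of_mem _ hg)).add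
      (hf.isSplit_mul (h q List.mem_cons_self))

theorem HasSplitRank.C_mul {T : Finset σ} {d M : ℕ} {f : MvPolynomial σ F}
    (hf : HasSplitRank T d M f) (c : F) : HasSplitRank T d M (C c * f) := by
  rw [mul_comm]
  exact hf.isSplit_mul (isSplit_C T 0 c)

theorem hasSplitRank_prod {T : Finset σ} {d M : ℕ} {ι : Type*} (s : Finset ι)
    {f : ι → MvPolynomial σ F} (hf : ∀ i ∈ s, HasSplitRank T d M (f i)) :
    HasSplitRank T (s.card * d) (M ^ s.card) (∏ i ∈ s, f i) := by
  classical
  induction s using Finset.induction_on with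
  | empty => simpa using (isSplit_one T 0).hasSplitRank
  | insert a s ha ih =>
    rw [Finset.prod_insert ha, Finset.card_insert_of_notMem ha, pow_succ', Nat.succ_mul, add_comm]
    exact (hf a (Finset.mem_insert_self _ _)).mul
      (ih fun i hi => hf i (Finset.mem_insert_of_mem hi))

end SplitPolynomials

/-! ### From certificates to PC derivations and OFPC proofs -/

section Derivations

variable {F σ : Type*} [Field F]

/-- Every line is inferred from earlier ones. -/
def IsDerivationList (A : Set (MvPolynomial σ F)) (π : List (MvPolynomial σ F)) : Prop :=
  ∀ (i : ℕ) (hi : i < π.length), PCInferred A {p | p ∈ π.take i} π[i]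

theorem isDerivationList_nil (A : Set (MvPolynomial σ F)) : IsDerivationList A [] := by
  intro i hi
  simp at hi

theorem IsDerivationList.append_singleton {A : Set (MvPolynomial σ F)}
    {π : List (MvPolynomial σ F)} (h : IsDerivationList A π) {q : MvPolynomial σ F}
    (hq : PCInferred A {p | p ∈ π} q) : IsDerivationList A (π ++ [q]) := by
  intro i hi
  rw [List.length_append, List.length_singleton] at hi
  rcases Nat.lt_succ_iff_lt_or_eq.1 hi with h' | rfl
  · rw [List.getElem_append_left h', List.take_append_of_le_length h'.le]
    exact h i h'
  · rw [List.getElem_append_right le_rfl, List.take_left]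
    simpa using hq

/-- The derivation `π` can be extended by at most `L` lines, all of them satisfying `R`, to a
derivation with `f` among its lines. -/
def ExtendsTo (A : Set (MvPolynomial σ F)) (R : MvPolynomial σ F → Prop)
    (π : List (MvPolynomial σ F)) (L : ℕ) (f : MvPolynomial σ F) : Prop :=
  ∃ π', IsDerivationList A (π ++ π') ∧ π'.length ≤ L ∧ (∀ q ∈ π', R q) ∧ f ∈ π ++ π'

variable {A : Set (MvPolynomial σ F)} {R : MvPolynomial σ F → Prop} {π : List (MvPolynomial σ F)}

theorem ExtendsTo.of_mem (hπ : IsDerivationList A π) {f : MvPolynomial σ F} (hf : f ∈ π) :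
    ExtendsTo A R π 0 f :=
  ⟨[], by simpa using hπ, by simp, by simp, by simpa using hf⟩

theorem ExtendsTo.of_inferred (hπ : IsDerivationList A π) {f : MvPolynomial σ F}
    (hf : PCInferred A {p | p ∈ π} f) (hR : R f) : ExtendsTo A R π 1 f :=
  ⟨[f], hπ.append_singleton hf, by simp, by simpa using hR, by simp⟩

theorem ExtendsTo.mono {L L' : ℕ} {f : MvPolynomial σ F} (h : ExtendsTo A R π L f) (hL : L ≤ L') :
    ExtendsTo A R π L' f := by
  obtain ⟨π', h₁, h₂, h₃⟩ := h
  exact ⟨π', h₁, h₂.trans hL, h₃⟩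

theorem ExtendsTo.trans {L L' : ℕ} {f g : MvPolynomial σ F} (hf : ExtendsTo A R π L f)
    (hg : ∀ π', IsDerivationList A (π ++ π') → f ∈ π ++ π' → ExtendsTo A R (π ++ π') L' g) :
    ExtendsTo A R π (L + L') g := by
  obtain ⟨π', h₁, h₂, h₃, h₄⟩ := hf
  obtain ⟨π'', h₁', h₂', h₃', h₄'⟩ := hg π' h₁ h₄
  refine ⟨π' ++ π'', by rwa [← List.append_assoc], by rw [List.length_append]; omega, ?_,
    by rwa [← List.append_assoc]⟩
  exact fun q hq => (List.mem_append.1 hq).elim (h₃ q) (h₃' q)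

/-- Horner's scheme inside PC: one line for the leading scalar, then a product by `x` and a linear
combination with `q` for every degree. -/
theorem ExtendsTo.aeval_mul (x : σ) {q : MvPolynomial σ F} (d : ℕ)
    (hR : ∀ w : Polynomial F, w.natDegree ≤ d →
      R (Polynomial.aeval (X x : MvPolynomial σ F) w * q))
    (hπ : IsDerivationList A π) (hq : q ∈ π) (u : Polynomial F) (hu : u.natDegree ≤ d) :
    ExtendsTo A R π (2 * d + 1) (Polynomial.aeval (X x : MvPolynomial σ F) u * q) := by
  induction d generalizing u with
  | zero =>
    obtain ⟨c, rfl⟩ := Polynomial.natDegree_eq_zero.1 (Nat.le_zero.1 hu)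
    refine .of_inferred hπ (.inr (.inr ⟨q, hq, q, hq, c, 0, ?_⟩)) (hR _ hu)
    simp [algebraMap_eq]
  | succ d ih =>
    have hd : u.divX.natDegree ≤ d := by
      rw [Polynomial.natDegree_divX_eq_natDegree_tsub_one]; omega
    refine ((ih (fun w hw => hR w (hw.trans d.le_succ)) _ hd).trans
      (L' := 2) fun π₁ h₁ hm => ?_).mono (by omega)
    have e : X x * (Polynomial.aeval (X x) u.divX * q) =
        Polynomial.aeval (X x : MvPolynomial σ F) (Polynomial.X * u.divX) * q := by
      rw [map_mul, Polynomial.aeval_X, mul_assoc]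
    refine ((ExtendsTo.of_inferred h₁ (.inr (.inl ⟨x, _, hm, rfl⟩)) ?_).trans (L' := 1)
      fun π₂ h₂ hm' => ?_).mono le_rfl
    · rw [e]
      refine hR _ (Polynomial.natDegree_mul_le.trans ?_)
      rw [Polynomial.natDegree_X]
      omega
    · refine .of_inferred h₂ (.inr (.inr ⟨_, hm', q,
        List.mem_append_left _ (List.mem_append_left _ hq), 1, u.coeff 0, ?_⟩)) (hR _ hu)
      conv_lhs => rw [← Polynomial.divX_mul_X_add u]
      simp only [map_add, map_mul, Polynomial.aeval_X, Polynomial.aeval_C, algebraMap_eq, C_1]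
      ring

theorem ExtendsTo.prod_aeval_mul {T : Finset σ} {d : ℕ} {q : MvPolynomial σ F}
    (u : σ → Polynomial F) (hu : ∀ x, (u x).natDegree ≤ d)
    (hR : ∀ g, IsSplit T (2 * d) g → R (g * q)) (hπ : IsDerivationList A π) (hq : q ∈ π) :
    ExtendsTo A R π (T.card * (2 * d + 1))
      ((∏ x ∈ T, Polynomial.aeval (X x : MvPolynomial σ F) (u x)) * q) := by
  classical
  suffices h : ∀ S ⊆ T, ExtendsTo A R π (S.card * (2 * d + 1))
      ((∏ x ∈ S, Polynomial.aeval (X x : MvPolynomial σ F) (u x)) * q) from h T subset_rfl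
  intro S
  induction S using Finset.induction_on with
  | empty => exact fun _ => by simpa using ExtendsTo.of_mem hπ hq
  | insert a s ha ih =>
    intro hs
    rw [Finset.prod_insert ha, Finset.card_insert_of_notMem ha, Nat.succ_mul, mul_assoc]
    have hs' := (Finset.subset_insert a s).trans hs
    refine (ih hs').trans fun π' h hm => .aeval_mul a d (fun w hw => ?_) h hm _ (hu a)
    rw [← mul_assoc]
    refine hR _ ?_
    -- The two factors have disjoint variables, but `IsSplit.mul` adds the degree bounds regardless,
    -- hence `2 * d` in `hR`.
    rw [two_mul]
    exact (isSplit_aeval (hs (Finset.mem_insert_self _ _)) w hw).mul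
      (isSplit_prod_of_subset hs' u fun x _ => hu x)

/-- `f` is a sum of at most `L` multiples of elements of `A` by split polynomials. -/
def HasCert (A : Set (MvPolynomial σ F)) (T : Finset σ) (d L : ℕ) (f : MvPolynomial σ F) : Prop :=
  ∃ l : List (MvPolynomial σ F × MvPolynomial σ F), l.length ≤ L ∧
    (∀ q ∈ l, q.1 ∈ A ∧ IsSplit T d q.2) ∧ f = (l.map fun q => q.1 * q.2).sum

/-- The summands are built one variable at a time and added to a running sum. Every line is then a
split multiple of one axiom or a partial sum of the certificate, so the split rank stays below the
certificate length. -/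
theorem HasCert.exists_derivation {T : Finset σ} {d L : ℕ} (hA : ∀ a ∈ A, IsSplit T 2 a)
    (h : HasCert A T d L 1) : ∃ π : List (MvPolynomial σ F), IsPCDerivation A π 1 ∧
      π.length ≤ (L + 1) * (T.card * (2 * d + 1) + 4) ∧
      ∀ q ∈ π, HasSplitRank T (2 * d + 2) (L + 1) q := by
  obtain ⟨l, hl, hlA, hsum⟩ := h
  -- The empty sum 0 has to be inferred from some earlier line, so one axiom `a` is put in front.
  -- One exists because 1 is not an empty sum.
  have hl0 : l ≠ [] := by
    rintro rfl
    simp at hsum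
  obtain ⟨⟨a, g⟩, l', rfl⟩ := List.exists_cons_of_ne_nil hl0
  have ha := hlA _ List.mem_cons_self
  have h0 : IsDerivationList A [a] := (isDerivationList_nil A).append_singleton (.inl ha.1)
  have key : ∀ l₁ : List (MvPolynomial σ F × MvPolynomial σ F), l₁.length ≤ L →
      (∀ q ∈ l₁, q.1 ∈ A ∧ IsSplit T d q.2) →
      ExtendsTo A (HasSplitRank T (2 * d + 2) (L + 1)) [a] (1 + l₁.length * (T.card * (2 * d + 1) + 3))
        (l₁.map fun q => q.1 * q.2).sum := by
    intro l₁
    induction l₁ with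
    | nil =>
      intro _ _
      have h00 : PCInferred A {p | p ∈ [a]} 0 :=
        .inr (.inr ⟨a, by simp, a, by simp, 0, 0, by simp⟩)
      exact (ExtendsTo.of_inferred h0 h00 (hasSplitRank_zero _ _ _)).mono (Nat.le_add_right _ _)
    | cons q l₁ ih =>
      intro hlen hq
      rw [List.length_cons] at hlen
      refine ((ih (by omega) fun q' h' => hq q' (List.mem_cons_of_mem _ h')).trans
        (L' := T.card * (2 * d + 1) + 3) fun π₁ h₁ hm => ?_).mono ?_
      · obtain ⟨hqA, c, u, hu, hqu⟩ := hq q List.mem_cons_self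
        refine ((ExtendsTo.of_inferred h₁ (.inl hqA) ?_).trans (L' := T.card * (2 * d + 1) + 1)
          fun π₂ h₂ hm₂ => ?_).mono (by omega)
        · exact (hA _ hqA).hasSplitRank.mono (by omega) (by omega)
        refine (ExtendsTo.prod_aeval_mul (T := T) u hu ?_ h₂ hm₂).trans (L' := 1)
          fun π₃ h₃ hm₃ => ?_
        · exact fun g hg => (hg.mul (hA _ hqA)).hasSplitRank.mono (by omega) (by omega)
        have hm' := List.mem_append_left π₃ (List.mem_append_left π₂ hm)
        have hinf : PCInferred A {p | p ∈ [a] ++ π₁ ++ π₂ ++ π₃}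
            ((q :: l₁).map fun q => q.1 * q.2).sum := by
          refine .inr (.inr ⟨_, hm₃, _, hm', c, 1, ?_⟩)
          rw [List.map_cons, List.sum_cons, hqu, C_1]
          ring
        refine ExtendsTo.of_inferred h₃ hinf ?_
        · refine ⟨_, ?_, ?_, rfl⟩
          · rw [List.length_map, List.length_cons]
            omega
          intro f hf
          obtain ⟨q', hq', rfl⟩ := List.mem_map.1 hf
          exact ((hA _ (hq q' hq').1).mul (hq q' hq').2).mono (by omega)
      · rw [List.length_cons, Nat.succ_mul l₁.length]
        omega
  rw [List.length_cons] at hl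
  obtain ⟨π', h₁, h₂, h₃, h₄⟩ := key (((a, g) :: l')) (by simpa using hl) hlA
  rw [← hsum] at h₄
  -- `ExtendsTo` only places 1 somewhere among the lines; it is repeated so as to be the last.
  refine ⟨[a] ++ π' ++ [1], ⟨h₁.append_singleton (.inr (.inr ⟨1, h₄, 1, h₄, 1, 0, by simp⟩)),
    List.getLast?_concat⟩, ?_, ?_⟩
  · rw [List.length_append, List.length_append, List.length_singleton, List.length_singleton]
    have : (((a, g) :: l').length) * (T.card * (2 * d + 1) + 3) ≤
        L * (T.card * (2 * d + 1) + 3) := by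
      gcongr
      simpa using hl
    nlinarith [Nat.zero_le (T.card * (2 * d + 1))]
  · intro q hq
    rw [List.mem_append, List.mem_append, List.mem_singleton, List.mem_singleton] at hq
    rcases hq with (rfl | hq) | rfl
    · exact (hA _ ha.1).hasSplitRank.mono (by omega) (by omega)
    · exact h₃ q hq
    · exact (isSplit_one T 0).hasSplitRank.mono (by omega) (by omega)

theorem exists_formulas (ord : LinearOrder σ) {K : ℕ} {π : List (MvPolynomial σ F)}
    (h : ∀ q ∈ π, ∃ Φ : NCFormula F σ, Φ.ComputesOrdered ord q ∧ Φ.size ≤ K) :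
    ∃ Φs : List (NCFormula F σ), List.Forall₂ (fun Φ q => Φ.ComputesOrdered ord q) Φs π ∧
      ofpcSize Φs ≤ π.length * K := by
  induction π with
  | nil => exact ⟨[], .nil, by simp [ofpcSize]⟩
  | cons q π ih =>
    obtain ⟨Φs, h₁, h₂⟩ := ih fun q hq => h q (List.mem_cons_of_mem _ hq)
    obtain ⟨Φ, h₃, h₄⟩ := h q List.mem_cons_self
    refine ⟨Φ :: Φs, .cons h₃ h₁, ?_⟩
    rw [List.length_cons, Nat.succ_mul]
    simp only [ofpcSize, List.map_cons, List.sum_cons] at h₂ ⊢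
    omega

theorem exists_isOFPCProof_of_hasSplitRank (ord : LinearOrder σ) {Q : Set (MvPolynomial σ F)}
    {π : List (MvPolynomial σ F)} {g : MvPolynomial σ F} (hπ : IsPCProof Q π g) {T : Finset σ}
    {d M : ℕ} (hR : ∀ q ∈ π, HasSplitRank T d M q) :
    ∃ Φs : List (NCFormula F σ), IsOFPCProof ord Q Φs g ∧
      ofpcSize Φs ≤ π.length * (M * (T.card * (4 * d + 2) + 4) + 1) := by
  obtain ⟨Φs, h₁, h₂⟩ := exists_formulas ord fun q hq => (hR q hq).exists_computesOrdered ord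
  exact ⟨Φs, ⟨π, hπ, h₁⟩, h₂⟩

theorem IsPCDerivation.mono {A' : Set (MvPolynomial σ F)} {g : MvPolynomial σ F}
    (h : IsPCDerivation A π g) (hA : A ⊆ A') : IsPCDerivation A' π g := by
  refine ⟨fun i hi => ?_, h.2⟩
  rcases h.1 i hi with h | h
  exacts [.inl (hA h), .inr h]

theorem HasCert.exists_isOFPCProof (ord : LinearOrder σ) {Q : Set (MvPolynomial σ F)}
    {T : Finset σ} {d L : ℕ} (hA : ∀ a ∈ A, a ∈ Q ∪ pcAxioms F σ ∧ IsSplit T 2 a)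
    (h : HasCert A T d L 1) :
    ∃ Φs : List (NCFormula F σ), IsOFPCProof ord Q Φs 1 ∧
      ofpcSize Φs ≤ (L + 1) * (T.card * (2 * d + 1) + 4) *
        ((L + 1) * (T.card * (4 * (2 * d + 2) + 2) + 4) + 1) := by
  obtain ⟨π, h₁, h₂, h₃⟩ := h.exists_derivation fun a ha => (hA a ha).2
  obtain ⟨Φs, h₄, h₅⟩ := exists_isOFPCProof_of_hasSplitRank (Q := Q) ord
    (h₁.mono fun a ha => (hA a ha).1) h₃
  exact ⟨Φs, h₄, h₅.trans (by gcongr)⟩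

end Derivations

/-! ### Calculus of certificates -/

section Certificates

variable {F σ : Type*} [Field F] {A : Set (MvPolynomial σ F)} {T : Finset σ}

theorem hasCert_zero (d L : ℕ) : HasCert A T d L (0 : MvPolynomial σ F) :=
  ⟨[], by simp, by simp, by simp⟩

theorem hasCert_of_mem {a g : MvPolynomial σ F} (ha : a ∈ A) {d : ℕ} (hg : IsSplit T d g) :
    HasCert A T d 1 (a * g) :=
  ⟨[(a, g)], by simp, by simpa using ⟨ha, hg⟩, by simp⟩

theorem HasCert.mono {d d' L L' : ℕ} {f : MvPolynomial σ F} (hf : HasCert A T d L f)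
    (hd : d ≤ d') (hL : L ≤ L') : HasCert A T d' L' f := by
  obtain ⟨l, hl, hg, rfl⟩ := hf
  exact ⟨l, hl.trans hL, fun g h => ⟨(hg g h).1, (hg g h).2.mono hd⟩, rfl⟩

theorem HasCert.add {d L L' : ℕ} {f g : MvPolynomial σ F}
    (hf : HasCert A T d L f) (hg : HasCert A T d L' g) :
    HasCert A T d (L + L') (f + g) := by
  obtain ⟨l, hl, h, rfl⟩ := hf
  obtain ⟨l', hl', h', rfl⟩ := hg
  refine ⟨l ++ l', by rw [List.length_append]; omega, fun q hq => ?_,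
    by rw [List.map_append, List.sum_append]⟩
  exact (List.mem_append.1 hq).elim (h q) (h' q)

theorem hasCert_sum {d : ℕ} {ι : Type*} (s : Finset ι)
    {f : ι → MvPolynomial σ F} {L : ι → ℕ} (hf : ∀ i ∈ s, HasCert A T d (L i) (f i)) :
    HasCert A T d (∑ i ∈ s, L i) (∑ i ∈ s, f i) := by
  classical
  induction s using Finset.induction_on with
  | empty => exact hasCert_zero _ _
  | insert a s ha ih =>
    rw [Finset.sum_insert ha, Finset.sum_insert ha]
    exact (hf a (Finset.mem_insert_self _ _)).add
      (ih fun i hi => hf i (Finset.mem_insert_of_mem hi))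

theorem hasCert_sum_const {d L : ℕ} {ι : Type*} (s : Finset ι)
    {f : ι → MvPolynomial σ F} (hf : ∀ i ∈ s, HasCert A T d L (f i)) :
    HasCert A T d (s.card * L) (∑ i ∈ s, f i) := by
  simpa using hasCert_sum s hf

theorem HasCert.mul_isSplit {d d' L : ℕ} {f g : MvPolynomial σ F} (hf : HasCert A T d L f)
    (hg : IsSplit T d' g) : HasCert A T (d + d') L (f * g) := by
  obtain ⟨l, hl, h, rfl⟩ := hf
  refine ⟨l.map fun q => (q.1, q.2 * g), by simpa using hl, fun q hq => ?_, ?_⟩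
  · obtain ⟨q', hq', rfl⟩ := List.mem_map.1 hq
    exact ⟨(h q' hq').1, (h q' hq').2.mul hg⟩
  · rw [← List.sum_map_mul_right, List.map_map]
    simp only [Function.comp_def, mul_assoc]

theorem HasCert.mul {d d' L M : ℕ} {f g : MvPolynomial σ F} (hf : HasCert A T d L f)
    (hg : HasSplitRank T d' M g) : HasCert A T (d + d') (L * M) (f * g) := by
  obtain ⟨l, hl, h, rfl⟩ := hg
  refine HasCert.mono ?_ le_rfl (Nat.mul_le_mul_left L hl)
  clear hl
  induction l with
  | nil => simpa using hasCert_zero _ _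
  | cons q l ih =>
    rw [List.sum_cons, mul_add, List.length_cons, Nat.mul_succ, add_comm (f * q)]
    exact (ih fun g hg => h g (List.mem_cons_of_mem _ hg)).add
      (hf.mul_isSplit (h q List.mem_cons_self))

theorem HasCert.neg {d L : ℕ} {f : MvPolynomial σ F} (hf : HasCert A T d L f) :
    HasCert A T d L (-f) := by
  have := hf.mul_isSplit (isSplit_C T 0 (-1))
  simpa using this

end Certificates

/-! ### The group algebra of residues and interpolation -/

section ResidueAlgebra

/-- Polynomials graded by residues mod `p`. -/
abbrev ResidueAlgebra (F σ : Type*) [Field F] (p : ℕ) : Type _ :=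
  AddMonoidAlgebra (MvPolynomial σ F) (ZMod p)

variable {F σ : Type*} [Field F] {p : ℕ}

/-- Reduce the Lagrange basis polynomials modulo t^p = 1 and read off the coefficient at `a`; for `k
< s.card`, interpolating t^k at the points of `s` is exact. The weights thus extract a residue
coefficient from the values at the points. -/
theorem exists_interpolation_weights (s : Finset F) (a : ZMod p) :
    ∃ w : F → F, ∀ k < s.card, ∑ l ∈ s, w l * l ^ k = if (k : ZMod p) = a then 1 else 0 := by
  classical
  let φ : Polynomial F → AddMonoidAlgebra F (ZMod p) :=
    Polynomial.aeval (AddMonoidAlgebra.single 1 1 : AddMonoidAlgebra F (ZMod p))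
  refine ⟨fun l => (φ (Lagrange.basis s id l)).coeff a, fun k hk => ?_⟩
  have h := Lagrange.eq_interpolate (s := s) (v := id) (f := (Polynomial.X : Polynomial F) ^ k)
    Function.injective_id.injOn (by rw [Polynomial.degree_X_pow]; exact_mod_cast hk)
  have h' := congrArg (fun q => (φ q).coeff a) h
  simp only [φ, Lagrange.interpolate_apply, map_sum, map_mul, Polynomial.aeval_C, map_pow,
    Polynomial.aeval_X, Polynomial.eval_pow, Polynomial.eval_X, id,
    AddMonoidAlgebra.single_pow, one_pow, nsmul_eq_mul, mul_one,
    AddMonoidAlgebra.coeff_single, Finsupp.single_apply] at h'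
  rw [h', AddMonoidAlgebra.coeff_sum, Finsupp.finsetSum_apply]
  refine Finset.sum_congr rfl fun l _ => ?_
  simp only [φ]
  rw [← map_pow, ← Algebra.smul_def, AddMonoidAlgebra.coeff_smul_apply, smul_eq_mul, mul_comm]

theorem coeff_aeval_eq_sum_eval (s : Finset F) (a : ZMod p) {w : F → F}
    (hw : ∀ k < s.card, ∑ l ∈ s, w l * l ^ k = if (k : ZMod p) = a then 1 else 0)
    (H : Polynomial (MvPolynomial σ F)) (hH : H.natDegree < s.card) :
    (Polynomial.aeval (AddMonoidAlgebra.single 1 1 : ResidueAlgebra F σ p) H).coeff a =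
      ∑ l ∈ s, C (w l) * H.eval (C l) := by
  classical
  simp only [Polynomial.aeval_eq_sum_range' hH, Polynomial.eval_eq_sum_range' hH]
  simp only [Finset.mul_sum]
  rw [Finset.sum_comm, AddMonoidAlgebra.coeff_sum, Finsupp.finsetSum_apply]
  refine Finset.sum_congr rfl fun k hk => ?_
  have h := hw k (Finset.mem_range.1 hk)
  have e : ∑ l ∈ s, C (w l) * (H.coeff k * C l ^ k) =
      H.coeff k * C (∑ l ∈ s, w l * l ^ k) := by
    rw [map_sum, Finset.mul_sum]
    refine Finset.sum_congr rfl fun l _ => ?_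
    rw [map_mul, map_pow]
    ring
  rw [e, h]
  simp only [AddMonoidAlgebra.single_pow, one_pow, nsmul_eq_mul, mul_one,
    AddMonoidAlgebra.coeff_smul_apply, AddMonoidAlgebra.coeff_single, Finsupp.single_apply]
  split_ifs <;> simp

theorem isSplit_prod_embedding {ι : Type*} (ν : ι ↪ σ) {T : Finset σ} {S : Finset ι}
    (hS : S.map ν ⊆ T) {d : ℕ} (u : ι → Polynomial F) (hu : ∀ q, (u q).natDegree ≤ d) :
    IsSplit T d (∏ q ∈ S, Polynomial.aeval (X (ν q) : MvPolynomial σ F) (u q)) := by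
  have h := isSplit_prod_of_subset hS (d := d) (Function.extend ν u 1) fun x hx => by
    obtain ⟨q, _, rfl⟩ := Finset.mem_map.1 hx
    rw [ν.injective.extend_apply]
    exact hu q
  rw [Finset.prod_map] at h
  simpa only [ν.injective.extend_apply] using h

variable [NeZero p]

theorem AddMonoidAlgebra.coeff_mul_eq_sum {R : Type*} [Semiring R]
    (f g : AddMonoidAlgebra R (ZMod p)) (a : ZMod p) :
    (f * g).coeff a = ∑ b : ZMod p, f.coeff b * g.coeff (a - b) := by
  classical
  rw [AddMonoidAlgebra.coeff_mul_antidiag f g a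
    (Finset.univ.map ⟨fun b : ZMod p => (b, a - b), fun b b' h => (Prod.ext_iff.1 h).1⟩),
    Finset.sum_map]
  · rfl
  · rintro ⟨b, b'⟩
    simp only [Finset.mem_map, Finset.mem_univ, true_and]
    constructor
    · rintro ⟨c, hc⟩
      obtain ⟨rfl, rfl⟩ := Prod.mk.inj hc
      exact add_sub_cancel _ _
    · rintro rfl
      exact ⟨b, Prod.ext rfl (add_sub_cancel_left _ _)⟩

theorem AddMonoidAlgebra.coeff_single_mul_one {R : Type*} [Semiring R]
    (f : AddMonoidAlgebra R (ZMod p)) (c a : ZMod p) :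
    (AddMonoidAlgebra.single c 1 * f).coeff a = f.coeff (a - c) := by
  rw [AddMonoidAlgebra.coeff_mul_eq_sum, Finset.sum_eq_single c]
  · simp
  · intro b _ hb
    simp [AddMonoidAlgebra.coeff_single, hb.symm]
  · simp

/-- The coefficients of `f` have split rank at most `M`. -/
def ResidueAlgebra.HasSplitRank (T : Finset σ) (d M : ℕ) (f : ResidueAlgebra F σ p) : Prop :=
  ∀ a, _root_.HasSplitRank T d M (f.coeff a)

/-- The coefficients of `f` have certificates of length at most `L`. -/
def ResidueAlgebra.HasCert (A : Set (MvPolynomial σ F)) (T : Finset σ) (d L : ℕ)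
    (f : ResidueAlgebra F σ p) : Prop :=
  ∀ a, _root_.HasCert A T d L (f.coeff a)

theorem ResidueAlgebra.HasCert.mul {A : Set (MvPolynomial σ F)} {T : Finset σ} {d d' L M : ℕ}
    {f g : ResidueAlgebra F σ p} (hf : ResidueAlgebra.HasCert A T d L f)
    (hg : ResidueAlgebra.HasSplitRank T d' M g) :
    ResidueAlgebra.HasCert A T (d + d') (p * (L * M)) (f * g) := by
  intro a
  rw [AddMonoidAlgebra.coeff_mul_eq_sum]
  have := hasCert_sum_const (Finset.univ : Finset (ZMod p))
    fun b _ => (hf b).mul (hg (a - b))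
  rwa [Finset.card_univ, ZMod.card] at this

/-- Telescoping: replace one factor `B i` by its power of t at a time. The factors not yet replaced
act as cofactors, so only their split rank enters, and the errors add up instead of multiplying. -/
theorem ResidueAlgebra.HasCert.prod_sub {A : Set (MvPolynomial σ F)} {T : Finset σ}
    {d d' L M : ℕ} {ι : Type*} (O : Finset ι) {B : ι → ResidueAlgebra F σ p} {c : ι → ZMod p}
    (hB : ∀ i ∈ O, ResidueAlgebra.HasCert A T d L (B i - AddMonoidAlgebra.single (c i) 1))
    (hrank : ∀ O' ⊆ O, ResidueAlgebra.HasSplitRank T d' M (∏ i ∈ O', B i)) :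
    ResidueAlgebra.HasCert A T (d + d') (O.card * (p * (L * M)))
      (∏ i ∈ O, B i - AddMonoidAlgebra.single (∑ i ∈ O, c i) 1) := by
  classical
  induction O using Finset.induction_on with
  | empty =>
    intro a
    rw [Finset.prod_empty, Finset.sum_empty, ← AddMonoidAlgebra.one_def, sub_self]
    exact hasCert_zero _ _
  | insert i O hi ih =>
    have h₁ := (hB i (Finset.mem_insert_self _ _)).mul (hrank O (Finset.subset_insert _ _))
    have h₂ := ih (fun j hj => hB j (Finset.mem_insert_of_mem hj))
      (fun O' hO' => hrank O' (hO'.trans (Finset.subset_insert _ _)))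
    intro a
    have e : ∏ j ∈ insert i O, B j - AddMonoidAlgebra.single (∑ j ∈ insert i O, c j) 1 =
        (B i - AddMonoidAlgebra.single (c i) 1) * ∏ j ∈ O, B j +
        AddMonoidAlgebra.single (c i) 1 *
          (∏ j ∈ O, B j - AddMonoidAlgebra.single (∑ j ∈ O, c j) 1) := by
      rw [Finset.prod_insert hi, Finset.sum_insert hi, mul_sub,
        AddMonoidAlgebra.single_mul_single, mul_one]
      ring
    rw [e, AddMonoidAlgebra.coeff_add, Finsupp.add_apply, AddMonoidAlgebra.coeff_single_mul_one,
      Finset.card_insert_of_notMem hi, Nat.succ_mul, add_comm (O.card * _)]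
    exact (h₁ a).add (h₂ _)

/-- The factor `1 + (t ^ a - 1) x`, which is `t ^ a` if `x = 1`, and `1` if `x = 0`. -/
def residueFactor (F : Type*) {σ : Type*} [Field F] {p : ℕ} (a : ZMod p) (x : σ) :
    ResidueAlgebra F σ p :=
  1 + AddMonoidAlgebra.single a (X x) - AddMonoidAlgebra.single 0 (X x)

/-- Lift the product to a polynomial `H` in t of degree at most `p * S.card`. At a scalar value of t
it becomes a product of univariate factors, and `p * S.card + 1` distinct scalars suffice to recover
each coefficient. The size of the field is needed for these points. -/
theorem hasSplitRank_prod_residueFactor {ι : Type*} (ν : ι ↪ σ) (r : ι → ZMod p) {T : Finset σ}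
    {S : Finset ι} (hS : S.map ν ⊆ T) (hF : ((p * S.card + 1 : ℕ) : ℕ∞) ≤ ENat.card F) :
    ResidueAlgebra.HasSplitRank T 1 (p * S.card + 1)
      (∏ q ∈ S, residueFactor F (r q) (ν q)) := by
  intro a
  obtain ⟨s, hs⟩ : ∃ s : Finset F, s.card = p * S.card + 1 := by
    rcases finite_or_infinite F with hfin | hinf
    · have := Fintype.ofFinite F
      rw [ENat.card_eq_coe_fintype_card, Nat.cast_le] at hF
      obtain ⟨s, _, hs⟩ := Finset.exists_subset_card_eq (s := (Finset.univ : Finset F)) hF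
      exact ⟨s, hs⟩
    · exact Infinite.exists_subset_card_eq F _
  obtain ⟨w, hw⟩ := exists_interpolation_weights (p := p) s a
  let H : Polynomial (MvPolynomial σ F) :=
    ∏ q ∈ S, (1 + (Polynomial.X ^ (r q).val - 1) * Polynomial.C (X (ν q)))
  have hdeg : H.natDegree < s.card := by
    rw [hs, Nat.lt_succ_iff]
    refine (Polynomial.natDegree_prod_le _ _).trans ?_
    rw [mul_comm, ← smul_eq_mul]
    refine Finset.sum_le_card_nsmul _ _ _ fun q _ => ?_
    refine (Polynomial.natDegree_add_le _ _).trans (max_le (by simp) ?_)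
    refine Polynomial.natDegree_mul_le.trans ?_
    rw [Polynomial.natDegree_C, add_zero]
    refine (Polynomial.natDegree_sub_le _ _).trans (max_le ?_ (by simp))
    exact (Polynomial.natDegree_X_pow_le _).trans (ZMod.val_lt _).le
  have hH : Polynomial.aeval (AddMonoidAlgebra.single 1 1 : ResidueAlgebra F σ p) H =
      ∏ q ∈ S, residueFactor F (r q) (ν q) := by
    rw [map_prod]
    refine Finset.prod_congr rfl fun q _ => ?_
    have h0 : algebraMap (MvPolynomial σ F) (ResidueAlgebra F σ p) (X (ν q)) =
        AddMonoidAlgebra.single 0 (X (ν q)) := rfl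
    simp only [map_add, map_one, map_mul, map_sub, map_pow, Polynomial.aeval_X, Polynomial.aeval_C,
      AddMonoidAlgebra.single_pow, one_pow, nsmul_eq_mul, mul_one, ZMod.natCast_val,
      ZMod.cast_id', id, residueFactor, h0, sub_mul, one_mul, AddMonoidAlgebra.single_mul_single,
      add_zero]
    ring
  rw [← hH, coeff_aeval_eq_sum_eval s a hw H hdeg, ← hs]
  have := hasSplitRank_sum (T := T) (d := 1) s (M := fun _ => 1)
    (f := fun l => C (w l) * H.eval (C l)) fun l _ => ?_
  · simpa using this
  · refine (IsSplit.hasSplitRank ?_).C_mul _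
    have := isSplit_prod_embedding (F := F) ν hS (d := 1)
      (fun q => 1 + Polynomial.C (l ^ (r q).val - 1) * Polynomial.X) fun q => by compute_degree
    convert this using 1
    rw [Polynomial.eval_prod]
    refine Finset.prod_congr rfl fun q _ => ?_
    simp [algebraMap_eq]

end ResidueAlgebra

/-! ### Local constraints on variables that encode values -/

section OneHot

variable {F σ D : Type*} [Field F] {p : ℕ} (ν : D × ZMod p ↪ σ)
  {A : Set (MvPolynomial σ F)} {T : Finset σ}

/-- The assignment which gives the value `j e` to every `e`, in the variables `ν (e, i)`, which say
that the value of `e` is `i`. -/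
def oneHotPoint (F : Type*) [Field F] {σ D : Type*} {p : ℕ} (ν : D × ZMod p ↪ σ)
    (j : D → ZMod p) : σ → F :=
  Function.extend ν (fun q => if q.2 = j q.1 then 1 else 0) 0

theorem oneHotPoint_apply (j : D → ZMod p) (q : D × ZMod p) :
    oneHotPoint F ν j (ν q) = if q.2 = j q.1 then 1 else 0 := by
  rw [oneHotPoint, ν.injective.extend_apply]

theorem isSplit_prod_selected (hT : ∀ q, ν q ∈ T) (S : Finset D) (j : D → ZMod p) :
    IsSplit T 1 (∏ e ∈ S, (X (ν (e, j e)) : MvPolynomial σ F)) := by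
  have := isSplit_prod_embedding (F := F)
    (⟨fun e => ν (e, j e), fun e e' h => (Prod.ext_iff.1 (ν.injective h)).1⟩ : D ↪ σ)
    (T := T) (S := S) (d := 1) (fun x hx => by
      obtain ⟨e, _, rfl⟩ := Finset.mem_map.1 hx
      exact hT _) (fun _ => Polynomial.X) fun _ => Polynomial.natDegree_X_le
  simp only [Polynomial.aeval_X] at this
  exact this

/-- In the presence of the factor for (e, j e), the variable with the selected value may be replaced
by 1 through its Boolean axiom, and any other variable of `e` by 0 through the uniqueness axiom. -/
theorem hasCert_selected_mul_univariate (hT : ∀ q, ν q ∈ T)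
    (hBool : ∀ q, X (ν q) * (1 - X (ν q)) ∈ A)
    (hUnique : ∀ e i j, i ≠ j → X (ν (e, i)) * X (ν (e, j)) ∈ A)
    {S : Finset D} (j : D → ZMod p) {d : ℕ} (u : Polynomial F) (hu : u.natDegree ≤ d)
    {q : D × ZMod p} (hq : q.1 ∈ S) :
    HasCert A T (d + 1) 1 ((∏ e ∈ S, X (ν (e, j e))) *
      (Polynomial.aeval (X (ν q) : MvPolynomial σ F) u - C (u.eval (oneHotPoint F ν j (ν q))))) := by
  classical
  obtain ⟨e, i⟩ := q
  rw [oneHotPoint_apply]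
  dsimp only at hq ⊢
  rw [← Finset.mul_prod_erase S _ hq]
  split_ifs with h
  · subst h
    obtain ⟨w, hw⟩ : (Polynomial.X - Polynomial.C 1) ∣ (u - Polynomial.C (u.eval 1)) :=
      Polynomial.X_sub_C_dvd_sub_C_eval
    have hwd : w.natDegree ≤ d := by
      rcases eq_or_ne w 0 with rfl | hw0
      · simp
      have h1 := congrArg Polynomial.natDegree hw
      rw [(Polynomial.monic_X_sub_C (1 : F)).natDegree_mul' hw0, Polynomial.natDegree_X_sub_C,
        Polynomial.natDegree_sub_C] at h1
      omega
    have e1 := congrArg (Polynomial.aeval (X (ν (e, j e)) : MvPolynomial σ F)) hw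
    simp only [map_sub, map_mul, Polynomial.aeval_X, Polynomial.aeval_C, algebraMap_eq, C_1] at e1
    rw [e1]
    have := (hasCert_of_mem (hBool (e, j e)) ((isSplit_aeval (hT (e, j e)) w hwd).mul
      (isSplit_prod_selected (F := F) ν hT (S.erase e) j))).neg
    convert this using 1
    ring
  · have e1 : Polynomial.aeval (X (ν (e, i)) : MvPolynomial σ F) u - C (u.eval 0) =
        X (ν (e, i)) * Polynomial.aeval (X (ν (e, i)) : MvPolynomial σ F) u.divX := by
      conv_lhs => enter [1]; rw [← Polynomial.divX_mul_X_add u]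
      rw [← Polynomial.coeff_zero_eq_eval_zero]
      simp only [map_add, map_mul, Polynomial.aeval_X, Polynomial.aeval_C, algebraMap_eq]
      ring
    rw [e1]
    have := hasCert_of_mem (hUnique e (j e) i (Ne.symm h)) ((isSplit_aeval (hT (e, i)) u.divX
      ((Polynomial.natDegree_divX_eq_natDegree_tsub_one (p := u)).le.trans
        ((Nat.sub_le _ _).trans hu))).mul
      (isSplit_prod_selected (F := F) ν hT (S.erase e) j))
    convert this using 1
    ring

theorem hasCert_selected_mul_prod (hT : ∀ q, ν q ∈ T)
    (hBool : ∀ q, X (ν q) * (1 - X (ν q)) ∈ A)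
    (hUnique : ∀ e i j, i ≠ j → X (ν (e, i)) * X (ν (e, j)) ∈ A)
    {S : Finset D} (j : D → ZMod p) {d : ℕ} (u : σ → Polynomial F)
    (hu : ∀ x, (u x).natDegree ≤ d) (W : Finset (D × ZMod p)) (hW : ∀ q ∈ W, q.1 ∈ S) :
    HasCert A T (2 * d + 1) W.card ((∏ e ∈ S, X (ν (e, j e))) *
      ((∏ q ∈ W, Polynomial.aeval (X (ν q) : MvPolynomial σ F) (u (ν q))) -
        C (∏ q ∈ W, (u (ν q)).eval (oneHotPoint F ν j (ν q))))) := by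
  classical
  induction W using Finset.induction_on with
  | empty => simpa using hasCert_zero _ _
  | insert a W ha ih =>
    have h₁ := (hasCert_selected_mul_univariate ν hT hBool hUnique j (u (ν a)) (hu _)
      (hW a (Finset.mem_insert_self _ _))).mul_isSplit
      (isSplit_prod_embedding (F := F) ν (T := T) (S := W) (d := d) (fun x hx => by
        obtain ⟨q, _, rfl⟩ := Finset.mem_map.1 hx
        exact hT q) (fun q => u (ν q)) fun q => hu _)
    have h₂ := (ih fun q hq => hW q (Finset.mem_insert_of_mem hq)).mul_isSplit
      (isSplit_C T 0 ((u (ν a)).eval (oneHotPoint F ν j (ν a))))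
    rw [Finset.card_insert_of_notMem ha]
    have := (h₁.mono (d' := 2 * d + 1) (by omega) le_rfl).add h₂
    convert this using 1
    · omega
    rw [Finset.prod_insert ha, Finset.prod_insert ha, C_mul]
    ring

/-- The variables of the elements of `S`. -/
def oneHotVars [NeZero p] (S : Finset D) : Finset σ := (S ×ˢ (Finset.univ : Finset (ZMod p))).map ν

theorem eval_aeval_X (b : σ → F) (x : σ) (u : Polynomial F) :
    eval b (Polynomial.aeval (X x : MvPolynomial σ F) u) = u.eval (b x) := by
  have : (eval b).comp (algebraMap F (MvPolynomial σ F)) = RingHom.id F := by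
    ext c
    simp [algebraMap_eq]
  rw [Polynomial.aeval_def, Polynomial.hom_eval₂, eval_X, this, Polynomial.eval₂_id]

theorem hasCert_selected_mul_sub_eval [NeZero p] (hT : ∀ q, ν q ∈ T)
    (hBool : ∀ q, X (ν q) * (1 - X (ν q)) ∈ A)
    (hUnique : ∀ e i j, i ≠ j → X (ν (e, i)) * X (ν (e, j)) ∈ A)
    {S : Finset D} (j : D → ZMod p) {d M : ℕ} {f : MvPolynomial σ F}
    (hf : HasSplitRank (oneHotVars ν S) d M f) :
    HasCert A T (2 * d + 1) (M * (S.card * p)) ((∏ e ∈ S, X (ν (e, j e))) *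
      (f - C (eval (oneHotPoint F ν j) f))) := by
  classical
  obtain ⟨l, hl, h, rfl⟩ := hf
  refine HasCert.mono ?_ le_rfl (Nat.mul_le_mul_right _ hl)
  clear hl
  induction l with
  | nil => simpa using hasCert_zero _ _
  | cons q l ih =>
    obtain ⟨c, u, hu, hq⟩ := h q List.mem_cons_self
    have h₁ := (hasCert_selected_mul_prod (T := T) ν hT hBool hUnique j u hu
      (S ×ˢ (Finset.univ : Finset (ZMod p))) fun q hq => (Finset.mem_product.1 hq).1).mul_isSplit
      (isSplit_C T 0 c)
    have h₂ := ih fun g hg => h g (List.mem_cons_of_mem _ hg)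
    rw [Finset.card_product, Finset.card_univ, ZMod.card] at h₁
    rw [List.length_cons]
    have := h₂.add h₁
    convert this using 1
    · ring
    rw [List.sum_cons, hq, oneHotVars, Finset.prod_map]
    simp only [map_add, map_mul, map_prod, eval_C, eval_aeval_X]
    ring

/-- Modulo products of two variables of `e`, the product of the factors 1 - x is 1 minus their sum;
up to sign that product is the clause saying that `e` has a value. -/
theorem hasCert_sum_sub_one [NeZero p] (hT : ∀ q, ν q ∈ T)
    (hUnique : ∀ e i j, i ≠ j → X (ν (e, i)) * X (ν (e, j)) ∈ A)
    (hSome : ∀ e, ∏ i : ZMod p, (X (ν (e, i)) - 1) ∈ A) (e : D) :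
    HasCert A T p (p * p + 1) (∑ i : ZMod p, X (ν (e, i)) - 1 : MvPolynomial σ F) := by
  classical
  have key : ∀ U : Finset (ZMod p), HasCert A T U.card (U.card * p)
      (∏ i ∈ U, (1 - X (ν (e, i))) - (1 - ∑ i ∈ U, X (ν (e, i))) : MvPolynomial σ F) := by
    intro U
    induction U using Finset.induction_on with
    | empty => simpa using hasCert_zero _ _
    | insert a U ha ih =>
      have hs : IsSplit T 1 (1 - X (ν (e, a)) : MvPolynomial σ F) := by
        have := isSplit_aeval (F := F) (hT (e, a)) (1 - Polynomial.X) (d := 1) (by compute_degree)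
        simpa using this
      have h₁ := ih.mul_isSplit hs
      have h₂ := hasCert_sum_const (A := A) (T := T) (d := 0) (L := 1) U
        (f := fun i => X (ν (e, a)) * X (ν (e, i)) * (1 : MvPolynomial σ F)) fun i hi =>
          hasCert_of_mem (hUnique e a i fun h => ha (h ▸ hi)) (isSplit_one _ _)
      have hU : U.card ≤ p := (Finset.card_le_univ U).trans_eq (ZMod.card p)
      have := (h₁.add (h₂.mono (Nat.zero_le _) le_rfl))
      rw [Finset.card_insert_of_notMem ha]
      refine HasCert.mono (L := U.card * p + U.card * 1) ?_ le_rfl (by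
        rw [Nat.succ_mul]; omega)
      convert this using 1
      rw [Finset.prod_insert ha, Finset.sum_insert ha]
      simp only [mul_one, ← Finset.mul_sum]
      ring
  have h₁ := key Finset.univ
  rw [Finset.card_univ, ZMod.card] at h₁
  have h₂ := hasCert_of_mem (hSome e) (isSplit_C T p ((-1) ^ (p + 1)))
  have := h₁.add h₂
  convert this using 1
  have e1 : ∏ i : ZMod p, (X (ν (e, i)) - 1 : MvPolynomial σ F) =
      (-1) ^ p * ∏ i : ZMod p, (1 - X (ν (e, i))) := by
    calc ∏ i : ZMod p, (X (ν (e, i)) - 1 : MvPolynomial σ F)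
        = ∏ i : ZMod p, (-1) * (1 - X (ν (e, i))) := Finset.prod_congr rfl fun i _ => by ring
      _ = _ := by rw [Finset.prod_mul_distrib, Finset.prod_const, Finset.card_univ, ZMod.card]
  have e2 : ((-1 : MvPolynomial σ F) ^ p) * (-1) ^ p = 1 := by
    rw [← mul_pow]; simp
  rw [e1, map_pow, map_neg, C_1, pow_succ]
  linear_combination (∏ i : ZMod p, (1 - X (ν (e, i)) : MvPolynomial σ F)) * e2

theorem hasCert_prod_sum_sub_one [NeZero p] (hT : ∀ q, ν q ∈ T)
    (hUnique : ∀ e i j, i ≠ j → X (ν (e, i)) * X (ν (e, j)) ∈ A)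
    (hSome : ∀ e, ∏ i : ZMod p, (X (ν (e, i)) - 1) ∈ A) (S : Finset D) :
    HasCert A T (p + S.card) (S.card * ((p * p + 1) * p ^ S.card))
      (∏ e ∈ S, ∑ i : ZMod p, X (ν (e, i)) - 1 : MvPolynomial σ F) := by
  classical
  induction S using Finset.induction_on with
  | empty => simpa using hasCert_zero _ _
  | insert a S ha ih =>
    have hrank : HasSplitRank T (S.card * 1) (p ^ S.card)
        (∏ e ∈ S, ∑ i : ZMod p, (X (ν (e, i)) : MvPolynomial σ F)) := by
      refine hasSplitRank_prod S fun e _ => ?_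
      have := hasSplitRank_sum (T := T) (d := 1) (Finset.univ : Finset (ZMod p)) (M := fun _ => 1)
        (f := fun i => (X (ν (e, i)) : MvPolynomial σ F)) fun i _ => (isSplit_X (hT _)).hasSplitRank
      simpa [ZMod.card] using this
    have h := (hasCert_sum_sub_one ν hT hUnique hSome a).mul hrank
    have hp : p ^ S.card ≤ p ^ (S.card + 1) := Nat.pow_le_pow_right (NeZero.pos p) (Nat.le_succ _)
    rw [Finset.card_insert_of_notMem ha, Finset.prod_insert ha, Nat.succ_mul]
    have := (ih.mono (d' := p + (S.card + 1)) (by omega)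
      (Nat.mul_le_mul_left _ (Nat.mul_le_mul_left _ hp))).add
      (h.mono (d' := p + (S.card + 1)) (by omega) (Nat.mul_le_mul_left _ hp))
    convert this using 1
    ring

/-- Modulo the axioms, 1 is the sum of the selecting monomials over all assignments to `S`.
Multiplied by such a monomial, `f` reduces to its value there, which is 0 unless the monomial has a
certificate itself. The cost is exponential in `S.card` only. -/
theorem HasCert.of_selected [NeZero p] (hT : ∀ q, ν q ∈ T)
    (hBool : ∀ q, X (ν q) * (1 - X (ν q)) ∈ A)
    (hUnique : ∀ e i j, i ≠ j → X (ν (e, i)) * X (ν (e, j)) ∈ A)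
    (hSome : ∀ e, ∏ i : ZMod p, (X (ν (e, i)) - 1) ∈ A) {S : Finset D} {M L₀ d₀ : ℕ}
    {f : MvPolynomial σ F} (hf : HasSplitRank (oneHotVars ν S) 1 M f)
    (hsel : ∀ j : D → ZMod p, eval (oneHotPoint F ν j) f = 0 ∨
      HasCert A T d₀ L₀ (∏ e ∈ S, X (ν (e, j e)))) :
    HasCert A T (p + S.card + d₀ + 3)
      (S.card * ((p * p + 1) * p ^ S.card) * M + p ^ S.card * (M * (S.card * p) + L₀ * M)) f := by
  classical
  have hfT : HasSplitRank T 1 M f := by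
    obtain ⟨l, hl, h, rfl⟩ := hf
    refine ⟨l, hl, fun g hg => ?_, rfl⟩
    obtain ⟨c, u, hu, rfl⟩ := h g hg
    have h0 : oneHotVars ν S ⊆ T := fun x hx => by
      obtain ⟨q, _, rfl⟩ := Finset.mem_map.1 hx
      exact hT q
    simpa using (isSplit_C T 0 c).mul (isSplit_prod_of_subset h0 (d := 1) u fun x _ => hu x)
  -- The value 0 outside `S` is arbitrary: the selecting monomials see only `S`.
  let ext : (S → ZMod p) → D → ZMod p := fun j e => if h : e ∈ S then j ⟨e, h⟩ else 0
  have hprod : ∏ e ∈ S, ∑ i : ZMod p, (X (ν (e, i)) : MvPolynomial σ F) =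
      ∑ j : S → ZMod p, ∏ e ∈ S, X (ν (e, ext j e)) := by
    rw [← Finset.prod_coe_sort, Finset.prod_univ_sum, Fintype.piFinset_univ]
    refine Finset.sum_congr rfl fun j _ => ?_
    rw [← Finset.prod_coe_sort S]
    refine Finset.prod_congr rfl fun e _ => ?_
    simp [ext]
  have h₁ := ((hasCert_prod_sum_sub_one ν hT hUnique hSome S).mul hfT).neg
  have h₂ : HasCert A T (d₀ + 3) ((Finset.univ : Finset (S → ZMod p)).card *
      (M * (S.card * p) + L₀ * M)) (∑ j : S → ZMod p, (∏ e ∈ S, X (ν (e, ext j e))) * f) := by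
    refine hasCert_sum_const _ fun j _ => ?_
    rcases hsel (ext j) with h | h
    · have := hasCert_selected_mul_sub_eval (T := T) ν hT hBool hUnique (ext j) hf
      rw [h, C_0, sub_zero] at this
      exact this.mono (by omega) (Nat.le_add_right _ _)
    · exact (h.mul hfT).mono (by omega) (Nat.le_add_left _ _)
  rw [Finset.card_univ, Fintype.card_fun, ZMod.card, Fintype.card_coe] at h₂
  have := (h₁.mono (d' := p + S.card + d₀ + 3) (by omega) le_rfl).add
    (h₂.mono (d' := p + S.card + d₀ + 3) (by omega) le_rfl)
  convert this using 1
  rw [← Finset.sum_mul, ← hprod]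
  ring

end OneHot

/-! ### Refuting Tseitin formulas -/

section TseitinRefutation

variable {F σ D : Type*} [Field F] {p : ℕ} [NeZero p] (ν : D × ZMod p ↪ σ)

/-- The product of `∑ i, t ^ i * x_{e,i}` over the elements `e` of `S`, as a product of factors with
one variable each. -/
def residueProd (F : Type*) {σ D : Type*} [Field F] {p : ℕ} [NeZero p] (ν : D × ZMod p ↪ σ)
    (S : Finset D) : ResidueAlgebra F σ p :=
  ∏ q ∈ S ×ˢ (Finset.univ : Finset (ZMod p)), residueFactor F q.2 (ν q)

theorem residueProd_eq_prod (S : Finset D) :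
    residueProd F ν S = ∏ e ∈ S, ∏ i : ZMod p, residueFactor F i (ν (e, i)) :=
  Finset.prod_product _ _ _

theorem prod_residueProd [DecidableEq D] {ι : Type*} (O : Finset ι) {W : ι → Finset D}
    (h : (O : Set ι).PairwiseDisjoint W) :
    ∏ i ∈ O, residueProd F ν (W i) = residueProd F ν (O.biUnion W) := by
  simp only [residueProd_eq_prod, Finset.prod_biUnion h]

/-- At a point that encodes values, exactly one factor per `e` differs from 1. The factored form
thus agrees with the sum of the terms t^i x there, while having only one variable per factor, as
interpolation requires. -/
theorem mapRingHom_residueProd (S : Finset D) (j : D → ZMod p) :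
    AddMonoidAlgebra.mapRingHom (ZMod p) (eval (oneHotPoint F ν j)) (residueProd F ν S) =
      AddMonoidAlgebra.single (∑ e ∈ S, j e) 1 := by
  classical
  have h1 : ∀ (e : D) (i : ZMod p), AddMonoidAlgebra.mapRingHom (ZMod p)
      (eval (oneHotPoint F ν j)) (residueFactor F i (ν (e, i))) =
        if i = j e then AddMonoidAlgebra.single i 1 else 1 := by
    intro e i
    rw [residueFactor, map_sub, map_add, map_one, AddMonoidAlgebra.mapRingHom_single,
      AddMonoidAlgebra.mapRingHom_single, eval_X, oneHotPoint_apply]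
    dsimp only
    split_ifs
    · rw [AddMonoidAlgebra.one_def]; abel
    · simp
  rw [residueProd_eq_prod, map_prod]
  simp only [map_prod, h1, Finset.prod_ite_eq', Finset.mem_univ, if_true]
  induction S using Finset.induction_on with
  | empty => simp [AddMonoidAlgebra.one_def]
  | insert a S ha ih =>
    rw [Finset.prod_insert ha, ih, Finset.sum_insert ha, AddMonoidAlgebra.single_mul_single, mul_one]

theorem hasSplitRank_residueProd [Fintype D]
    (hF : ((p * (Fintype.card D * p) + 1 : ℕ) : ℕ∞) ≤ ENat.card F) {S : Finset D} {T : Finset σ}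
    (hT : oneHotVars ν S ⊆ T) :
    ResidueAlgebra.HasSplitRank T 1 (p * (S.card * p) + 1) (residueProd F ν S) := by
  have h := hasSplitRank_prod_residueFactor (F := F) (T := T) ν
    (fun q : D × ZMod p => q.2) (S := S ×ˢ (Finset.univ : Finset (ZMod p))) hT
  rw [Finset.card_product, Finset.card_univ, ZMod.card] at h
  refine h (le_trans ?_ hF)
  exact_mod_cast Nat.succ_le_succ (Nat.mul_le_mul_left _
    (Nat.mul_le_mul_right _ (Finset.card_le_univ S)))

/-- The length of the certificates for a constraint with at most `Δ` summands. -/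
def localCertLength (p Δ : ℕ) : ℕ :=
  Δ * ((p * p + 1) * p ^ Δ) * (p * (Δ * p) + 2) +
    p ^ Δ * ((p * (Δ * p) + 2) * (Δ * p) + 2 * (p * (Δ * p) + 2))

theorem hasCert_residueProd_sub [Fintype D] {A : Set (MvPolynomial σ F)} {T : Finset σ}
    (hF : ((p * (Fintype.card D * p) + 1 : ℕ) : ℕ∞) ≤ ENat.card F)
    (hT : ∀ q, ν q ∈ T) (hBool : ∀ q, X (ν q) * (1 - X (ν q)) ∈ A)
    (hUnique : ∀ e i j, i ≠ j → X (ν (e, i)) * X (ν (e, j)) ∈ A)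
    (hSome : ∀ e, ∏ i : ZMod p, (X (ν (e, i)) - 1) ∈ A) {S : Finset D} {Δ : ℕ}
    (hS : S.card ≤ Δ) (c : ZMod p)
    (hsel : ∀ j : D → ZMod p, ∑ e ∈ S, j e ≠ c → HasCert A T 1 2 (∏ e ∈ S, X (ν (e, j e)))) :
    ResidueAlgebra.HasCert A T (p + Δ + 4) (localCertLength p Δ)
      (residueProd F ν S - AddMonoidAlgebra.single c 1) := by
  classical
  intro a
  have hrank : HasSplitRank (oneHotVars ν S) 1 (p * (Δ * p) + 2)
      ((residueProd F ν S - AddMonoidAlgebra.single c 1).coeff a) := by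
    have h₁ := hasSplitRank_residueProd ν hF (S := S) (T := oneHotVars ν S) subset_rfl a
    have h₂ := (isSplit_C (F := F) (oneHotVars ν S) 1 (if c = a then -1 else 0)).hasSplitRank
    have h := h₁.add h₂
    refine HasSplitRank.mono (d := 1) (M := p * (S.card * p) + 1 + 1) ?_ le_rfl ?_
    · convert h using 1
      rw [AddMonoidAlgebra.coeff_sub, Finsupp.sub_apply, AddMonoidAlgebra.coeff_single,
        Finsupp.single_apply, sub_eq_add_neg]
      split_ifs <;> simp
    · have := Nat.mul_le_mul_left p (Nat.mul_le_mul_right p hS)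
      omega
  refine (HasCert.of_selected (L₀ := 2) (d₀ := 1) ν hT hBool hUnique hSome hrank fun j => ?_).mono
    (by omega) ?_
  · by_cases hj : ∑ e ∈ S, j e = c
    · left
      rw [← AddMonoidAlgebra.coeff_mapRingHom, map_sub, mapRingHom_residueProd, hj,
        AddMonoidAlgebra.mapRingHom_single, map_one, sub_self]
      rfl
    · exact .inr (hsel j hj)
  · unfold localCertLength
    have hp := Nat.pow_le_pow_right (NeZero.pos p) hS
    gcongr

/-- A bound for the size of OFPC refutations of Tseitin mod `p` formulas with `V` vertices, degree at
most `Δ` and `D` directed edges. -/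
def tseitinBound (p Δ V D : ℕ) : ℕ :=
  ((V + D) * (p * (localCertLength p Δ * (p * (D * p) + 1))) + 1) *
      (D * p * (2 * (p + Δ + 5) + 1) + 4) *
    (((V + D) * (p * (localCertLength p Δ * (p * (D * p) + 1))) + 1) *
      (D * p * (4 * (2 * (p + Δ + 5) + 2) + 2) + 4) + 1)

theorem exists_isOFPCProof_tseitin {V : Type*} [Fintype V] [Fintype D] [DecidableEq V]
    (ord : LinearOrder σ) (fst : D → V) (symm : D → D) (hsymm : Function.Involutive symm)
    (hne : ∀ e, symm e ≠ e) (charge : V → ZMod p) (hcharge : ∑ v, charge v ≠ 0) {Δ : ℕ}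
    (hΔ : ∀ v, (Finset.univ.filter fun e => fst e = v).card ≤ Δ) (h2 : 2 ≤ Δ)
    (hF : ((p * (Fintype.card D * p) + 1 : ℕ) : ℕ∞) ≤ ENat.card F) {Q : Set (MvPolynomial σ F)}
    (hSome : ∀ e, ∏ i : ZMod p, (X (ν (e, i)) - 1) ∈ Q)
    (hUnique : ∀ e i j, i ≠ j → X (ν (e, i)) * X (ν (e, j)) ∈ Q)
    (hOpp : ∀ e i, X (ν (e, i)) * (X (ν (symm e, -i)) - 1) ∈ Q)
    (hVertex : ∀ (v : V) (j : D → ZMod p),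
      ∑ e ∈ Finset.univ.filter (fun e => fst e = v), j e ≠ charge v →
      ∏ e ∈ Finset.univ.filter (fun e => fst e = v), X (ν (e, j e)) ∈ Q) :
    ∃ Φs : List (NCFormula F σ), IsOFPCProof ord Q Φs 1 ∧
      ofpcSize Φs ≤ tseitinBound p Δ (Fintype.card V) (Fintype.card D) := by
  classical
  let T : Finset σ := Finset.univ.map ν
  have hT : ∀ q, ν q ∈ T := fun q => Finset.mem_map_of_mem _ (Finset.mem_univ q)
  let A : Set (MvPolynomial σ F) := {a | a ∈ Q ∪ pcAxioms F σ ∧ IsSplit T 2 a}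
  have hsub : ∀ (q : D × ZMod p) (c : F), IsSplit T 1 (X (ν q) - C c) := fun q c => by
    have := isSplit_aeval (F := F) (hT q) (Polynomial.X - Polynomial.C c) (d := 1)
      (Polynomial.natDegree_X_sub_C_le c)
    simpa [algebraMap_eq] using this
  have hX : ∀ q, IsSplit T 1 (X (ν q) : MvPolynomial σ F) := fun q => isSplit_X (hT q)
  have hBool' : ∀ q, X (ν q) * (1 - X (ν q)) ∈ A := fun q => by
    refine ⟨.inr ⟨_, rfl⟩, (hX q).mul (d' := 1) ?_⟩
    have := (hsub q 1).mul (isSplit_C T 0 (-1))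
    convert this using 1
    simp
  have hUnique' : ∀ e i j, i ≠ j → X (ν (e, i)) * X (ν (e, j)) ∈ A := fun e i j h =>
    ⟨.inl (hUnique e i j h), (hX _).mul (hX _)⟩
  have hSome' : ∀ e, ∏ i : ZMod p, (X (ν (e, i)) - 1) ∈ A := fun e => by
    refine ⟨.inl (hSome e), ?_⟩
    have := isSplit_prod_embedding (F := F)
      (⟨fun i => ν (e, i), fun i i' h => (Prod.ext_iff.1 (ν.injective h)).2⟩ : ZMod p ↪ σ)
      (T := T) (S := Finset.univ) (d := 2) (fun x hx => by
        obtain ⟨i, _, rfl⟩ := Finset.mem_map.1 hx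
        exact hT _) (fun _ => Polynomial.X - Polynomial.C 1)
      fun _ => (Polynomial.natDegree_X_sub_C_le _).trans one_le_two
    simp only [map_sub, Polynomial.aeval_X, map_one] at this
    exact this
  have hOpp' : ∀ e i, X (ν (e, i)) * (X (ν (symm e, -i)) - 1) ∈ A := fun e i => by
    refine ⟨.inl (hOpp e i), (hX _).mul (d' := 1) ?_⟩
    simpa using hsub (symm e, -i) 1
  let star : V → Finset D := fun v => Finset.univ.filter fun e => fst e = v
  -- An arbitrary numbering selects one orientation of each undirected edge, so that the pairs
  -- indexed by `O` partition `D`.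
  let num : D ≃ Fin (Fintype.card D) := Fintype.equivFin D
  let O : Finset D := Finset.univ.filter fun e => num e < num (symm e)
  let pair : D → Finset D := fun e => {e, symm e}
  set L := localCertLength p Δ
  have hstar : ∀ v ∈ (Finset.univ : Finset V), ResidueAlgebra.HasCert A T (p + Δ + 4) L
      (residueProd F ν (star v) - AddMonoidAlgebra.single (charge v) 1) := fun v _ => by
    refine hasCert_residueProd_sub ν hF hT hBool' hUnique' hSome' (hΔ v) _ fun j hj => ?_
    have : (∏ e ∈ star v, X (ν (e, j e))) ∈ A :=
      ⟨.inl (hVertex v j hj), (isSplit_prod_selected ν hT _ j).mono one_le_two⟩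
    simpa using (hasCert_of_mem this (isSplit_one T 0)).mono (Nat.zero_le 1) one_le_two
  have hpair : ∀ e ∈ O, ResidueAlgebra.HasCert A T (p + Δ + 4) L
      (residueProd F ν (pair e) - AddMonoidAlgebra.single 0 1) := fun e _ => by
    refine hasCert_residueProd_sub ν hF hT hBool' hUnique' hSome'
      (Finset.card_le_two.trans h2) _ fun j hj => ?_
    have hj : ∑ e' ∈ {e, symm e}, j e' ≠ 0 := hj
    change HasCert A T 1 2 (∏ e' ∈ {e, symm e}, X (ν (e', j e')))
    rw [Finset.sum_pair (hne e).symm] at hj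
    rw [Finset.prod_pair (hne e).symm]
    -- Insert the forced variable of `symm e` with value `-j e` by the opposition axiom; it then
    -- clashes with the different value `j (symm e)`.
    have h₁ := (hasCert_of_mem (hOpp' e (j e)) (hX (symm e, j (symm e)))).neg
    have h₂ := hasCert_of_mem (hUnique' (symm e) (-j e) (j (symm e))
      fun h => hj (by rw [← h, add_neg_cancel])) (hX (e, j e))
    convert h₁.add h₂ using 1
    ring
  have hrank : ∀ S : Finset D, ResidueAlgebra.HasSplitRank T 1
      (p * (Fintype.card D * p) + 1) (residueProd F ν S) := fun S a => by
    refine (hasSplitRank_residueProd ν hF (fun x hx => ?_) a).mono le_rfl ?_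
    · obtain ⟨q, _, rfl⟩ := Finset.mem_map.1 hx
      exact hT q
    · have := Nat.mul_le_mul_left p (Nat.mul_le_mul_right p (Finset.card_le_univ S))
      omega
  have hdisj₁ : ∀ O' : Finset V, (O' : Set V).PairwiseDisjoint star := fun O' v _ v' _ h => by
    refine Finset.disjoint_left.2 fun e he he' => h ?_
    exact (Finset.mem_filter.1 he).2.symm.trans (Finset.mem_filter.1 he').2
  have hdisj₂ : ∀ O' ⊆ O, (O' : Set D).PairwiseDisjoint pair := by
    intro O' hO' e he e' he' h
    have h₁ := (Finset.mem_filter.1 (hO' he)).2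
    have h₂ := (Finset.mem_filter.1 (hO' he')).2
    refine Finset.disjoint_left.2 fun x hx hx' => ?_
    simp only [pair, Finset.mem_insert, Finset.mem_singleton] at hx hx'
    rcases hx with rfl | rfl <;> rcases hx' with hx' | hx'
    · exact h hx'
    · rw [hx', hsymm] at h₁
      exact lt_asymm h₁ h₂
    · rw [← hx', hsymm] at h₂
      exact lt_asymm h₁ h₂
    · exact h (hsymm.injective hx')
  have hV := ResidueAlgebra.HasCert.prod_sub (Finset.univ : Finset V) hstar fun O' _ => by
    rw [prod_residueProd ν O' (hdisj₁ O')]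
    exact hrank _
  have hE := ResidueAlgebra.HasCert.prod_sub O hpair fun O' hO' => by
    rw [prod_residueProd ν O' (hdisj₂ O' hO')]
    exact hrank _
  have hVu : Finset.univ.biUnion star = Finset.univ := by
    ext e
    simp [star]
  have hEu : O.biUnion pair = Finset.univ := by
    ext e
    simp only [Finset.mem_biUnion, Finset.mem_univ, iff_true]
    rcases lt_trichotomy (num e) (num (symm e)) with h | h | h
    · exact ⟨e, by simpa [O] using h, by simp [pair]⟩
    · exact absurd (num.injective h).symm (hne e)
    · exact ⟨symm e, by simpa [O, hsymm e] using h, by simp [pair, hsymm e]⟩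
  rw [prod_residueProd ν _ (hdisj₁ _), hVu] at hV
  rw [prod_residueProd ν _ (hdisj₂ _ subset_rfl), hEu, Finset.sum_const_zero] at hE
  -- Compare the coefficients at residue 0 of the two evaluations of the same full product: the
  -- total charge is nonzero, so only the pairing of edges contributes the constant 1.
  have h1 := (hV 0).neg.add (hE 0)
  rw [← Nat.add_mul, Finset.card_univ] at h1
  have hone : -(residueProd F ν Finset.univ -
      AddMonoidAlgebra.single (∑ v, charge v) 1).coeff 0 +
      (residueProd F ν Finset.univ - AddMonoidAlgebra.single 0 1).coeff 0 =
        -(1 : MvPolynomial σ F) := by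
    simp only [AddMonoidAlgebra.coeff_sub, AddMonoidAlgebra.coeff_single, Finsupp.sub_apply,
      Finsupp.single_eq_same, Finsupp.single_eq_of_ne hcharge.symm]
    ring
  rw [hone] at h1
  have h1 := h1.neg
  rw [neg_neg] at h1
  obtain ⟨Φs, h₃, h₄⟩ := (h1.mono le_rfl
    (Nat.mul_le_mul_right _ (Nat.add_le_add_left (Finset.card_le_univ O) _))).exists_isOFPCProof
      ord (Q := Q) fun a ha => ha
  refine ⟨Φs, h₃, h₄.trans_eq ?_⟩
  have hTc : T.card = Fintype.card D * p := by
    rw [Finset.card_map, Finset.card_univ, Fintype.card_prod, ZMod.card]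
  rw [hTc, tseitinBound]

end TseitinRefutation

/-! ### Simulation of PCR by OFPC -/

section Simulation

variable {F σ : Type*} [Field F]

theorem IsDerivationList.of_append_singleton {A : Set (MvPolynomial σ F)}
    {π : List (MvPolynomial σ F)} {q : MvPolynomial σ F} (h : IsDerivationList A (π ++ [q])) :
    IsDerivationList A π ∧ PCInferred A {p | p ∈ π} q := by
  constructor
  · intro i hi
    have := h i (by rw [List.length_append]; omega)
    rwa [List.getElem_append_left hi, List.take_append_of_le_length hi.le] at this
  · have := h π.length (by simp)
    rw [List.getElem_append_right le_rfl, List.take_left] at this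
    simpa using this

theorem pcInferred_linear_or_eq_zero {A P : Set (MvPolynomial σ F)} {p p' : MvPolynomial σ F}
    (hp : p ≠ 0 → p ∈ P) (hp' : p' ≠ 0 → p' ∈ P) (a b : F) (h : C a * p + C b * p' ≠ 0) :
    PCInferred A P (C a * p + C b * p') := by
  by_cases h₁ : p = 0
  · have h₂ : p' ≠ 0 := by
      rintro rfl
      simp [h₁] at h
    exact .inr (.inr ⟨p', hp' h₂, p', hp' h₂, 0, b, by simp [h₁]⟩)
  · by_cases h₂ : p' = 0
    · exact .inr (.inr ⟨p, hp h₁, p, hp h₁, a, 0, by simp [h₂]⟩)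
    · exact .inr (.inr ⟨p, hp h₁, p', hp' h₂, a, b, rfl⟩)

open Classical in
/-- The nonzero lines of a derivation. -/
def nonzeroLines {τ : Type*} (π : List (MvPolynomial τ F)) : List (MvPolynomial τ F) :=
  π.filter (· ≠ 0)

theorem mem_nonzeroLines {τ : Type*} {π : List (MvPolynomial τ F)} {q : MvPolynomial τ F} :
    q ∈ nonzeroLines π ↔ q ∈ π ∧ q ≠ 0 := by
  simp [nonzeroLines]

/-- Zero lines contribute nothing to the size, so the length of a proof is controlled only after
they are removed. -/
theorem length_nonzeroLines_le (π : List (MvPolynomial (σ ⊕ σ) F)) :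
    (nonzeroLines π).length ≤ pcrSize π := by
  classical
  rw [pcrSize]
  induction π with
  | nil => simp [nonzeroLines]
  | cons q π ih =>
    rw [nonzeroLines] at ih ⊢
    rw [List.map_cons, List.sum_cons]
    by_cases hq : q = 0
    · rw [List.filter_cons_of_neg (by simpa using hq)]
      omega
    · rw [List.filter_cons_of_pos (by simpa using hq), List.length_cons]
      have : 0 < q.support.card := Finset.card_pos.2 (by
        rwa [Finset.nonempty_iff_ne_empty, ne_eq, support_eq_empty])
      omega

theorem IsDerivationList.nonzeroLines {A : Set (MvPolynomial σ F)}
    {π : List (MvPolynomial σ F)} (h : IsDerivationList A π) :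
    IsDerivationList A (nonzeroLines π) := by
  induction π using List.reverseRecOn with
  | nil => exact h
  | append_singleton π q ih =>
    obtain ⟨h₁, h₂⟩ := h.of_append_singleton
    by_cases hq : q = 0
    · have hf : _root_.nonzeroLines (π ++ [q]) = _root_.nonzeroLines π := by
        simp [_root_.nonzeroLines, hq]
      rw [hf]
      exact ih h₁
    · have hf : _root_.nonzeroLines (π ++ [q]) = _root_.nonzeroLines π ++ [q] := by
        simp [_root_.nonzeroLines, hq]
      rw [hf]
      refine (ih h₁).append_singleton ?_
      have hmem : ∀ p ∈ π, p ≠ 0 → p ∈ _root_.nonzeroLines π := fun p hp h0 =>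
        mem_nonzeroLines.2 ⟨hp, h0⟩
      rcases h₂ with h₂ | ⟨x, p, hp, rfl⟩ | ⟨p, hp, p', hp', a, b, rfl⟩
      · exact .inl h₂
      · exact .inr (.inl ⟨x, p, hmem p hp (right_ne_zero_of_mul hq), rfl⟩)
      · exact pcInferred_linear_or_eq_zero (hmem p hp) (hmem p' hp') a b hq

/-- PCR derivations from `Q` whose product rules and axioms concern the variables in `T`. -/
inductive RestrictedDerivation (Q : Set (MvPolynomial (σ ⊕ σ) F)) (T : Finset σ) :
    List (MvPolynomial (σ ⊕ σ) F) → Prop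
  | nil : RestrictedDerivation Q T []
  | initial {π} {q} : RestrictedDerivation Q T π → q ∈ Q → RestrictedDerivation Q T (π ++ [q])
  | mulAxiom {π} {x} : RestrictedDerivation Q T π → x ∈ T →
      RestrictedDerivation Q T (π ++ [X (Sum.inl x) * X (Sum.inr x)])
  | addAxiom {π} {x} : RestrictedDerivation Q T π → x ∈ T →
      RestrictedDerivation Q T (π ++ [X (Sum.inl x) + X (Sum.inr x) - 1])
  | mulVar {π} {z} {p} : RestrictedDerivation Q T π → Sum.elim id id z ∈ T → p ∈ π →
      RestrictedDerivation Q T (π ++ [X z * p])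
  | linear {π} {p p'} (a b : F) : RestrictedDerivation Q T π → p ∈ π → p' ∈ π →
      RestrictedDerivation Q T (π ++ [C a * p + C b * p'])

theorem RestrictedDerivation.mono {Q : Set (MvPolynomial (σ ⊕ σ) F)} {T T' : Finset σ}
    {π : List (MvPolynomial (σ ⊕ σ) F)} (h : RestrictedDerivation Q T π) (hT : T ⊆ T') :
    RestrictedDerivation Q T' π := by
  induction h with
  | nil => exact .nil
  | initial _ hq ih => exact .initial ih hq
  | mulAxiom _ hx ih => exact .mulAxiom ih (hT hx)
  | addAxiom _ hx ih => exact .addAxiom ih (hT hx)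
  | mulVar _ hz hp ih => exact .mulVar ih (hT hz) hp
  | linear a b _ hp hp' ih => exact .linear a b ih hp hp'

/-- Each line brings in at most one variable through a product rule or an axiom. Clauses may contain
arbitrarily many others at the price of one monomial; those are not collected in `T`. -/
theorem exists_restrictedDerivation {Q : Set (MvPolynomial (σ ⊕ σ) F)}
    {π : List (MvPolynomial (σ ⊕ σ) F)} (h : IsDerivationList (Q ∪ pcrAxioms F σ) π) :
    ∃ T : Finset σ, T.card ≤ π.length ∧ RestrictedDerivation Q T π := by
  classical
  induction π using List.reverseRecOn with
  | nil => exact ⟨∅, by simp, .nil⟩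
  | append_singleton π q ih =>
    obtain ⟨h₁, h₂⟩ := h.of_append_singleton
    obtain ⟨T, hT, hd⟩ := ih h₁
    have hd' : ∀ x, RestrictedDerivation Q (insert x T) π := fun x =>
      hd.mono (Finset.subset_insert x T)
    have hc : ∀ x, (insert x T).card ≤ (π ++ [q]).length := fun x => by
      rw [List.length_append, List.length_singleton]
      exact (Finset.card_insert_le _ _).trans (by omega)
    have hx : ∀ x, x ∈ insert x T := fun x => Finset.mem_insert_self x T
    have hle : T.card ≤ (π ++ [q]).length := by
      rw [List.length_append]
      omega
    rcases h₂ with (h₂ | ⟨x, rfl⟩ | ⟨x, rfl⟩) | ⟨z, p, hp, rfl⟩ | ⟨p, hp, p', hp', a, b, rfl⟩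
    · exact ⟨T, hle, hd.initial h₂⟩
    · exact ⟨_, hc x, (hd' x).mulAxiom (hx x)⟩
    · exact ⟨_, hc x, (hd' x).addAxiom (hx x)⟩
    · exact ⟨_, hc (Sum.elim id id z), (hd' _).mulVar (hx _) hp⟩
    · exact ⟨T, hle, hd.linear a b hp hp'⟩

open Classical in
/-- The substitution of `1 - x` for `x̄`, and of `0` for the variables that are not in `T`. -/
def complementSubst (F : Type*) {σ : Type*} [Field F] (T : Finset σ) :
    MvPolynomial (σ ⊕ σ) F →ₐ[F] MvPolynomial σ F :=
  aeval (Sum.elim (fun x => if x ∈ T then X x else 0) (fun x => if x ∈ T then 1 - X x else 0))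

theorem isSplit_prod {T : Finset σ} {ι : Type*} (s : Finset ι) {d : ι → ℕ}
    {f : ι → MvPolynomial σ F} (h : ∀ i ∈ s, IsSplit T (d i) (f i)) :
    IsSplit T (∑ i ∈ s, d i) (∏ i ∈ s, f i) := by
  classical
  induction s using Finset.induction_on with
  | empty => exact isSplit_one _ _
  | insert a s ha ih =>
    rw [Finset.prod_insert ha, Finset.sum_insert ha]
    exact (h a (Finset.mem_insert_self _ _)).mul
      (ih fun i hi => h i (Finset.mem_insert_of_mem hi))

theorem IsSplit.pow {T : Finset σ} {f : MvPolynomial σ F} (h : IsSplit T 1 f) (k : ℕ) :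
    IsSplit T k (f ^ k) := by
  induction k with
  | zero => simpa using isSplit_one _ _
  | succ k ih => rw [pow_succ]; exact ih.mul h

theorem isSplit_X_sub_C {T : Finset σ} {x : σ} (hx : x ∈ T) (c : F) :
    IsSplit T 1 (X x - C c : MvPolynomial σ F) := by
  have := isSplit_aeval (F := F) hx (Polynomial.X - Polynomial.C c) (d := 1)
    (Polynomial.natDegree_X_sub_C_le c)
  simpa [algebraMap_eq] using this

theorem isSplit_complementSubst_X {T : Finset σ} {z : σ ⊕ σ} (hz : Sum.elim id id z ∈ T) :
    IsSplit T 1 (complementSubst F T (X z)) := by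
  rw [complementSubst, aeval_X]
  rcases z with x | x
  · simpa [show x ∈ T from hz] using isSplit_X (F := F) hz
  · have := (isSplit_X_sub_C (F := F) (show x ∈ T from hz) 1).mul (isSplit_C T 0 (-1))
    simpa [show x ∈ T from hz] using this

theorem complementSubst_X_of_notMem {T : Finset σ} {z : σ ⊕ σ} (hz : Sum.elim id id z ∉ T) :
    complementSubst F T (X z) = 0 := by
  rw [complementSubst, aeval_X]
  rcases z with x | x
  · simp [show x ∉ T from hz]
  · simp [show x ∉ T from hz]

/-- The monomials of `q` in the variables from `T` have degree at most `d`. -/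
def MonomialsBounded (T : Finset σ) (d : ℕ) (q : MvPolynomial (σ ⊕ σ) F) : Prop :=
  ∀ m ∈ q.support, (∀ z ∈ m.support, Sum.elim id id z ∈ T) → m.degree ≤ d

/-- A monomial within `T` becomes a product of powers of x and 1 - x, which is split; any other
monomial is sent to 0, so its degree is irrelevant. -/
theorem hasSplitRank_complementSubst {T : Finset σ} {d : ℕ} {q : MvPolynomial (σ ⊕ σ) F}
    (h : MonomialsBounded T d q) : HasSplitRank T d q.support.card (complementSubst F T q) := by
  have e : complementSubst F T q =
      ∑ m ∈ q.support, complementSubst F T (monomial m (coeff m q)) := by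
    conv_lhs => rw [q.as_sum, map_sum]
  rw [e]
  have := hasSplitRank_sum (T := T) (d := d) q.support (M := fun _ => 1)
    (f := fun m => complementSubst F T (monomial m (coeff m q))) fun m hm => IsSplit.hasSplitRank ?_
  · simpa using this
  have e₂ : complementSubst F T (monomial m (coeff m q)) =
      C (coeff m q) * ∏ z ∈ m.support, complementSubst F T (X z) ^ m z := by
    rw [monomial_eq, map_mul, Finsupp.prod, map_prod]
    simp only [map_pow]
    congr 1
    rw [complementSubst, ← algebraMap_eq, AlgHom.commutes, algebraMap_eq]
  rw [e₂]
  by_cases hz : ∀ z ∈ m.support, Sum.elim id id z ∈ T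
  · have := (isSplit_C T 0 (coeff m q)).mul (isSplit_prod m.support fun z hz' =>
      (isSplit_complementSubst_X (F := F) (hz z hz')).pow (m z))
    refine this.mono ?_
    rw [zero_add]
    exact h m hm hz
  · push Not at hz
    obtain ⟨z, hz, hzT⟩ := hz
    rw [Finset.prod_eq_zero hz, mul_zero]
    · simpa using isSplit_C (F := F) T d 0
    · rw [complementSubst_X_of_notMem hzT, zero_pow (Finsupp.mem_support_iff.1 hz)]

theorem MonomialsBounded.mono {T : Finset σ} {d d' : ℕ} {q : MvPolynomial (σ ⊕ σ) F}
    (h : MonomialsBounded T d q) (hd : d ≤ d') : MonomialsBounded T d' q :=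
  fun m hm hz => (h m hm hz).trans hd

theorem monomialsBounded_of_totalDegree {T : Finset σ} {d : ℕ} {q : MvPolynomial (σ ⊕ σ) F}
    (h : q.totalDegree ≤ d) : MonomialsBounded T d q :=
  fun _ hm _ => (le_totalDegree hm).trans h

theorem exists_of_mem_support_X_mul {τ : Type*} {z : τ} {p : MvPolynomial τ F} {m : τ →₀ ℕ}
    (hm : m ∈ (X z * p).support) : ∃ m' ∈ p.support, m = Finsupp.single z 1 + m' := by
  rw [support_X_mul, Finset.mem_map] at hm
  obtain ⟨m', hm', rfl⟩ := hm
  exact ⟨m', hm', rfl⟩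

theorem MonomialsBounded.X_mul {T : Finset σ} {d : ℕ} {p : MvPolynomial (σ ⊕ σ) F}
    (h : MonomialsBounded T d p) (z : σ ⊕ σ) : MonomialsBounded T (d + 1) (X z * p) := by
  intro m hm hT
  obtain ⟨m', hm', rfl⟩ := exists_of_mem_support_X_mul hm
  rw [map_add, Finsupp.degree_single, add_comm]
  refine Nat.succ_le_succ (h m' hm' fun y hy => hT y ?_)
  rw [Finsupp.mem_support_iff] at hy ⊢
  rw [Finsupp.add_apply]
  omega

theorem MonomialsBounded.linear {T : Finset σ} {d : ℕ} {p p' : MvPolynomial (σ ⊕ σ) F}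
    (h : MonomialsBounded T d p) (h' : MonomialsBounded T d p') (a b : F) :
    MonomialsBounded T d (C a * p + C b * p') := by
  classical
  intro m hm hT
  rw [mem_support_iff, coeff_add, coeff_C_mul, coeff_C_mul] at hm
  by_cases h₁ : coeff m p = 0
  · refine h' m ?_ hT
    rw [mem_support_iff]
    intro h₂
    simp [h₁, h₂] at hm
  · exact h m (mem_support_iff.2 h₁) hT

/-- A clause whose monomial survives has its literals among the `2 * T.card` literals over `T`. -/
theorem monomialsBounded_pcrPoly (T : Finset σ) (K : Clause σ) :
    MonomialsBounded T (2 * T.card) (Clause.pcrPoly F K) := by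
  classical
  intro m hm hT
  have hK : K ⊆ T ×ˢ Finset.univ := by
    intro l hl
    rw [Clause.pcrPoly, ← Finset.mul_prod_erase K _ hl] at hm
    obtain ⟨m', _, rfl⟩ := exists_of_mem_support_X_mul hm
    have := hT (if l.2 then Sum.inr l.1 else Sum.inl l.1) (by
      rw [Finsupp.mem_support_iff, Finsupp.add_apply, Finsupp.single_eq_same]
      omega)
    rw [Finset.mem_product]
    refine ⟨?_, Finset.mem_univ _⟩
    split_ifs at this <;> exact this
  refine (le_totalDegree hm).trans ((totalDegree_finsetProd _ _).trans ?_)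
  simp only [totalDegree_X, Finset.sum_const, smul_eq_mul, mul_one]
  refine (Finset.card_le_card hK).trans_eq ?_
  rw [Finset.card_product, mul_comm]
  rfl

theorem complementSubst_pcrPoly {T : Finset σ} {K : Clause σ}
    (h : complementSubst F T (Clause.pcrPoly F K) ≠ 0) :
    IsSplit T (2 * T.card) (Clause.poly F K) ∧ ∃ c : F,
      complementSubst F T (Clause.pcrPoly F K) = C c * Clause.poly F K := by
  classical
  rw [Clause.pcrPoly, map_prod, Finset.prod_ne_zero_iff] at h
  have hT : ∀ l ∈ K, l.1 ∈ T := by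
    intro l hl
    by_contra hlT
    refine h l hl (complementSubst_X_of_notMem ?_)
    split_ifs <;> exact hlT
  have hK : K ⊆ T ×ˢ Finset.univ := fun l hl =>
    Finset.mem_product.2 ⟨hT l hl, Finset.mem_univ _⟩
  constructor
  · refine (isSplit_prod K (d := fun _ => 1) fun l hl => isSplit_X_sub_C (hT l hl) _).mono ?_
    rw [Finset.sum_const, smul_eq_mul, mul_one]
    refine (Finset.card_le_card hK).trans_eq ?_
    rw [Finset.card_product, mul_comm]
    rfl
  · refine ⟨∏ l ∈ K, if l.2 then -1 else 1, ?_⟩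
    rw [Clause.pcrPoly, Clause.poly, map_prod, map_prod, ← Finset.prod_mul_distrib]
    refine Finset.prod_congr rfl fun l hl => ?_
    rw [complementSubst, aeval_X]
    cases hl2 : l.2
    · simp [hT l hl]
    · simp [hT l hl]

/-- Translate line by line, skipping lines that become 0. Two PC lines are used in two cases: a
clause agrees with its translation only up to sign, and a product by x̄ is rewritten as q - x q.
Sending both x and x̄ to 0 outside `T` would violate x + x̄ = 1, but those axioms are used only
inside `T`. -/
theorem RestrictedDerivation.exists_pc {K : Set (Clause σ)} {T : Finset σ}
    {π : List (MvPolynomial (σ ⊕ σ) F)} (h : RestrictedDerivation (cnfPCRPolys F K) T π) {s : ℕ}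
    (hs : ∀ q ∈ π, q.support.card ≤ s) (hs1 : 1 ≤ s) :
    (∀ q ∈ π, MonomialsBounded T (2 * T.card + π.length) q) ∧
    ∃ ρ : List (MvPolynomial σ F), IsDerivationList (cnfPolys F K ∪ pcAxioms F σ) ρ ∧
      (∀ q ∈ π, complementSubst F T q ≠ 0 → complementSubst F T q ∈ ρ) ∧
      ρ.length ≤ 2 * π.length ∧
      ∀ r ∈ ρ, HasSplitRank T (2 * T.card + π.length + 1) s r := by
  have step : ∀ {π : List (MvPolynomial (σ ⊕ σ) F)} {q : MvPolynomial (σ ⊕ σ) F},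
      ((∀ q ∈ π, q.support.card ≤ s) →
        (∀ q ∈ π, MonomialsBounded T (2 * T.card + π.length) q) ∧
        ∃ ρ : List (MvPolynomial σ F), IsDerivationList (cnfPolys F K ∪ pcAxioms F σ) ρ ∧
          (∀ q ∈ π, complementSubst F T q ≠ 0 → complementSubst F T q ∈ ρ) ∧
          ρ.length ≤ 2 * π.length ∧
          ∀ r ∈ ρ, HasSplitRank T (2 * T.card + π.length + 1) s r) →
      (∀ q' ∈ π ++ [q], q'.support.card ≤ s) →
      ((∀ q ∈ π, MonomialsBounded T (2 * T.card + π.length) q) →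
        MonomialsBounded T (2 * T.card + π.length + 1) q) →
      (∀ ρ : List (MvPolynomial σ F), IsDerivationList (cnfPolys F K ∪ pcAxioms F σ) ρ →
        (∀ q ∈ π, complementSubst F T q ≠ 0 → complementSubst F T q ∈ ρ) →
        (∀ q ∈ π, MonomialsBounded T (2 * T.card + π.length) q) →
        complementSubst F T q ≠ 0 →
        PCInferred (cnfPolys F K ∪ pcAxioms F σ) {p | p ∈ ρ} (complementSubst F T q) ∨
        ∃ r, PCInferred (cnfPolys F K ∪ pcAxioms F σ) {p | p ∈ ρ} r ∧
          HasSplitRank T (2 * T.card + π.length + 2) s r ∧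
          PCInferred (cnfPolys F K ∪ pcAxioms F σ) {p | p ∈ ρ ++ [r]} (complementSubst F T q)) →
      (∀ q' ∈ π ++ [q], MonomialsBounded T (2 * T.card + (π ++ [q]).length) q') ∧
      ∃ ρ : List (MvPolynomial σ F), IsDerivationList (cnfPolys F K ∪ pcAxioms F σ) ρ ∧
        (∀ q' ∈ π ++ [q], complementSubst F T q' ≠ 0 → complementSubst F T q' ∈ ρ) ∧
        ρ.length ≤ 2 * (π ++ [q]).length ∧
        ∀ r ∈ ρ, HasSplitRank T (2 * T.card + (π ++ [q]).length + 1) s r := by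
    intro π q ih hs hq hinf
    obtain ⟨hb, ρ, h₁, h₂, h₃, h₄⟩ := ih fun q hq => hs q (List.mem_append_left _ hq)
    have hq := hq hb
    rw [List.length_append, List.length_singleton]
    refine ⟨fun q' hq' => ?_, ?_⟩
    · rcases List.mem_append.1 hq' with hq' | hq'
      · exact (hb q' hq').mono (by omega)
      · rw [List.mem_singleton.1 hq']
        exact hq
    have hrank : HasSplitRank T (2 * T.card + (π.length + 1) + 1) s (complementSubst F T q) :=
      (hasSplitRank_complementSubst hq).mono (by omega) (hs q (by simp))
    have h₄' : ∀ r ∈ ρ, HasSplitRank T (2 * T.card + (π.length + 1) + 1) s r :=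
      fun r hr => (h₄ r hr).mono (by omega) le_rfl
    by_cases h0 : complementSubst F T q = 0
    · refine ⟨ρ, h₁, fun q' hq' h' => ?_, by omega, h₄'⟩
      rcases List.mem_append.1 hq' with hq' | hq'
      · exact h₂ q' hq' h'
      · rw [List.mem_singleton.1 hq'] at h'
        exact absurd h0 h'
    rcases hinf ρ h₁ h₂ hb h0 with hi | ⟨r, hr, hr', hi⟩
    · refine ⟨ρ ++ [complementSubst F T q], h₁.append_singleton hi, fun q' hq' h' => ?_,
        by rw [List.length_append, List.length_singleton]; omega, fun r hr => ?_⟩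
      · rcases List.mem_append.1 hq' with hq' | hq'
        · exact List.mem_append_left _ (h₂ q' hq' h')
        · rw [List.mem_singleton.1 hq']
          simp
      · rcases List.mem_append.1 hr with hr | hr
        · exact h₄' r hr
        · rw [List.mem_singleton.1 hr]
          exact hrank
    · refine ⟨ρ ++ [r] ++ [complementSubst F T q], (h₁.append_singleton hr).append_singleton hi,
        fun q' hq' h' => ?_, by simp only [List.length_append, List.length_singleton]; omega,
        fun r' hr' => ?_⟩
      · rcases List.mem_append.1 hq' with hq' | hq'
        · exact List.mem_append_left _ (List.mem_append_left _ (h₂ q' hq' h'))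
        · rw [List.mem_singleton.1 hq']
          simp
      · rcases List.mem_append.1 hr' with hr' | hr'
        · rcases List.mem_append.1 hr' with hr' | hr'
          · exact h₄' r' hr'
          · rw [List.mem_singleton.1 hr']
            assumption
        · rw [List.mem_singleton.1 hr']
          exact hrank
  induction h with
  | nil => exact ⟨by simp, [], isDerivationList_nil _, by simp, by simp, by simp⟩
  | initial _ hq ih =>
    obtain ⟨C', hC', rfl⟩ := hq
    refine step ih hs (fun _ => (monomialsBounded_pcrPoly T C').mono (by omega))
      fun ρ hρ _ _ h0 => .inr ?_
    obtain ⟨h₁, c, hc⟩ := complementSubst_pcrPoly h0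
    refine ⟨Clause.poly F C', .inl (.inl ⟨C', hC', rfl⟩),
      h₁.hasSplitRank.mono (by omega) hs1,
      .inr (.inr ⟨Clause.poly F C', by simp, Clause.poly F C', by simp, c, 0, ?_⟩)⟩
    dsimp only
    rw [hc, C_0, zero_mul, add_zero]
  | @mulAxiom π x _ hx ih =>
    refine step ih hs (fun _ => monomialsBounded_of_totalDegree ?_) fun ρ hρ _ _ h0 =>
      .inl (.inl (.inr ⟨x, ?_⟩))
    · refine (totalDegree_mul _ _).trans ?_
      have := Finset.card_pos.2 ⟨x, hx⟩
      rw [totalDegree_X, totalDegree_X]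
      omega
    · simp [complementSubst, hx]
  | @addAxiom π x _ hx ih =>
    refine step ih hs (fun _ => monomialsBounded_of_totalDegree ?_) fun ρ hρ _ _ h0 =>
      absurd ?_ h0
    · refine (totalDegree_sub _ _).trans (max_le ((totalDegree_add _ _).trans ?_) (by simp))
      rw [totalDegree_X, totalDegree_X]
      omega
    · simp [complementSubst, hx]
  | @mulVar π z p _ hz hp ih =>
    refine step ih hs (fun hb => (hb p hp).X_mul z) fun ρ hρ hm hb h0 => ?_
    rw [map_mul] at h0 ⊢
    have hpρ := hm p hp (right_ne_zero_of_mul h0)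
    rcases z with x | x
    · refine .inl (.inr (.inl ⟨x, _, hpρ, ?_⟩))
      simp [complementSubst, show x ∈ T from hz]
    · refine .inr ⟨X x * complementSubst F T p, .inr (.inl ⟨x, _, hpρ, rfl⟩), ?_,
        .inr (.inr ⟨complementSubst F T p, ?_, X x * complementSubst F T p, ?_, 1, -1, ?_⟩)⟩
      · rw [mul_comm (X x)]
        have h₁ := (hasSplitRank_complementSubst (hb p hp)).isSplit_mul
          (isSplit_X (F := F) (show x ∈ T from hz))
        refine h₁.mono ?_ (hs p (List.mem_append_left _ hp))
        omega
      · exact List.mem_append_left _ hpρ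
      · exact List.mem_append_right _ (by simp)
      · have : complementSubst F T (X (Sum.inr x)) = 1 - X x := by
          simp [complementSubst, show x ∈ T from hz]
        rw [this, C_1, C_neg, C_1]
        ring
  | @linear π p p' a b _ hp hp' ih =>
    refine step ih hs (fun hb => ((hb p hp).linear (hb p' hp') a b).mono (by omega))
      fun ρ hρ hm _ h0 => .inl ?_
    have hC : ∀ c : F, complementSubst F T (C c) = C c := fun c => by
      rw [complementSubst, ← algebraMap_eq, AlgHom.commutes, algebraMap_eq]
    rw [map_add, map_mul, map_mul, hC, hC] at h0 ⊢
    exact pcInferred_linear_or_eq_zero (hm p hp) (hm p' hp') a b h0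

theorem ofpcSystem_polySimulates_pcrSystem (ord : LinearOrder σ) :
    PolySimulates (ofpcSystem F ord) (pcrSystem F σ) := by
  obtain ⟨B, hB⟩ : ∃ B : Polynomial ℕ, ∀ n,
      B.eval n = (2 * n + 1) * (n * (n * (4 * (3 * n + 1) + 2) + 4) + 1) :=
    ⟨(2 * Polynomial.X + 1) * (Polynomial.X * (Polynomial.X * (4 * (3 * Polynomial.X + 1) + 2) + 4)
      + 1), fun n => by simp⟩
  refine ⟨B, fun K _ s hs => ?_⟩
  obtain ⟨π, ⟨hπ, hlast⟩, rfl⟩ := hs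
  have h1 : (1 : MvPolynomial (σ ⊕ σ) F) ∈ nonzeroLines π :=
    mem_nonzeroLines.2 ⟨List.mem_of_getLast? hlast, one_ne_zero⟩
  have hder : IsDerivationList (cnfPCRPolys F K ∪ pcrAxioms F σ) (nonzeroLines π) :=
    IsDerivationList.nonzeroLines hπ
  have hlen := length_nonzeroLines_le π
  have hsupp : ∀ q ∈ nonzeroLines π, q.support.card ≤ pcrSize π := fun q hq => by
    refine List.single_le_sum (fun _ _ => Nat.zero_le _) _ ?_
    exact List.mem_map_of_mem (mem_nonzeroLines.1 hq).1
  have hpos : 1 ≤ pcrSize π := (List.length_pos_of_mem h1).trans_le hlen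
  obtain ⟨T, hT, hd⟩ := exists_restrictedDerivation hder
  obtain ⟨-, ρ, h₁, h₂, h₃, h₄⟩ := hd.exists_pc hsupp hpos
  have hρ1 := h₂ 1 h1 (by simp)
  rw [map_one] at hρ1
  have hproof : IsPCProof (cnfPolys F K) (ρ ++ [1]) 1 :=
    ⟨h₁.append_singleton (.inr (.inr ⟨1, hρ1, 1, hρ1, 1, 0, by simp⟩)), List.getLast?_concat⟩
  obtain ⟨Φs, h₅, h₆⟩ := exists_isOFPCProof_of_hasSplitRank ord hproof
    (T := T) (d := 3 * pcrSize π + 1) (M := pcrSize π) fun q hq => by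
      have hq' : q ∈ ρ := by
        rcases List.mem_append.1 hq with hq | hq
        · exact hq
        · rw [List.mem_singleton.1 hq]
          exact hρ1
      exact (h₄ q hq').mono (by omega) le_rfl
  refine ⟨ofpcSize Φs, h₆.trans ?_, Φs, h₅, rfl⟩
  rw [hB]
  rw [List.length_append, List.length_singleton]
  have hT' := hT.trans hlen
  gcongr
  omega

end Simulation

/-! ### Fourier analysis of functions on residue vectors -/

section Characters

variable {E K : Type*} [Fintype E] [Field K] {p : ℕ}

/-- The pairing of a residue vector with an assignment. -/
def pairing (a g : E → ZMod p) : ZMod p := ∑ e, a e * g e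

/-- The support of a residue vector. -/
def residueSupport {V : Type*} [Fintype V] (a : V → ZMod p) : Finset V := by
  classical exact Finset.univ.filter fun e => a e ≠ 0

theorem mem_residueSupport {V : Type*} [Fintype V] {a : V → ZMod p} {e : V} :
    e ∈ residueSupport a ↔ a e ≠ 0 := by
  simp [residueSupport]

theorem card_residueSupport_add_le {V : Type*} [Fintype V] (a b : V → ZMod p) :
    (residueSupport (a + b)).card ≤ (residueSupport a).card + (residueSupport b).card := by
  classical
  refine (Finset.card_le_card fun e he => ?_).trans (Finset.card_union_le _ _)
  rw [Finset.mem_union]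
  simp only [mem_residueSupport, Pi.add_apply] at he ⊢
  by_contra! h
  exact he (by rw [h.1, h.2, add_zero])

theorem card_residueSupport_neg {V : Type*} [Fintype V] (a : V → ZMod p) :
    (residueSupport (-a)).card = (residueSupport a).card := by
  congr 1
  ext e
  simp [mem_residueSupport]

theorem card_residueSupport_sub_le {V : Type*} [Fintype V] (a b : V → ZMod p) :
    (residueSupport (a - b)).card ≤ (residueSupport a).card + (residueSupport b).card := by
  rw [sub_eq_add_neg, ← card_residueSupport_neg b]
  exact card_residueSupport_add_le a (-b)

theorem card_residueSupport_single_le {V : Type*} [Fintype V] [DecidableEq V] (v : V)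
    (i : ZMod p) : (residueSupport (Pi.single v i)).card ≤ 1 := by
  refine (Finset.card_le_card (t := {v}) fun e he => ?_).trans (Finset.card_singleton _).le
  rw [mem_residueSupport] at he
  rw [Finset.mem_singleton]
  by_contra h
  exact he (Pi.single_eq_of_ne h _)

theorem pairing_add_left (a b g : E → ZMod p) :
    pairing (a + b) g = pairing a g + pairing b g := by
  simp [pairing, add_mul, Finset.sum_add_distrib]

theorem pairing_add_right (a g g' : E → ZMod p) :
    pairing a (g + g') = pairing a g + pairing a g' := by
  simp [pairing, mul_add, Finset.sum_add_distrib]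

theorem pairing_sub_left (a b g : E → ZMod p) :
    pairing (a - b) g = pairing a g - pairing b g := by
  simp [pairing, sub_mul, Finset.sum_sub_distrib]

theorem pairing_single_right [DecidableEq E] (a : E → ZMod p) (e : E) (i : ZMod p) :
    pairing a (Pi.single e i) = a e * i := by
  simp [pairing, Pi.single_apply]

theorem pairing_single_left [DecidableEq E] (g : E → ZMod p) (e : E) (i : ZMod p) :
    pairing (Pi.single e i) g = i * g e := by
  simp [pairing, Pi.single_apply]

variable [NeZero p] (ψ : AddChar (ZMod p) K)

/-- The (unnormalized) Fourier coefficients of a function of `E → ZMod p`. -/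
def residueFourier (f : (E → ZMod p) → K) (a : E → ZMod p) : K := by
  classical exact ∑ g : E → ZMod p, f g * ψ (-pairing a g)

theorem residueFourier_add (f f' : (E → ZMod p) → K) (a : E → ZMod p) :
    residueFourier ψ (f + f') a = residueFourier ψ f a + residueFourier ψ f' a := by
  simp [residueFourier, add_mul, Finset.sum_add_distrib]

theorem residueFourier_smul (c : K) (f : (E → ZMod p) → K) (a : E → ZMod p) :
    residueFourier ψ (c • f) a = c * residueFourier ψ f a := by
  simp [residueFourier, mul_assoc, Finset.mul_sum]

theorem residueFourier_sum {ι : Type*} (s : Finset ι) (f : ι → (E → ZMod p) → K)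
    (a : E → ZMod p) : residueFourier ψ (∑ i ∈ s, f i) a = ∑ i ∈ s, residueFourier ψ (f i) a := by
  simp only [residueFourier, Finset.sum_apply, Finset.sum_mul]
  exact Finset.sum_comm

theorem residueFourier_char_mul (b : E → ZMod p) (f : (E → ZMod p) → K) (a : E → ZMod p) :
    residueFourier ψ (fun g => ψ (pairing b g) * f g) a = residueFourier ψ f (a - b) := by
  refine Finset.sum_congr rfl fun g _ => ?_
  rw [pairing_sub_left, neg_sub, sub_eq_add_neg, AddChar.map_add_eq_mul]
  ring

/-- Translating by a coordinate `e` outside `U` with `a e ≠ 0` fixes `f` but multiplies the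
coefficient by `ψ (-a e)`, which is not 1. -/
theorem residueFourier_eq_zero_of_dependsOn (hψ : ∀ s, ψ s = 1 → s = 0) {U : Finset E}
    {f : (E → ZMod p) → K} (hf : ∀ g g', (∀ e ∈ U, g e = g' e) → f g = f g') {a : E → ZMod p}
    (ha : ¬ residueSupport a ⊆ U) : residueFourier ψ f a = 0 := by
  classical
  obtain ⟨e, he, heU⟩ := Finset.not_subset.1 ha
  rw [mem_residueSupport] at he
  have h : residueFourier ψ f a = ψ (-a e) * residueFourier ψ f a := by
    conv_lhs => rw [residueFourier, ← Equiv.sum_comp (Equiv.addRight (Pi.single e (1 : ZMod p)))]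
    rw [residueFourier, Finset.mul_sum]
    refine Finset.sum_congr rfl fun g _ => ?_
    rw [Equiv.coe_addRight, pairing_add_right, pairing_single_right, mul_one, neg_add,
      AddChar.map_add_eq_mul, hf (g + Pi.single e 1) g]
    · ring
    · intro e' he'
      have : e' ≠ e := fun h => heU (h ▸ he')
      simp [Pi.single_eq_of_ne this]
  have h1 : ψ (-a e) ≠ 1 := fun h1 => he (neg_eq_zero.1 (hψ _ h1))
  have h2 : (1 - ψ (-a e)) * residueFourier ψ f a = 0 := by linear_combination h
  exact (mul_eq_zero.1 h2).resolve_left (sub_ne_zero.2 h1.symm)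

/-- Fourier inversion on `ZMod p`; this is why `p` must be invertible in `K`. -/
theorem exists_char_expansion (hψ : ∀ s, ψ s = 1 → s = 0) (hp : (p : K) ≠ 0) (h : ZMod p → K) :
    ∃ w : ZMod p → K, ∀ s, h s = ∑ i, w i * ψ (i * s) := by
  classical
  have hprim : ψ.IsPrimitive := AddChar.zmod_char_primitive_of_eq_one_only_at_zero p ψ hψ
  refine ⟨fun i => (p : K)⁻¹ * ∑ t, h t * ψ (-(i * t)), fun s => ?_⟩
  have e : ∑ i : ZMod p, (p : K)⁻¹ * (∑ t, h t * ψ (-(i * t))) * ψ (i * s) =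
      (p : K)⁻¹ * ∑ t, h t * ∑ i : ZMod p, ψ (i * (s - t)) := by
    simp only [Finset.mul_sum, Finset.sum_mul]
    rw [Finset.sum_comm]
    refine Finset.sum_congr rfl fun t _ => Finset.sum_congr rfl fun i _ => ?_
    rw [mul_sub, sub_eq_add_neg, AddChar.map_add_eq_mul]
    ring
  rw [e]
  simp only [AddChar.sum_mulShift _ hprim, sub_eq_zero, ZMod.card]
  simp [hp, mul_comm]

end Characters

/-! ### Class sums of Fourier coefficients -/

section Coboundaries

variable {V K : Type*} {p : ℕ}

/-- The differences of the values at the ends of the edges of the complete directed graph. -/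
def coboundary (u : V → ZMod p) : V × V → ZMod p := fun e => u e.1 - u e.2

theorem coboundary_add (u u' : V → ZMod p) :
    coboundary (u + u') = coboundary u + coboundary u' := by
  ext e
  simp only [coboundary, Pi.add_apply]
  ring

variable [Fintype V] [Field K]

theorem pairing_coboundary_single [DecidableEq V] (v : V) (g : V × V → ZMod p) :
    pairing (coboundary (Pi.single v 1)) g = ∑ w, g (v, w) - ∑ w, g (w, v) := by
  simp only [pairing, coboundary, sub_mul, Finset.sum_sub_distrib, Fintype.sum_prod_type,
    Pi.single_apply, ite_mul, one_mul, zero_mul]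
  congr 1
  · rw [Finset.sum_comm]
    simp
  · simp

/-- Isoperimetry of the complete directed graph: if the support has between one third and two thirds
of the vertices, all edges between it and its complement, in both directions, lie in the support of
the coboundary, and there are at least 4/9 of the square of the number of vertices. -/
theorem card_residueSupport_lt_of_coboundary {u : V → ZMod p}
    (h : 3 * (residueSupport u).card < 2 * Fintype.card V)
    (h' : 9 * (residueSupport (coboundary u)).card < 4 * Fintype.card V ^ 2) :
    3 * (residueSupport u).card < Fintype.card V := by
  classical
  by_contra! hn
  have hsub : residueSupport u ×ˢ (residueSupport u)ᶜ ∪ (residueSupport u)ᶜ ×ˢ residueSupport u ⊆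
      residueSupport (coboundary u) := by
    intro e he
    simp only [Finset.mem_union, Finset.mem_product, Finset.mem_compl, mem_residueSupport,
      not_not, coboundary] at he ⊢
    rcases he with ⟨h₁, h₂⟩ | ⟨h₁, h₂⟩
    · rwa [h₂, sub_zero]
    · rw [h₁, zero_sub]
      exact neg_ne_zero.2 h₂
  have hcard := Finset.card_le_card hsub
  rw [Finset.card_union_of_disjoint, Finset.card_product, Finset.card_product] at hcard
  · have hst : (residueSupport u).card + (residueSupport u)ᶜ.card = Fintype.card V :=
      Finset.card_add_card_compl _
    set s := (residueSupport u).card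
    set t := (residueSupport u)ᶜ.card
    rw [← hst] at h h' hn
    -- The bound 18 s t ≥ 4 (s + t)^2 is equivalent to (2 s - t)(2 t - s) ≥ 0.
    obtain ⟨x, hx⟩ : ∃ x, 2 * s = t + x := ⟨2 * s - t, by omega⟩
    obtain ⟨y, hy⟩ : ∃ y, 2 * t = s + y := ⟨2 * t - s, by omega⟩
    have : 0 ≤ (x : ℤ) * y := by positivity
    have hx' : (x : ℤ) = 2 * s - t := by push_cast [← Nat.cast_inj (R := ℤ)] at hx; linarith
    have hy' : (y : ℤ) = 2 * t - s := by push_cast [← Nat.cast_inj (R := ℤ)] at hy; linarith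
    rw [hx', hy'] at this
    zify at h' hcard
    nlinarith
  · rw [Finset.disjoint_left]
    intro e he he'
    exact (Finset.mem_compl.1 (Finset.mem_product.1 he').1) (Finset.mem_product.1 he).1

variable [NeZero p]

/-- The functions whose Fourier coefficients are supported in degree at most `d`. -/
def HasFourierDegree (ψ : AddChar (ZMod p) K) (d : ℕ) (f : (V × V → ZMod p) → K) : Prop :=
  ∀ a, d < (residueSupport a).card → residueFourier ψ f a = 0

theorem hasFourierDegree_of_dependsOn {ψ : AddChar (ZMod p) K} (hψ : ∀ s, ψ s = 1 → s = 0)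
    {U : Finset (V × V)} {f : (V × V → ZMod p) → K}
    (hf : ∀ g g', (∀ e ∈ U, g e = g' e) → f g = f g') {d : ℕ} (hU : U.card ≤ d) :
    HasFourierDegree ψ d f := by
  refine fun a ha => residueFourier_eq_zero_of_dependsOn ψ hψ hf fun h => ?_
  have := Finset.card_le_card h
  omega

variable (ψ : AddChar (ZMod p) K) (c : V → ZMod p)

open Classical in
/-- The sum of the Fourier coefficients of `f` over the characters that differ from the character
`a` by few of the constraints with right-hand sides `c`. -/
def classSum (f : (V × V → ZMod p) → K) (a : V × V → ZMod p) : K :=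
  ∑ u : V → ZMod p, if 3 * (residueSupport u).card < Fintype.card V then
    ψ (pairing u c) * residueFourier ψ f (a + coboundary u) else 0

theorem classSum_add (f f' : (V × V → ZMod p) → K) (a : V × V → ZMod p) :
    classSum ψ c (f + f') a = classSum ψ c f a + classSum ψ c f' a := by
  rw [classSum, classSum, classSum, ← Finset.sum_add_distrib]
  refine Finset.sum_congr rfl fun u _ => ?_
  rw [residueFourier_add]
  split_ifs <;> ring

theorem classSum_smul (r : K) (f : (V × V → ZMod p) → K) (a : V × V → ZMod p) :
    classSum ψ c (r • f) a = r * classSum ψ c f a := by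
  rw [classSum, classSum, Finset.mul_sum]
  refine Finset.sum_congr rfl fun u _ => ?_
  rw [residueFourier_smul]
  split_ifs <;> ring

theorem classSum_sum {ι : Type*} (s : Finset ι) (f : ι → (V × V → ZMod p) → K)
    (a : V × V → ZMod p) : classSum ψ c (∑ i ∈ s, f i) a = ∑ i ∈ s, classSum ψ c (f i) a := by
  classical
  induction s using Finset.induction_on with
  | empty =>
    rw [Finset.sum_empty, Finset.sum_empty, ← zero_smul K (0 : (V × V → ZMod p) → K),
      classSum_smul, zero_mul]
  | insert i s hi ih => rw [Finset.sum_insert hi, Finset.sum_insert hi, classSum_add, ih]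

theorem classSum_char_mul (b : V × V → ZMod p) (f : (V × V → ZMod p) → K)
    (a : V × V → ZMod p) :
    classSum ψ c (fun g => ψ (pairing b g) * f g) a = classSum ψ c f (a - b) := by
  rw [classSum, classSum]
  refine Finset.sum_congr rfl fun u _ => ?_
  rw [residueFourier_char_mul, add_sub_right_comm]

/-- Reindex by adding `u₁`. Only terms with a nonzero coefficient, hence of low degree, matter; for
these the relevant coboundaries are differences of two low-degree vectors, so by isoperimetry `u` is
small exactly when `u₁ + u` is. -/
theorem classSum_shift {f : (V × V → ZMod p) → K} {d d' : ℕ} (hf : HasFourierDegree ψ d f)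
    (hd : 9 * (d + d') < 4 * Fintype.card V ^ 2) {a : V × V → ZMod p}
    (ha : (residueSupport a).card ≤ d') {u₁ : V → ZMod p}
    (hu₁ : 3 * (residueSupport u₁).card < Fintype.card V)
    (ha' : (residueSupport (a + coboundary u₁)).card ≤ d') :
    classSum ψ c f a = ψ (pairing u₁ c) * classSum ψ c f (a + coboundary u₁) := by
  classical
  rw [classSum, classSum, Finset.mul_sum, ← Equiv.sum_comp (Equiv.addLeft u₁)]
  refine Finset.sum_congr rfl fun u _ => ?_
  rw [Equiv.coe_addLeft, pairing_add_left, coboundary_add, ← add_assoc, AddChar.map_add_eq_mul]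
  by_cases h0 : residueFourier ψ f (a + coboundary u₁ + coboundary u) = 0
  · simp [h0]
  have hdeg : (residueSupport (a + coboundary u₁ + coboundary u)).card ≤ d :=
    not_lt.1 fun h => h0 (hf _ h)
  have hiff : 3 * (residueSupport (u₁ + u)).card < Fintype.card V ↔
      3 * (residueSupport u).card < Fintype.card V := by
    constructor
    · intro h
      have h₁ := card_residueSupport_sub_le (u₁ + u) u₁
      have h₂ := card_residueSupport_sub_le (a + coboundary u₁ + coboundary u)
        (a + coboundary u₁)
      rw [add_sub_cancel_left] at h₁ h₂
      exact card_residueSupport_lt_of_coboundary (by omega) (by omega)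
    · intro h
      have h₁ := card_residueSupport_add_le u₁ u
      have h₂ := card_residueSupport_sub_le (a + coboundary u₁ + coboundary u) a
      rw [add_assoc, add_sub_cancel_left, ← coboundary_add] at h₂
      rw [add_assoc, ← coboundary_add] at hdeg
      exact card_residueSupport_lt_of_coboundary (by omega) (by omega)
  simp only [hiff]
  split_ifs <;> ring

/-- The class sums of the characters of degree at most `d` vanish. -/
def ClassSumsVanish (d : ℕ) (f : (V × V → ZMod p) → K) : Prop :=
  ∀ a, (residueSupport a).card ≤ d → classSum ψ c f a = 0

theorem ClassSumsVanish.mul_coordinate {f : (V × V → ZMod p) → K} {d : ℕ}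
    (hψ : ∀ s, ψ s = 1 → s = 0) (hp : (p : K) ≠ 0) (hf : HasFourierDegree ψ d f)
    (h : ClassSumsVanish ψ c d f) (hd : 9 * (d + (d + 1)) < 4 * Fintype.card V ^ 2)
    (e : V × V) (w : ZMod p → K) : ClassSumsVanish ψ c d (fun g => w (g e) * f g) := by
  classical
  intro a ha
  obtain ⟨w', hw'⟩ := exists_char_expansion ψ hψ hp w
  have e₁ : (fun g : V × V → ZMod p => w (g e) * f g) =
      ∑ i : ZMod p, w' i • fun g => ψ (pairing (Pi.single e i) g) * f g := by
    ext g
    rw [hw', Finset.sum_mul, Finset.sum_apply]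
    refine Finset.sum_congr rfl fun i _ => ?_
    rw [Pi.smul_apply, smul_eq_mul, pairing_single_left, mul_assoc]
  rw [e₁, classSum_sum]
  refine Finset.sum_eq_zero fun i _ => ?_
  rw [classSum_smul, classSum_char_mul]
  have hb := card_residueSupport_sub_le a (Pi.single e i)
  have hb' := card_residueSupport_single_le e i
  set b := a - Pi.single e i
  have hS : classSum ψ c f b = 0 := by
    -- The vector `b` may have weight `d + 1`, just outside the hypothesis. Either its class has a
    -- member of weight at most `d`, to which the sum can be shifted, or every coefficient in the
    -- class vanishes for degree reasons.
    by_cases hex : ∃ u₁ : V → ZMod p, 3 * (residueSupport u₁).card < Fintype.card V ∧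
        (residueSupport (b + coboundary u₁)).card ≤ d
    · obtain ⟨u₁, h₁, h₂⟩ := hex
      rw [classSum_shift ψ c hf hd (by omega) h₁ (by omega), h _ h₂, mul_zero]
    · push Not at hex
      refine Finset.sum_eq_zero fun u _ => ?_
      split_ifs with hu
      · rw [hf _ (hex u hu), mul_zero]
      · rfl
  rw [hS, mul_zero]

/-- Since `f` vanishes where the constraint at `v` holds, it is a multiple of the constraint
character minus 1, with a cofactor depending on the edges at `v` only. Shifting the class by the
unit vector at `v` makes the two terms cancel. -/
theorem classSumsVanish_of_constraint {f : (V × V → ZMod p) → K} {d : ℕ}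
    (hψ : ∀ s, ψ s = 1 → s = 0) (v : V)
    (hdep : ∀ g g', (∀ w, g (v, w) = g' (v, w) ∧ g (w, v) = g' (w, v)) → f g = f g')
    (hf : ∀ g, f g ≠ 0 → ∑ w, g (v, w) - ∑ w, g (w, v) ≠ c v) (hV : 3 < Fintype.card V)
    (hd : 9 * (2 * Fintype.card V + (d + 2 * Fintype.card V)) < 4 * Fintype.card V ^ 2) :
    ClassSumsVanish ψ c d f := by
  classical
  intro a ha
  let r : (V × V → ZMod p) → ZMod p := fun g => ∑ w, g (v, w) - ∑ w, g (w, v)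
  -- The denominator is 0 exactly where the constraint holds; there `f` is 0, so the quotient is
  -- harmlessly 0.
  let f' : (V × V → ZMod p) → K := fun g => f g / (ψ (r g - c v) - 1)
  have hcob := pairing_coboundary_single (p := p) v
  set b : V × V → ZMod p := coboundary (Pi.single v 1) with hbdef
  have hfe : f = (ψ (-c v) • fun g => ψ (pairing b g) * f' g) + (-1 : K) • f' := by
    ext g
    by_cases h0 : f g = 0
    · simp [f', h0]
    have h1 : ψ (r g - c v) - 1 ≠ 0 :=
      sub_ne_zero.2 fun h => hf g h0 (sub_eq_zero.1 (hψ _ h))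
    simp only [Pi.add_apply, Pi.smul_apply, smul_eq_mul, f', hcob]
    change f g = ψ (-c v) * (ψ (r g) * _) + _
    have e : ψ (r g - c v) = ψ (r g) * ψ (-c v) := by
      rw [sub_eq_add_neg, AddChar.map_add_eq_mul]
    rw [e] at h1 ⊢
    set D := ψ (r g) * ψ (-c v) - 1 with hD
    have e₂ : f g / D * D = f g := div_mul_cancel₀ _ h1
    linear_combination (-1 : K) * e₂ + f g / D * hD
  let U : Finset (V × V) := ({v} : Finset V) ×ˢ Finset.univ ∪ Finset.univ ×ˢ ({v} : Finset V)
  have hU : U.card ≤ 2 * Fintype.card V := by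
    refine (Finset.card_union_le _ _).trans ?_
    rw [Finset.card_product, Finset.card_product, Finset.card_singleton, Finset.card_univ]
    omega
  have hdep' : ∀ g g' : V × V → ZMod p, (∀ e ∈ U, g e = g' e) → f' g = f' g' := by
    intro g g' h
    have h₁ : ∀ w, g (v, w) = g' (v, w) := fun w => h _ (by simp [U])
    have h₂ : ∀ w, g (w, v) = g' (w, v) := fun w => h _ (by simp [U])
    simp only [f', r, hdep g g' fun w => ⟨h₁ w, h₂ w⟩, h₁, h₂]
  have hb : residueSupport b ⊆ U := by
    intro e he
    rw [mem_residueSupport, hbdef] at he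
    by_contra heU
    simp only [U, Finset.mem_union, Finset.mem_product, Finset.mem_singleton, Finset.mem_univ,
      and_true, true_and, not_or] at heU
    exact he (by simp [coboundary, heU.1, heU.2])
  have hbc := (Finset.card_le_card hb).trans hU
  have hab := card_residueSupport_sub_le a b
  have hshift := classSum_shift ψ c (f := f') (hasFourierDegree_of_dependsOn hψ hdep' hU) hd
    (a := a - b) (u₁ := Pi.single v 1) (by omega)
    (lt_of_le_of_lt (Nat.mul_le_mul_left 3 (card_residueSupport_single_le v (1 : ZMod p))) hV)
    (by rw [sub_add_cancel]; omega)
  rw [← hbdef, sub_add_cancel, pairing_single_left, one_mul] at hshift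
  rw [hfe, classSum_add, classSum_smul, classSum_smul, classSum_char_mul, hshift, ← mul_assoc,
    ← AddChar.map_add_eq_mul, neg_add_cancel, AddChar.map_zero_eq_one]
  ring

/-- The only nonzero coefficient of 1 is the trivial one, a power of `p`. A vector with zero
coboundary is constant, so if its support is small it is 0; the class of the trivial character
contributes a single term. -/
theorem not_classSumsVanish_one (hψ : ∀ s, ψ s = 1 → s = 0) (hp : (p : K) ≠ 0)
    (hV : 0 < Fintype.card V) (d : ℕ) : ¬ ClassSumsVanish ψ c d (1 : (V × V → ZMod p) → K) := by
  classical
  intro h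
  have h0 := h 0 (by simp [residueSupport])
  rw [classSum, Finset.sum_eq_single 0] at h0
  · have h1 : pairing (0 : V → ZMod p) c = 0 := by simp [pairing]
    have h2 : coboundary (0 : V → ZMod p) = 0 := by ext; simp [coboundary]
    have h3 : residueSupport (0 : V → ZMod p) = ∅ := by simp [residueSupport]
    rw [h1, h2, h3, Finset.card_empty, mul_zero, if_pos hV, AddChar.map_zero_eq_one, one_mul,
      add_zero, residueFourier] at h0
    simp [pairing, ZMod.card, hp] at h0
  · intro u _ hu
    split_ifs with hs
    · rw [residueFourier_eq_zero_of_dependsOn ψ hψ (U := ∅) (fun _ _ _ => rfl), mul_zero]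
      intro hsub
      obtain ⟨v, hv⟩ : ∃ v, u v = 0 := by
        by_contra! hne
        have : residueSupport u = Finset.univ := by
          ext v
          simp [mem_residueSupport, hne v]
        rw [this, Finset.card_univ] at hs
        omega
      refine hu (funext fun v' => ?_)
      by_contra hv'
      have : ((v', v) : V × V) ∈ residueSupport (0 + coboundary u) := by
        rw [mem_residueSupport, zero_add, coboundary, hv, sub_zero]
        exact hv'
      exact absurd (hsub this) (Finset.notMem_empty _)
    · rfl
  · simp

end Coboundaries

/-! ### Tseitin formulas of multigraphs -/

section DartFormula

variable {V D σ : Type*} [Fintype D] [DecidableEq V] [DecidableEq σ] {p : ℕ} [NeZero p]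

/-- The Tseitin formula of a multigraph with directed edges `D` that uses the variables in the range
of `ν`. -/
def dartCNF (ν : D × ZMod p ↪ σ) (fst : D → V) (symm : D → D) (charge : V → ZMod p) :
    Set (Clause σ) :=
  {C | ∃ e : D, C = Finset.univ.map ⟨fun i : ZMod p => (ν (e, i), true),
    fun i j h => by simpa using h⟩} ∪
  {C | ∃ (e : D) (i j : ZMod p), i ≠ j ∧ C = {(ν (e, i), false), (ν (e, j), false)}} ∪
  {C | ∃ (e : D) (i : ZMod p), C = {(ν (e, i), false), (ν (symm e, -i), true)}} ∪
  {C | ∃ (v : V) (j : D → ZMod p),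
    ∑ e ∈ Finset.univ.filter (fun e => fst e = v), j e ≠ charge v ∧
    C = (Finset.univ.filter (fun e => fst e = v)).image fun e => (ν (e, j e), false)}

variable (ν : D × ZMod p ↪ σ) (fst : D → V) (symm : D → D) (charge : V → ZMod p)

theorem dartCNF_finite [Finite V] : (dartCNF ν fst symm charge).Finite := by
  classical
  refine (((Set.Finite.union ?_ ?_).union ?_).union ?_)
  · refine (Set.finite_range fun e : D => Finset.univ.map ⟨fun i : ZMod p => (ν (e, i), true),
      fun i j h => by simpa using h⟩).subset ?_
    rintro C ⟨e, rfl⟩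
    exact ⟨e, rfl⟩
  · refine (Set.finite_range fun t : D × ZMod p × ZMod p =>
      ({(ν (t.1, t.2.1), false), (ν (t.1, t.2.2), false)} : Clause σ)).subset ?_
    rintro C ⟨e, i, j, -, rfl⟩
    exact ⟨(e, i, j), rfl⟩
  · refine (Set.finite_range fun t : D × ZMod p =>
      ({(ν (t.1, t.2), false), (ν (symm t.1, -t.2), true)} : Clause σ)).subset ?_
    rintro C ⟨e, i, rfl⟩
    exact ⟨(e, i), rfl⟩
  · refine (Set.finite_range fun t : V × (D → ZMod p) =>
      ((Finset.univ.filter (fun e => fst e = t.1)).image fun e => (ν (e, t.2 e), false) :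
        Clause σ)).subset ?_
    rintro C ⟨v, j, -, rfl⟩
    exact ⟨(v, j), rfl⟩

theorem exists_isOFPCProof_dartCNF {F : Type*} [Field F] [Fintype V] (ord : LinearOrder σ)
    (hsymm : Function.Involutive symm) (hne : ∀ e, symm e ≠ e) (hcharge : ∑ v, charge v ≠ 0)
    {Δ : ℕ} (hΔ : ∀ v, (Finset.univ.filter fun e => fst e = v).card ≤ Δ) (h2 : 2 ≤ Δ)
    (hF : ((p * (Fintype.card D * p) + 1 : ℕ) : ℕ∞) ≤ ENat.card F) :
    ∃ Φs : List (NCFormula F σ), IsOFPCProof ord (cnfPolys F (dartCNF ν fst symm charge)) Φs 1 ∧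
      ofpcSize Φs ≤ tseitinBound p Δ (Fintype.card V) (Fintype.card D) := by
  classical
  refine exists_isOFPCProof_tseitin ν ord fst symm hsymm hne charge hcharge hΔ h2 hF ?_ ?_ ?_ ?_
  · intro e
    refine ⟨_, .inl (.inl (.inl ⟨e, rfl⟩)), ?_⟩
    simp only [Clause.poly, Finset.prod_map]
    refine Finset.prod_congr rfl fun i _ => ?_
    change X (ν (e, i)) - C (if true = true then 1 else 0) = _
    simp
  · intro e i j hij
    refine ⟨_, .inl (.inl (.inr ⟨e, i, j, hij, rfl⟩)), ?_⟩
    simp only [Clause.poly]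
    rw [Finset.prod_pair]
    · simp
    · simpa using hij
  · intro e i
    refine ⟨_, .inl (.inr ⟨e, i, rfl⟩), ?_⟩
    simp only [Clause.poly]
    rw [Finset.prod_pair]
    · simp
    · simp
  · intro v j hj
    refine ⟨_, .inr ⟨v, j, hj, rfl⟩, ?_⟩
    simp only [Clause.poly]
    rw [Finset.prod_image]
    · simp
    · intro e _ e' _ h
      simp only [Prod.mk.injEq, and_true, EmbeddingLike.apply_eq_iff_eq] at h
      exact h.1

theorem dartCNF_subset_tseitinCNF {V : Type*} [Fintype V] [DecidableEq V] (G : SimpleGraph V)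
    [DecidableRel G.Adj] (charge : V → ZMod p) :
    dartCNF (.refl _) (fun e : G.Dart => e.fst) SimpleGraph.Dart.symm charge ⊆
      tseitinCNF G p charge := by
  rintro C (((⟨e, h⟩ | ⟨e, i, j, hij, h⟩) | ⟨e, i, h⟩) | ⟨v, j, hj, h⟩)
  · exact .inl (.inl (.inl ⟨e, h⟩))
  · exact .inl (.inl (.inr ⟨e, i, j, hij, h⟩))
  · exact .inl (.inr ⟨e, i, .inl h⟩)
  · exact .inr ⟨v, j, hj, h⟩

end DartFormula

theorem IsOFPCProof.mono {F σ : Type*} [Field F] {ord : LinearOrder σ}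
    {Q Q' : Set (MvPolynomial σ F)} {Φs : List (NCFormula F σ)} {g : MvPolynomial σ F}
    (h : IsOFPCProof ord Q Φs g) (hQ : Q ⊆ Q') : IsOFPCProof ord Q' Φs g := by
  obtain ⟨π, ⟨h₁, h₂⟩, h₃⟩ := h
  refine ⟨π, ⟨fun i hi => ?_, h₂⟩, h₃⟩
  rcases h₁ i hi with h | h
  exacts [.inl (Set.union_subset_union_left _ hQ h), .inr h]

/-! ### A counting argument for restrictions -/

section Avoiding

/-- Union bound: after shrinking `T i` to `k` elements, the maps that avoid `κ i` on it are a
fraction of (1 - 1/|A|)^k of all maps. -/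
theorem exists_forall_exists_eq {E A ι : Type*} [Fintype E] [Fintype A]
    [Nonempty A] (S : Finset ι)
    (T : ι → Finset E) (κ : ι → E → A) {k : ℕ} (hT : ∀ i ∈ S, k ≤ (T i).card)
    (h : S.card * (Fintype.card A - 1) ^ k < Fintype.card A ^ k) :
    ∃ ρ : E → A, ∀ i ∈ S, ∃ e ∈ T i, ρ e = κ i e := by
  classical
  by_contra! hρ
  have hT' : ∀ i, ∃ T' : Finset E, i ∈ S → T' ⊆ T i ∧ T'.card = k := by
    intro i
    by_cases hi : i ∈ S
    · obtain ⟨T', h⟩ := Finset.exists_subset_card_eq (hT i hi)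
      exact ⟨T', fun _ => h⟩
    · exact ⟨∅, fun h => absurd h hi⟩
  choose T' hT' using hT'
  let W : ι → Finset (E → A) := fun i =>
    Fintype.piFinset fun e => if e ∈ T' i then Finset.univ.erase (κ i e) else Finset.univ
  have hcover : (Finset.univ : Finset (E → A)) ⊆ S.biUnion W := by
    intro ρ _
    obtain ⟨i, hi, hρi⟩ := hρ ρ
    refine Finset.mem_biUnion.2 ⟨i, hi, Fintype.mem_piFinset.2 fun e => ?_⟩
    split_ifs with he
    · exact Finset.mem_erase.2 ⟨hρi e ((hT' i hi).1 he), Finset.mem_univ _⟩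
    · exact Finset.mem_univ _
  by_cases hS : S.Nonempty
  swap
  · obtain ⟨i, hi, -⟩ := hρ fun _ => Classical.arbitrary A
    exact hS ⟨i, hi⟩
  have hk : k ≤ Fintype.card E := by
    obtain ⟨i, hi⟩ := hS
    exact (hT i hi).trans (Finset.card_le_univ _)
  have hW : ∀ i ∈ S, (W i).card =
      (Fintype.card A - 1) ^ k * Fintype.card A ^ (Fintype.card E - k) := by
    intro i hi
    rw [Fintype.card_piFinset, ← Finset.prod_mul_prod_compl (T' i)]
    congr 1
    · rw [Finset.prod_congr rfl (g := fun _ => Fintype.card A - 1), Finset.prod_const,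
        (hT' i hi).2]
      intro e he
      rw [if_pos he, Finset.card_erase_of_mem (Finset.mem_univ _), Finset.card_univ]
    · rw [Finset.prod_congr rfl (g := fun _ => Fintype.card A), Finset.prod_const,
        Finset.card_compl, (hT' i hi).2]
      intro e he
      rw [if_neg (Finset.mem_compl.1 he), Finset.card_univ]
  have h₁ := (Finset.card_le_card hcover).trans Finset.card_biUnion_le
  rw [Finset.sum_congr rfl hW, Finset.sum_const, smul_eq_mul, Finset.card_univ,
    Fintype.card_fun, ← mul_assoc] at h₁
  have hA : 0 < Fintype.card A ^ (Fintype.card E - k) := pow_pos Fintype.card_pos _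
  have h₂ := Nat.mul_lt_mul_of_pos_right h hA
  rw [← pow_add, Nat.add_sub_cancel' hk] at h₂
  omega

end Avoiding

/-! ### Degree lower bound for derivations -/

section DegreeBound

variable {V F K τ : Type*} [Fintype V] [Field F] [Field K] [Algebra F K] {p : ℕ} [NeZero p]
  {ψ : AddChar (ZMod p) K} {c : V → ZMod p} {d : ℕ} {val : (V × V → ZMod p) → τ → K}

theorem hasFourierDegree_zero (ψ : AddChar (ZMod p) K) (d : ℕ) :
    HasFourierDegree ψ d (0 : (V × V → ZMod p) → K) := by
  intro a _
  simp [residueFourier]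

theorem classSumsVanish_zero (ψ : AddChar (ZMod p) K) (c : V → ZMod p) (d : ℕ) :
    ClassSumsVanish ψ c d (0 : (V × V → ZMod p) → K) := by
  intro a _
  rw [← zero_smul K (0 : (V × V → ZMod p) → K), classSum_smul, zero_mul]

/-- If every monomial vanishes or depends on at most `d` coordinates, then the degree is at most
`d`. -/
theorem hasFourierDegree_aeval (hψ : ∀ s, ψ s = 1 → s = 0) (T : (τ →₀ ℕ) → Finset (V × V))
    (q : MvPolynomial τ F)
    (hT : ∀ m ∈ q.support, ∀ g g', (∀ e ∈ T m, g e = g' e) → ∀ z ∈ m.support, val g z = val g' z)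
    (hq : ∀ m ∈ q.support, (T m).card ≤ d ∨ ∃ z ∈ m.support, ∀ g, val g z = 0) :
    HasFourierDegree ψ d fun g => aeval (val g) q := by
  have e : (fun g => aeval (val g) q) = ∑ m ∈ q.support,
      fun g => algebraMap F K (coeff m q) * m.prod fun z k => val g z ^ k := by
    ext g
    conv_lhs => rw [q.as_sum]
    simp only [map_sum, aeval_monomial, Finset.sum_apply]
  intro a ha
  rw [e, residueFourier_sum]
  refine Finset.sum_eq_zero fun m hm => ?_
  rcases hq m hm with h | ⟨z, hz, h⟩
  · refine hasFourierDegree_of_dependsOn hψ (fun g g' hg => ?_) h a ha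
    congr 1
    exact Finsupp.prod_congr fun z hz => by rw [hT m hm g g' hg z hz]
  · refine (congrArg (fun f => residueFourier ψ f a) ?_).trans (hasFourierDegree_zero ψ d a ha)
    ext g
    rw [Finsupp.prod, Finset.prod_eq_zero hz, mul_zero, Pi.zero_apply]
    rw [h, zero_pow (Finsupp.mem_support_iff.1 hz)]

/-- Vanishing of the class sums is an invariant of all lines. A product rule multiplies by a
function of one coordinate, and the degree bound on the premise keeps the invariant at the same
level `d`. -/
theorem not_isPCDerivation_one_of_hasFourierDegree (hψ : ∀ s, ψ s = 1 → s = 0)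
    (hp : (p : K) ≠ 0) (hV : 0 < Fintype.card V)
    (hd : 9 * (d + (d + 1)) < 4 * Fintype.card V ^ 2)
    (hval : ∀ z, ∃ (e : V × V) (h : ZMod p → K), ∀ g, val g z = h (g e))
    {A : Set (MvPolynomial τ F)}
    (hA : ∀ q ∈ A, ClassSumsVanish ψ c d fun g => aeval (val g) q) {π : List (MvPolynomial τ F)}
    (hπ : ∀ q ∈ π, HasFourierDegree ψ d fun g => aeval (val g) q) : ¬ IsPCDerivation A π 1 := by
  rintro ⟨hinf, hlast⟩
  have key : ∀ (i : ℕ) (hi : i < π.length), ClassSumsVanish ψ c d fun g => aeval (val g) π[i] := by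
    intro i
    induction i using Nat.strong_induction_on with
    | _ i ih =>
      intro hi
      have hprev : ∀ q ∈ π.take i, ClassSumsVanish ψ c d fun g => aeval (val g) q := by
        intro q hq
        obtain ⟨j, hj, rfl⟩ := List.getElem_of_mem hq
        rw [List.getElem_take]
        rw [List.length_take] at hj
        exact ih j (by omega) (by omega)
      rcases hinf i hi with h | ⟨z, q, hq, h⟩ | ⟨q₁, hq₁, q₂, hq₂, a, b, h⟩
      · exact hA _ h
      · obtain ⟨e, w, hw⟩ := hval z
        rw [h]
        simp only [map_mul, aeval_X, hw]
        exact (hprev q hq).mul_coordinate ψ c hψ hp (hπ q (List.mem_of_mem_take hq)) hd e w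
      · intro r hr
        have e : (fun g => aeval (val g) (C a * q₁ + C b * q₂)) =
            algebraMap F K a • (fun g => aeval (val g) q₁) +
              algebraMap F K b • fun g => aeval (val g) q₂ := by
          ext g
          simp [Algebra.smul_def]
        rw [h, e, classSum_add, classSum_smul, classSum_smul, hprev q₁ hq₁ r hr,
          hprev q₂ hq₂ r hr, mul_zero, mul_zero, add_zero]
  obtain ⟨ne, hl⟩ := List.getLast?_eq_some_iff.1 hlast
  have h1 := key ne.length (by rw [hl]; simp)
  simp only [hl, List.getElem_concat_length, map_one] at h1
  exact not_classSumsVanish_one ψ c hψ hp hV d h1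

end DegreeBound

/-! ### Restrictions of the doubled complete graph -/

section Restriction

variable {V σ : Type*} {p : ℕ}

/-- The directed edges of the complete directed graph with loops, with two copies of each edge, and
with both orientations of each copy. -/
abbrev DoubledDart (V : Type*) := ((V × V) × Bool) × Bool

/-- The source of a directed edge. -/
def DoubledDart.fst (δ : DoubledDart V) : V := if δ.2 then δ.1.1.1 else δ.1.1.2

/-- The opposite directed edge. -/
def DoubledDart.symm (δ : DoubledDart V) : DoubledDart V := (δ.1, !δ.2)

theorem DoubledDart.symm_involutive : Function.Involutive (DoubledDart.symm (V := V)) := by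
  intro δ
  simp [DoubledDart.symm]

theorem DoubledDart.symm_ne (δ : DoubledDart V) : δ.symm ≠ δ := by
  rcases δ with ⟨e, b⟩
  simp [DoubledDart.symm]

/-- The value of a directed edge under the restriction `ρ`, which fixes one copy of each edge, when
the two copies of each edge `e` have the total value `g e`. -/
def DoubledDart.value (ρ : V × V → Bool × ZMod p) (g : V × V → ZMod p) (δ : DoubledDart V) :
    ZMod p :=
  if δ.2 then (if δ.1.2 = (ρ δ.1.1).1 then (ρ δ.1.1).2 else g δ.1.1 - (ρ δ.1.1).2)
  else -(if δ.1.2 = (ρ δ.1.1).1 then (ρ δ.1.1).2 else g δ.1.1 - (ρ δ.1.1).2)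

theorem DoubledDart.value_symm (ρ : V × V → Bool × ZMod p) (g : V × V → ZMod p)
    (δ : DoubledDart V) : δ.symm.value ρ g = -δ.value ρ g := by
  rcases δ with ⟨⟨e, b⟩, _ | _⟩ <;> simp [DoubledDart.value, DoubledDart.symm]

theorem DoubledDart.value_congr (ρ : V × V → Bool × ZMod p) {g g' : V × V → ZMod p}
    {δ : DoubledDart V} (h : g δ.1.1 = g' δ.1.1) : δ.value ρ g = δ.value ρ g' := by
  simp [DoubledDart.value, h]

/-- The two copies of an edge add up to `g e` whatever `ρ` fixes. So after any restriction the
vertex constraints are those of the undoubled graph, which is why edges are doubled. -/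
theorem DoubledDart.sum_value [Fintype V] [DecidableEq V] (ρ : V × V → Bool × ZMod p)
    (g : V × V → ZMod p) (v : V) :
    ∑ δ ∈ Finset.univ.filter (fun δ : DoubledDart V => δ.fst = v), δ.value ρ g =
      ∑ w, g (v, w) - ∑ w, g (w, v) := by
  have e : ∀ e : V × V, ∑ b : Bool, ∑ o : Bool,
      (if DoubledDart.fst ((e, b), o) = v then DoubledDart.value ρ g ((e, b), o) else 0) =
      (if e.1 = v then g e else 0) - if e.2 = v then g e else 0 := by
    intro e
    simp only [Fintype.sum_bool, DoubledDart.fst, DoubledDart.value]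
    rcases (ρ e).1 <;> by_cases h₁ : e.1 = v <;> by_cases h₂ : e.2 = v <;>
      simp only [h₁, h₂, if_true, if_false, reduceCtorEq, Bool.false_eq_true] <;> ring
  rw [Finset.sum_filter, Fintype.sum_prod_type, Fintype.sum_prod_type,
    Finset.sum_congr rfl fun x _ => e x, Finset.sum_sub_distrib, Fintype.sum_prod_type,
    Fintype.sum_prod_type]
  congr 1
  · rw [Finset.sum_comm]
    simp
  · simp

theorem DoubledDart.card_filter_fst_le [Fintype V] [DecidableEq V] (v : V) :
    (Finset.univ.filter fun δ : DoubledDart V => δ.fst = v).card ≤ 4 * Fintype.card V := by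
  classical
  have hsub : (Finset.univ.filter fun δ : DoubledDart V => δ.fst = v) ⊆
      Finset.univ.image fun t : V × Bool × Bool =>
        (((if t.2.2 then (v, t.1) else (t.1, v)), t.2.1), t.2.2) := by
    rintro ⟨⟨⟨w, w'⟩, b⟩, _ | _⟩ h
    · obtain rfl : w' = v := (Finset.mem_filter.1 h).2
      exact Finset.mem_image.2 ⟨(w, b, false), Finset.mem_univ _, rfl⟩
    · obtain rfl : w = v := (Finset.mem_filter.1 h).2
      exact Finset.mem_image.2 ⟨(w', b, true), Finset.mem_univ _, rfl⟩
  refine (Finset.card_le_card hsub).trans (Finset.card_image_le.trans ?_)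
  simp only [Finset.card_univ, Fintype.card_prod, Fintype.card_bool]
  omega

/-- The truth values of the variables under a restriction and an assignment. -/
def restrictedTruth (ν : DoubledDart V × ZMod p ↪ σ) (ρ : V × V → Bool × ZMod p)
    (g : V × V → ZMod p) (x : σ) : Prop :=
  ∃ δ : DoubledDart V, ν (δ, δ.value ρ g) = x

variable (ν : DoubledDart V × ZMod p ↪ σ) (ρ : V × V → Bool × ZMod p) (g : V × V → ZMod p)

theorem restrictedTruth_apply (δ : DoubledDart V) (i : ZMod p) :
    restrictedTruth ν ρ g (ν (δ, i)) ↔ δ.value ρ g = i := by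
  constructor
  · rintro ⟨δ', h⟩
    rw [EmbeddingLike.apply_eq_iff_eq, Prod.mk.injEq] at h
    rw [← h.1]
    exact h.2
  · rintro rfl
    exact ⟨δ, rfl⟩

theorem restrictedTruth_congr {g g' : V × V → ZMod p} {x : σ}
    (h : ∀ (δ : DoubledDart V) (i : ZMod p), ν (δ, i) = x → g δ.1.1 = g' δ.1.1) :
    restrictedTruth ν ρ g x ↔ restrictedTruth ν ρ g' x := by
  constructor
  · rintro ⟨δ, rfl⟩
    exact ⟨δ, by rw [DoubledDart.value_congr ρ (h δ _ rfl)]⟩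
  · rintro ⟨δ, rfl⟩
    exact ⟨δ, by rw [DoubledDart.value_congr ρ (h δ _ rfl)]⟩

open Classical in
/-- The values of the variables `x` and `x̄` of PCR under a restriction and an assignment. -/
def restrictedValue (K : Type*) [Field K] : σ ⊕ σ → K :=
  Sum.elim (fun x => if restrictedTruth ν ρ g x then 1 else 0)
    (fun x => if restrictedTruth ν ρ g x then 0 else 1)

variable {K : Type*} [Field K]

theorem restrictedValue_literal (l : σ × Bool) :
    restrictedValue ν ρ g K (if l.2 then Sum.inr l.1 else Sum.inl l.1) = 0 ↔
      (restrictedTruth ν ρ g l.1 ↔ l.2 = true) := by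
  rcases l with ⟨x, _ | _⟩ <;> simp [restrictedValue]

theorem restrictedValue_congr {g g' : V × V → ZMod p} {z : σ ⊕ σ}
    (h : ∀ (δ : DoubledDart V) (i : ZMod p), ν (δ, i) = z.elim id id → g δ.1.1 = g' δ.1.1) :
    restrictedValue ν ρ g K z = restrictedValue ν ρ g' K z := by
  have h' := restrictedTruth_congr ν ρ h
  rcases z with x | x <;> simp only [Sum.elim_inl, Sum.elim_inr, id] at h' <;>
    by_cases h₀ : restrictedTruth ν ρ g x <;> have h₁ := h₀ <;> rw [h'] at h₁ <;>
    simp [restrictedValue, h₀, h₁]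

theorem exists_restrictedValue_eq [Nonempty V] (z : σ ⊕ σ) :
    ∃ (e : V × V) (h : ZMod p → K), ∀ g, restrictedValue ν ρ g K z = h (g e) := by
  by_cases hz : ∃ (δ : DoubledDart V) (i : ZMod p), ν (δ, i) = z.elim id id
  · obtain ⟨δ, i, hδ⟩ := hz
    refine ⟨δ.1.1, fun s => restrictedValue ν ρ (fun _ => s) K z, fun g =>
      restrictedValue_congr ν ρ fun δ' i' h => ?_⟩
    rw [← hδ, EmbeddingLike.apply_eq_iff_eq, Prod.mk.injEq] at h
    rw [h.1]
  · obtain ⟨v⟩ := ‹Nonempty V›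
    refine ⟨(v, v), fun s => restrictedValue ν ρ (fun _ => s) K z, fun g =>
      restrictedValue_congr ν ρ fun δ' i' h => ?_⟩
    exact absurd ⟨δ', i', h⟩ hz

/-- Let the restriction fix the very copy to which the variable belongs: to `i + 1`, different from
`i` as `p ≥ 2`, for a positive variable, to `i` for a complement, with the sign of the orientation.
One of `2 * p` choices at the edge thus kills the variable. -/
theorem exists_restrictedValue_eq_zero (hp : 2 ≤ p) {z : σ ⊕ σ} {δ : DoubledDart V} {i : ZMod p}
    (hz : ν (δ, i) = z.elim id id) :
    ∃ κ : Bool × ZMod p, ∀ ρ g, ρ δ.1.1 = κ → restrictedValue ν ρ g K z = 0 := by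
  have : Fact (1 < p) := ⟨hp⟩
  rcases z with x | x
  · obtain rfl : ν (δ, i) = x := hz
    refine ⟨(δ.1.2, if δ.2 then i + 1 else -(i + 1)), fun ρ g h => ?_⟩
    have : ¬ restrictedTruth ν ρ g (ν (δ, i)) := by
      rw [restrictedTruth_apply, DoubledDart.value, h]
      rcases δ with ⟨e, _ | _⟩ <;> simp
    simp [restrictedValue, this]
  · obtain rfl : ν (δ, i) = x := hz
    refine ⟨(δ.1.2, if δ.2 then i else -i), fun ρ g h => ?_⟩
    have : restrictedTruth ν ρ g (ν (δ, i)) := by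
      rw [restrictedTruth_apply, DoubledDart.value, h]
      rcases δ with ⟨e, _ | _⟩ <;> simp
    simp [restrictedValue, this]

theorem aeval_restrictedValue_pcrPoly {F : Type*} [Field F] [Algebra F K] (g : V × V → ZMod p)
    (C : Clause σ) :
    aeval (restrictedValue ν ρ g K) (Clause.pcrPoly F C) = 0 ↔
      ∃ l ∈ C, (restrictedTruth ν ρ g l.1 ↔ l.2 = true) := by
  rw [Clause.pcrPoly, map_prod, Finset.prod_eq_zero_iff]
  simp only [aeval_X, restrictedValue_literal]

end Restriction

/-! ### Size lower bound for PCR -/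

section SizeBound

variable {V σ F K : Type*} [Fintype V] [DecidableEq V] [DecidableEq σ] [Field F] [Field K]
  [Algebra F K] {p : ℕ} [NeZero p] {ψ : AddChar (ZMod p) K} (ν : DoubledDart V × ZMod p ↪ σ)
  (ρ : V × V → Bool × ZMod p) (charge : V → ZMod p) {d : ℕ}

theorem classSumsVanish_aeval_axiom (hψ : ∀ s, ψ s = 1 → s = 0) (hV : 3 < Fintype.card V)
    (hd : 9 * (2 * Fintype.card V + (d + 2 * Fintype.card V)) < 4 * Fintype.card V ^ 2)
    {q : MvPolynomial (σ ⊕ σ) F}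
    (hq : q ∈ cnfPCRPolys F (dartCNF ν DoubledDart.fst DoubledDart.symm charge) ∪ pcrAxioms F σ) :
    ClassSumsVanish ψ charge d fun g => aeval (restrictedValue ν ρ g K) q := by
  have hzero : (∀ g, aeval (restrictedValue ν ρ g K) q = 0) →
      ClassSumsVanish ψ charge d fun g => aeval (restrictedValue ν ρ g K) q := by
    intro h
    rw [funext h]
    exact classSumsVanish_zero ψ charge d
  rcases hq with ⟨C, hC, rfl⟩ | ⟨x, rfl⟩ | ⟨x, rfl⟩
  · rcases hC with ((⟨δ, rfl⟩ | ⟨δ, i, j, hij, rfl⟩) | ⟨δ, i, rfl⟩) | ⟨v, j, hj, rfl⟩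
    · refine hzero fun g => (aeval_restrictedValue_pcrPoly ν ρ g _).2 ?_
      refine ⟨(ν (δ, δ.value ρ g), true), Finset.mem_map.2 ⟨_, Finset.mem_univ _, rfl⟩, ?_⟩
      simp [restrictedTruth_apply]
    · refine hzero fun g => (aeval_restrictedValue_pcrPoly ν ρ g _).2 ?_
      by_cases h : δ.value ρ g = i
      · refine ⟨(ν (δ, j), false), by simp, ?_⟩
        simp [restrictedTruth_apply, h, hij]
      · refine ⟨(ν (δ, i), false), by simp, ?_⟩
        simp [restrictedTruth_apply, h]
    · refine hzero fun g => (aeval_restrictedValue_pcrPoly ν ρ g _).2 ?_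
      by_cases h : δ.value ρ g = i
      · refine ⟨(ν (δ.symm, -i), true), by simp, ?_⟩
        simp [restrictedTruth_apply, DoubledDart.value_symm, h]
      · refine ⟨(ν (δ, i), false), by simp, ?_⟩
        simp [restrictedTruth_apply, h]
    · refine classSumsVanish_of_constraint ψ charge hψ v (fun g g' h => ?_) (fun g h => ?_) hV hd
      · simp only [Clause.pcrPoly, map_prod, aeval_X]
        refine Finset.prod_congr rfl fun l hl => ?_
        obtain ⟨δ, hδ, rfl⟩ := Finset.mem_image.1 hl
        refine restrictedValue_congr ν ρ fun δ' i hi => ?_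
        have hi' : ν (δ', i) = ν (δ, j δ) := hi
        rw [EmbeddingLike.apply_eq_iff_eq, Prod.mk.injEq] at hi'
        rw [hi'.1]
        obtain rfl : δ.fst = v := (Finset.mem_filter.1 hδ).2
        rcases δ with ⟨⟨⟨w, w'⟩, b⟩, _ | _⟩
        · exact (h w).2
        · exact (h w').1
      · rw [Ne, aeval_restrictedValue_pcrPoly] at h
        push Not at h
        rw [← DoubledDart.sum_value ρ g v, Finset.sum_congr rfl fun δ hδ => ?_]
        · exact hj
        · have := h _ (Finset.mem_image.2 ⟨δ, hδ, rfl⟩)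
          simpa [restrictedTruth_apply] using this
  · refine hzero fun g => ?_
    by_cases h : restrictedTruth ν ρ g x <;> simp [restrictedValue, h]
  · refine hzero fun g => ?_
    by_cases h : restrictedTruth ν ρ g x <;> simp [restrictedValue, h]

theorem card_support_biUnion_le_pcrSize [DecidableEq (MvPolynomial (σ ⊕ σ) F)]
    (π : List (MvPolynomial (σ ⊕ σ) F)) :
    (π.toFinset.biUnion fun q => q.support).card ≤ pcrSize π := by
  refine Finset.card_biUnion_le.trans ?_
  induction π with
  | nil => simp
  | cons q π ih =>
    rw [pcrSize, List.map_cons, List.sum_cons, List.toFinset_cons]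
    by_cases h : q ∈ π.toFinset
    · rw [Finset.insert_eq_of_mem h]
      exact ih.trans (Nat.le_add_left _ _)
    · rw [Finset.sum_insert h]
      exact Nat.add_le_add_left ih _

/-- If the proof were smaller, one restriction would kill every monomial that touches more than `d`
edges. All lines would then have Fourier degree at most `d`, contradicting the degree bound. -/
theorem pow_le_pcrSize_mul_pow (hψ : ∀ s, ψ s = 1 → s = 0) (hp : 2 ≤ p) (hpK : (p : K) ≠ 0)
    (hV : 3 < Fintype.card V) (hd : 9 * (d + (d + 1)) < 4 * Fintype.card V ^ 2)
    (hd' : 9 * (2 * Fintype.card V + (d + 2 * Fintype.card V)) < 4 * Fintype.card V ^ 2)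
    {π : List (MvPolynomial (σ ⊕ σ) F)}
    (hπ : IsPCRProof (cnfPCRPolys F (dartCNF ν DoubledDart.fst DoubledDart.symm charge)) π 1) :
    (2 * p) ^ (d + 1) ≤ pcrSize π * (2 * p - 1) ^ (d + 1) := by
  classical
  by_contra! hlt
  let touches : V × V → σ ⊕ σ → Prop := fun e z =>
    ∃ (δ : DoubledDart V) (i : ZMod p), ν (δ, i) = z.elim id id ∧ δ.1.1 = e
  let T : (σ ⊕ σ →₀ ℕ) → Finset (V × V) := fun m =>
    Finset.univ.filter fun e => ∃ z ∈ m.support, touches e z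
  let S := (π.toFinset.biUnion fun q => q.support).filter fun m => d + 1 ≤ (T m).card
  have hκ : ∀ (m : σ ⊕ σ →₀ ℕ) (e : V × V), ∃ κ : Bool × ZMod p, e ∈ T m →
      ∀ ρ : V × V → Bool × ZMod p, ρ e = κ →
        ∃ z ∈ m.support, ∀ g, restrictedValue ν ρ g K z = 0 := by
    intro m e
    by_cases he : e ∈ T m
    · obtain ⟨z, hz, δ, i, hδ, rfl⟩ := (Finset.mem_filter.1 he).2
      obtain ⟨κ, h⟩ := exists_restrictedValue_eq_zero (K := K) ν hp hδ
      exact ⟨κ, fun _ ρ hρ => ⟨z, hz, fun g => h ρ g hρ⟩⟩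
    · exact ⟨0, fun h => absurd h he⟩
  choose κ hκ using hκ
  have hcard : Fintype.card (Bool × ZMod p) = 2 * p := by
    rw [Fintype.card_prod, Fintype.card_bool, ZMod.card]
  obtain ⟨ρ, hρ⟩ := exists_forall_exists_eq S T κ (k := d + 1)
    (fun m hm => (Finset.mem_filter.1 hm).2) (by
      rw [hcard]
      refine lt_of_le_of_lt (Nat.mul_le_mul_right _ ?_) hlt
      exact (Finset.card_filter_le _ _).trans (card_support_biUnion_le_pcrSize π))
  have : Nonempty V := Fintype.card_pos_iff.1 (by omega)
  refine not_isPCDerivation_one_of_hasFourierDegree (c := charge) (d := d) hψ hpK (by omega) hd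
    (exists_restrictedValue_eq ν ρ)
    (fun q hq => classSumsVanish_aeval_axiom ν ρ charge hψ hV hd' hq) (fun q hq => ?_) hπ
  refine hasFourierDegree_aeval hψ T q (fun m _ g g' h z hz => ?_) fun m hm => ?_
  · exact restrictedValue_congr ν ρ fun δ i hδ =>
      h _ (Finset.mem_filter.2 ⟨Finset.mem_univ _, z, hz, δ, i, hδ, rfl⟩)
  · rcases Nat.lt_or_ge d (T m).card with h | h
    · obtain ⟨e, he, hκe⟩ := hρ m (Finset.mem_filter.2
        ⟨Finset.mem_biUnion.2 ⟨q, List.mem_toFinset.2 hq, hm⟩, h⟩)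
      exact .inr (hκ m e he ρ hκe)
    · exact .inl h

end SizeBound

/-! ### Simply exponential versus quadratic-exponential growth -/

section Growth

/-- Functions of at most simply exponential growth. -/
def ExpBounded (f : ℕ → ℕ) : Prop := ∃ C, ∀ m, f m ≤ C ^ (m + 1)

theorem ExpBounded.const (c : ℕ) : ExpBounded fun _ => c := by
  refine ⟨c + 1, fun m => c.le_succ.trans ?_⟩
  exact Nat.le_self_pow (Nat.succ_ne_zero m) _

theorem ExpBounded.id : ExpBounded fun m => m :=
  ⟨2, fun m => m.le_succ.trans (Nat.lt_two_pow_self (n := m + 1)).le⟩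

theorem ExpBounded.add {f g : ℕ → ℕ} (hf : ExpBounded f) (hg : ExpBounded g) :
    ExpBounded fun m => f m + g m := by
  obtain ⟨A, hA⟩ := hf
  obtain ⟨B, hB⟩ := hg
  exact ⟨A + B, fun m => (Nat.add_le_add (hA m) (hB m)).trans
    (pow_add_pow_le (Nat.zero_le _) (Nat.zero_le _) (Nat.succ_ne_zero m))⟩

theorem ExpBounded.mul {f g : ℕ → ℕ} (hf : ExpBounded f) (hg : ExpBounded g) :
    ExpBounded fun m => f m * g m := by
  obtain ⟨A, hA⟩ := hf
  obtain ⟨B, hB⟩ := hg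
  exact ⟨A * B, fun m => (Nat.mul_le_mul (hA m) (hB m)).trans (mul_pow A B _).ge⟩

theorem ExpBounded.const_pow (c k : ℕ) : ExpBounded fun m => c ^ (k * m) := by
  refine ⟨(c + 1) ^ k, fun m => ?_⟩
  rw [← pow_mul]
  exact (Nat.pow_le_pow_left c.le_succ _).trans
    (Nat.pow_le_pow_right c.succ_pos (Nat.mul_le_mul_left _ m.le_succ))

theorem ExpBounded.polynomial_eval (B : Polynomial ℕ) {f : ℕ → ℕ} (hf : ExpBounded f) :
    ExpBounded fun m => B.eval (f m) := by
  induction B using Polynomial.induction_on' with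
  | add p q hp hq => simpa only [Polynomial.eval_add] using hp.add hq
  | monomial n a =>
    simp only [Polynomial.eval_monomial]
    refine (ExpBounded.const a).mul ?_
    induction n with
    | zero => simpa only [pow_zero] using ExpBounded.const 1
    | succ n ih => simpa only [pow_succ] using ih.mul hf

theorem Polynomial.eval_mono_nat (B : Polynomial ℕ) {s t : ℕ} (h : s ≤ t) :
    B.eval s ≤ B.eval t := by
  rw [Polynomial.eval_eq_sum_range, Polynomial.eval_eq_sum_range]
  gcongr

theorem expBounded_tseitinBound (p : ℕ) :
    ExpBounded fun m => tseitinBound p (12 * m) (3 * m) (36 * m * m) := by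
  unfold tseitinBound localCertLength
  repeat' first
    | with_reducible exact ExpBounded.const _
    | with_reducible exact ExpBounded.id
    | with_reducible exact ExpBounded.const_pow _ _
    | with_reducible apply ExpBounded.add
    | with_reducible apply ExpBounded.mul

theorem ExpBounded.exists_lt_pow {f : ℕ → ℕ} (hf : ExpBounded f) {a : ℕ} (ha : 0 < a) :
    ∃ m, 5 ≤ m ∧ f m * a ^ (m ^ 2 + 1) < (a + 1) ^ (m ^ 2 + 1) := by
  obtain ⟨C, hC⟩ := hf
  have ha' : (0 : ℝ) < a := Nat.cast_pos.2 ha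
  have hq : 1 < ((a + 1 : ℕ) : ℝ) / a := by
    rw [one_lt_div ha']
    exact_mod_cast a.lt_succ_self
  obtain ⟨k, hk⟩ := pow_unbounded_of_one_lt (C : ℝ) hq
  -- The base `C` is below the `k`-th power of the ratio, and `k * (k + 6)` is at most `(k + 5) ^ 2
  -- + 1`.
  refine ⟨k + 5, by omega, ?_⟩
  have h₁ : ((f (k + 5) : ℕ) : ℝ) < (((a + 1 : ℕ) : ℝ) / a) ^ ((k + 5) ^ 2 + 1) := by
    calc ((f (k + 5) : ℕ) : ℝ) ≤ (C : ℝ) ^ (k + 5 + 1) := by exact_mod_cast hC (k + 5)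
      _ < ((((a + 1 : ℕ) : ℝ) / a) ^ k) ^ (k + 5 + 1) :=
        pow_lt_pow_left₀ hk (Nat.cast_nonneg _) (Nat.succ_ne_zero _)
      _ = (((a + 1 : ℕ) : ℝ) / a) ^ (k * (k + 5 + 1)) := (pow_mul _ _ _).symm
      _ ≤ _ := pow_le_pow_right₀ hq.le (by nlinarith)
  rw [div_pow, lt_div_iff₀ (pow_pos ha' _)] at h₁
  exact_mod_cast h₁

end Growth

/-! ### The separation and the final bounds -/

theorem exists_residue_character (F : Type*) [Field F] :
    ∃ p : ℕ, 2 ≤ p ∧ (p : AlgebraicClosure F) ≠ 0 ∧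
      ∃ ψ : AddChar (ZMod p) (AlgebraicClosure F), ∀ s, ψ s = 1 → s = 0 := by
  have h : ∃ p : ℕ, 2 ≤ p ∧ (p : F) ≠ 0 := by
    by_cases h2 : (2 : F) = 0
    · refine ⟨3, by norm_num, fun h3 => one_ne_zero (α := F) ?_⟩
      push_cast at h3
      linear_combination h3 - h2
    · exact ⟨2, le_rfl, by exact_mod_cast h2⟩
  obtain ⟨p, hp, hpF⟩ := h
  have : NeZero p := ⟨by omega⟩
  have : NeZero (p : F) := ⟨hpF⟩
  have hpK : (p : AlgebraicClosure F) ≠ 0 := by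
    rw [← map_natCast (algebraMap F (AlgebraicClosure F))]
    exact (map_ne_zero _).2 hpF
  obtain ⟨ζ, hζ⟩ := HasEnoughRootsOfUnity.exists_primitiveRoot (AlgebraicClosure F) p
  refine ⟨p, hp, hpK, AddChar.zmodChar p hζ.pow_eq_one, fun s hs => ?_⟩
  rw [AddChar.zmodChar_apply] at hs
  have := Nat.eq_zero_of_dvd_of_lt ((hζ.pow_eq_one_iff_dvd _).1 hs) s.val_lt
  exact (ZMod.val_eq_zero s).1 this

theorem not_pcrSystem_polySimulates_ofpcSystem (F : Type*) [Field F] [Infinite F]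
    {σ : Type*} [Infinite σ] (ord : LinearOrder σ) :
    ¬ PolySimulates (pcrSystem F σ) (ofpcSystem F ord) := by
  rintro ⟨B, hB⟩
  obtain ⟨p, hp, hpK, ψ, hψ⟩ := exists_residue_character F
  have : NeZero p := ⟨by omega⟩
  obtain ⟨m, hm, hlt⟩ := ((expBounded_tseitinBound p).polynomial_eval B).exists_lt_pow
    (a := 2 * p - 1) (by omega)
  let ν : DoubledDart (Fin (3 * m)) × ZMod p ↪ σ :=
    (Fintype.equivFin _).toEmbedding.trans (Fin.valEmbedding.trans (Infinite.natEmbedding σ))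
  let v₀ : Fin (3 * m) := ⟨0, by omega⟩
  let charge : Fin (3 * m) → ZMod p := fun v => if v = v₀ then 1 else 0
  have hcharge : ∑ v, charge v ≠ 0 := by
    have : Fact (1 < p) := ⟨hp⟩
    simp [charge]
  obtain ⟨Φs, hΦ, hsize⟩ := exists_isOFPCProof_dartCNF (F := F) (Δ := 12 * m) ν DoubledDart.fst
    DoubledDart.symm charge ord DoubledDart.symm_involutive DoubledDart.symm_ne hcharge
    (fun v => (DoubledDart.card_filter_fst_le v).trans (by rw [Fintype.card_fin]; omega))
    (by omega) (by rw [ENat.card_eq_top_of_infinite]; exact le_top)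
  obtain ⟨s, hs, π, hπ, rfl⟩ := hB _ (dartCNF_finite ν _ _ charge) _ ⟨Φs, hΦ, rfl⟩
  have hD : Fintype.card (DoubledDart (Fin (3 * m))) = 36 * m * m := by
    simp only [Fintype.card_prod, Fintype.card_fin, Fintype.card_bool]
    ring
  rw [hD, Fintype.card_fin] at hsize
  -- With 3m vertices and `d = m ^ 2`, the degree conditions read 18 m^2 + 9 < 36 m^2 and 108 m + 9
  -- m^2 < 36 m^2; the second is the reason for `5 ≤ m`.
  have hlow := pow_le_pcrSize_mul_pow (d := m ^ 2) ν charge hψ hp hpK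
    (by rw [Fintype.card_fin]; omega) (by rw [Fintype.card_fin]; nlinarith)
    (by rw [Fintype.card_fin]; nlinarith) hπ
  rw [show 2 * p - 1 + 1 = 2 * p by omega] at hlt
  exact absurd (hlow.trans (Nat.mul_le_mul_right _ (hs.trans (B.eval_mono_nat hsize))))
    (not_le.2 hlt)

theorem exists_isOFPCProof_tseitinCNF (r p : ℕ) [NeZero p] : ∃ B T : Polynomial ℕ,
    ∀ (V : Type*) [Fintype V] [DecidableEq V] (G : SimpleGraph V) [DecidableRel G.Adj],
      G.IsRegularOfDegree r →
      ∀ charge : V → ZMod p, ∑ v, charge v ≠ 0 →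
      ∀ (F : Type*) [Field F], ((T.eval (Fintype.card V) : ℕ) : ℕ∞) ≤ ENat.card F →
      ∀ ord : LinearOrder (TseitinVar G p),
        ∃ Φs : List (NCFormula F (TseitinVar G p)),
          IsOFPCProof ord (cnfPolys F (tseitinCNF G p charge)) Φs 1 ∧
          ofpcSize Φs ≤ B.eval (Fintype.card V) := by
  obtain ⟨B, hB⟩ : ∃ B : Polynomial ℕ, ∀ n, B.eval n = tseitinBound p (r + 2) n (n * r) := by
    let n : Polynomial ℕ := Polynomial.X
    let D := n * (r : Polynomial ℕ)
    let q : Polynomial ℕ := p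
    let L : Polynomial ℕ := (localCertLength p (r + 2) : ℕ)
    let l := (n + D) * (q * (L * (q * (D * q) + 1))) + 1
    let k : Polynomial ℕ := (p + (r + 2) + 5 : ℕ)
    refine ⟨l * (D * q * (2 * k + 1) + 4) *
      (l * (D * q * (4 * (2 * k + 2) + 2) + 4) + 1), fun t => ?_⟩
    simp [tseitinBound, n, D, q, L, l, k]
  obtain ⟨T, hT⟩ : ∃ T : Polynomial ℕ, ∀ n, T.eval n = p * (n * r * p) + 1 :=
    ⟨(p : Polynomial ℕ) * (Polynomial.X * (r : Polynomial ℕ) * (p : Polynomial ℕ)) + 1,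
      fun n => by simp⟩
  refine ⟨B, T, fun V _ _ G _ hG charge hcharge F _ hF ord => ?_⟩
  have hD : Fintype.card G.Dart = Fintype.card V * r := by
    rw [G.dart_card_eq_sum_degrees, Finset.sum_congr rfl fun v _ => hG.degree_eq v,
      Finset.sum_const, Finset.card_univ, smul_eq_mul]
  -- The bound `r + 2` instead of `r` covers the edge constraints too, which have two summands even
  -- for small `r`.
  obtain ⟨Φs, hΦ, hsize⟩ := exists_isOFPCProof_dartCNF (F := F) (Δ := r + 2) (.refl _)
    (fun e : G.Dart => e.fst) SimpleGraph.Dart.symm charge ord SimpleGraph.Dart.symm_involutive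
    SimpleGraph.Dart.symm_ne hcharge
    (fun v => by
      rw [G.dart_fst_fiber_card_eq_degree, hG.degree_eq]
      omega)
    (by omega) (by rwa [hD, ← hT])
  refine ⟨Φs, hΦ.mono (Set.image_mono (dartCNF_subset_tseitinCNF G charge)), ?_⟩
  rwa [hB, ← hD]

end

theorem corollary5p8 :
    -- polynomial-size OFPC refutations of the Tseitin mod `p` formulas, for any order
    (∀ (r p : ℕ) [NeZero p], ∃ B T : Polynomial ℕ,
      ∀ (V : Type*) [Fintype V] [DecidableEq V] (G : SimpleGraph V) [DecidableRel G.Adj],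
        G.IsRegularOfDegree r →
        ∀ charge : V → ZMod p, ∑ v, charge v ≠ 0 →
        ∀ (F : Type*) [Field F], ((T.eval (Fintype.card V) : ℕ) : ℕ∞) ≤ ENat.card F →
        ∀ ord : LinearOrder (TseitinVar G p),
          ∃ Φs : List (NCFormula F (TseitinVar G p)),
            IsOFPCProof ord (cnfPolys F (tseitinCNF G p charge)) Φs 1 ∧
            ofpcSize Φs ≤ B.eval (Fintype.card V)) ∧
    -- OFPC is strictly stronger than PCR
    (∀ (F : Type*) [Field F] [Infinite F] (ord : LinearOrder ℕ),
      StrictlyStronger (ofpcSystem F ord) (pcrSystem F ℕ)) :=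
  ⟨fun r p _ => exists_isOFPCProof_tseitinCNF r p, fun F _ _ ord =>
    ⟨ofpcSystem_polySimulates_pcrSystem ord, not_pcrSystem_polySimulates_ofpcSystem F ord⟩⟩
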